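/- All simplicial complexes are finite. A normal $3$-pseudomanifold is a strongly connected pure $3$-dimensional simplicial complex in which every triangle lies in exactly two tetrahedra and the links of all vertices and edges are connected. A vertex is non-singular if its link is a triangulated $2$-sphere, and singular otherwise. Let $f_0(K)$, $f_1(K)$ be the numbers of vertices and edges of $K$, and $g_2(K)=f_1(K)-4f_0(K)+10$. Consider the following operations on a normal $3$-pseudomanifold $K$. (A) If $uv$ is an edge with $\mathrm{lk}(uv)=\partial(abc)$ and $abc\notin K$, remove all faces containing $uv$ and insert $abc$, $uabc$, $vabc$. (B) Edge contraction: if $uv$ is an edge, $v$ is non-singular and $\mathrm{lk}(u)\cap\mathrm{lk}(v)=\mathrm{lk}(uv)$, identify $u$ and $v$ to a single vertex. (B$'$) Edge expansion: if $w$ is a vertex and $C$ is a cycle in $\mathrm{lk}(w)$ which separates $\mathrm{lk}(w)$ into two portions $D_1,D_2$ (with $D_1\cup D_2=\mathrm{lk}(w)$, $D_1\cap D_2=C$), one of which is a disc, remove $w$, insert two new vertices $u,v$, cone off one portion by $u$ and the other by $v$, and insert all tetrahedra spanned by $u$, $v$ and an edge of $C$. (C) If $w$ is a non-singular vertex, $\partial(abc)\subseteq\mathrm{lk}(w)$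 and $abc\notin K$, let $D_1,D_2$ be the two discs into which $\partial(abc)$ divides $\mathrm{lk}(w)$; remove $w$, insert $abc$, and cone off the spheres $D_1\cup\{abc\}$ and $D_2\cup\{abc\}$ by two new vertices. (D) An edge expansion (B$'$) followed by an edge contraction (B). Let $\mathcal R_1$ be the class of all normal $3$-pseudomanifolds $K$ with exactly one singular vertex such that (i) whenever $K$ contains all proper faces of a tetrahedron, it contains the tetrahedron, and (ii) there is no normal $3$-pseudomanifold $K'$ obtained from $K$ by one of the operations (A), (B), (C), (D) with $g_2(K')<g_2(K)$. **Theorem.** Let $K\in\mathcal R_1$, let $t$ be a vertex of $K$ and $h\ge 1$, and suppose that $|\mathrm{lk}(t,K)|$ is a connected sum of $h$ tori or a connected sum of $h$ Klein bottles. Then $f_1(K)\ge 4f_0(K)+6h$, i.e. $g_2(K)\ge 10+6h$. -/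

import Mathlib

/-
Finite simplicial complexes are finite `PreAbstractSimplicialComplex`es: sets of nonempty finite
vertex sets, closed under nonempty subsets. The vertices live in an infinite type `V`, so that new
vertices are always available; a face with `k + 1` vertices has dimension `k`.
-/
namespace SimplicialPM

/-- `f_i(K)`, the number of `i`-dimensional faces. -/
noncomputable def fNum {V : Type*} (K : PreAbstractSimplicialComplex V) (i : ℕ) : ℕ :=
  {σ : Finset V | σ ∈ K.faces ∧ σ.card = i + 1}.ncard

/-- `g_2(K) = f_1(K) - 4 f_0(K) + 10`, for a complex of dimension three. -/
noncomputable def g2 {V : Type*} (K : PreAbstractSimplicialComplex V) : ℤ :=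
  (fNum K 1 : ℤ) - 4 * (fNum K 0 : ℤ) + 10

/-! ### Basic constructions -/

/-- The simplex with vertex set `S`, with all of its faces. -/
def simplex {V : Type*} (S : Finset V) : PreAbstractSimplicialComplex V where
  faces := {σ | σ.Nonempty ∧ σ ⊆ S}
  isRelLowerSet_faces := by
    rintro σ ⟨hn, hs⟩
    exact ⟨hn, fun τ hτ hτn => ⟨hτn, Finset.Subset.trans hτ hs⟩⟩

/-- The boundary of the simplex with vertex set `S`: all proper faces. -/
def simplexBoundary {V : Type*} (S : Finset V) : PreAbstractSimplicialComplex V where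
  faces := {σ | σ.Nonempty ∧ σ ⊂ S}
  isRelLowerSet_faces := by
    rintro σ ⟨hn, hs⟩
    exact ⟨hn, fun τ hτ hτn => ⟨hτn, lt_of_le_of_lt hτ hs⟩⟩

/-- The link of `σ` in `K`. -/
def link {V : Type*} [DecidableEq V] (K : PreAbstractSimplicialComplex V) (σ : Finset V) :
    PreAbstractSimplicialComplex V where
  faces := {γ | γ.Nonempty ∧ Disjoint γ σ ∧ γ ∪ σ ∈ K.faces}
  isRelLowerSet_faces := by
    rintro γ ⟨hn, hd, hK⟩
    refine ⟨hn, fun τ hτ hτn => ⟨hτn, Finset.disjoint_of_subset_left hτ hd, ?_⟩⟩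
    exact (K.isRelLowerSet_faces hK).2 (Finset.union_subset_union_left hτ)
      (hτn.mono Finset.subset_union_left)

/-- `K` with all faces containing `A` removed. -/
def deleteStar {V : Type*} (K : PreAbstractSimplicialComplex V) (A : Finset V) :
    PreAbstractSimplicialComplex V where
  faces := {σ | σ ∈ K.faces ∧ ¬ A ⊆ σ}
  isRelLowerSet_faces := by
    rintro σ ⟨hK, hA⟩
    exact ⟨(K.isRelLowerSet_faces hK).1, fun τ hτ hτn =>
      ⟨(K.isRelLowerSet_faces hK).2 hτ hτn, fun h => hA (Finset.Subset.trans h hτ)⟩⟩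

/-- The cone over `K` with apex `a` (used for `a` not a vertex of `K`). -/
def cone {V : Type*} [DecidableEq V] (K : PreAbstractSimplicialComplex V) (a : V) :
    PreAbstractSimplicialComplex V where
  faces := {σ | σ ∈ K.faces ∨ ∃ τ : Finset V, (τ = ∅ ∨ τ ∈ K.faces) ∧ σ = insert a τ}
  isRelLowerSet_faces := by
    rintro σ (hσ | ⟨τ, hτ, rfl⟩)
    · exact ⟨(K.isRelLowerSet_faces hσ).1, fun ρ hρ hρn =>
        Or.inl ((K.isRelLowerSet_faces hσ).2 hρ hρn)⟩
    · have key : ∀ ρ : Finset V, ρ ⊆ τ → ρ = ∅ ∨ ρ ∈ K.faces := by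
        intro ρ hρ
        rcases Finset.eq_empty_or_nonempty ρ with h | h
        · exact Or.inl h
        · rcases hτ with rfl | hτ
          · exact Or.inl (Finset.subset_empty.mp hρ)
          · exact Or.inr ((K.isRelLowerSet_faces hτ).2 hρ h)
      refine ⟨Finset.insert_nonempty a τ, fun ρ hρ hρn => ?_⟩
      by_cases ha : a ∈ ρ
      · exact Or.inr ⟨ρ.erase a, key _ (Finset.subset_insert_iff.mp hρ),
          (Finset.insert_erase ha).symm⟩
      · rcases key ρ ((Finset.subset_insert_iff_of_notMem ha).mp hρ) with h | h
        · exact absurd h hρn.ne_empty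
        · exact Or.inl h

/-! ### Stellar equivalence, i.e. PL homeomorphism -/

/-- The stellar subdivision of `K` at the face `A` with new vertex `a`: the star `A * lk A` is
replaced by `a * ∂A * lk A`. -/
def starring {V : Type*} [DecidableEq V] (K : PreAbstractSimplicialComplex V)
    (A : Finset V) (a : V) : PreAbstractSimplicialComplex V where
  faces := {σ | (σ ∈ K.faces ∧ ¬ A ⊆ σ) ∨
    ∃ τ : Finset V, ¬ A ⊆ τ ∧ τ ∪ A ∈ K.faces ∧ σ = insert a τ}
  isRelLowerSet_faces := by
    rintro σ (⟨hσ, hA⟩ | ⟨τ, hA, hτ, rfl⟩)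
    · exact ⟨(K.isRelLowerSet_faces hσ).1, fun ρ hρ hρn =>
        Or.inl ⟨(K.isRelLowerSet_faces hσ).2 hρ hρn, fun h => hA (Finset.Subset.trans h hρ)⟩⟩
    · have hAn : A.Nonempty := by
        rcases Finset.eq_empty_or_nonempty A with h | h
        · exact absurd (h ▸ Finset.empty_subset τ) hA
        · exact h
      refine ⟨Finset.insert_nonempty a τ, fun ρ hρ hρn => ?_⟩
      by_cases ha : a ∈ ρ
      · have hs : ρ.erase a ⊆ τ := Finset.subset_insert_iff.mp hρ
        exact Or.inr ⟨ρ.erase a, fun h => hA (Finset.Subset.trans h hs),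
          (K.isRelLowerSet_faces hτ).2 (Finset.union_subset_union_left hs)
            (hAn.mono Finset.subset_union_right), (Finset.insert_erase ha).symm⟩
      · have hs : ρ ⊆ τ := (Finset.subset_insert_iff_of_notMem ha).mp hρ
        exact Or.inl ⟨(K.isRelLowerSet_faces hτ).2
          (Finset.Subset.trans hs Finset.subset_union_left) hρn,
          fun h => hA (Finset.Subset.trans h hs)⟩

/-- `L` is a stellar subdivision of `K`. Subdividing at a vertex renames that vertex. -/
def IsStarring {V : Type*} [DecidableEq V] (K L : PreAbstractSimplicialComplex V) : Prop :=
  ∃ (A : Finset V) (a : V), A ∈ K.faces ∧ {a} ∉ K.faces ∧ L = starring K A a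

/-- PL homeomorphism of finite complexes: a finite sequence of stellar subdivisions and inverses of
stellar subdivisions leads from `K` to `L`. As renaming a vertex is a stellar subdivision, this
includes isomorphism. -/
def PLHomeo {V : Type*} [DecidableEq V] (K L : PreAbstractSimplicialComplex V) : Prop :=
  Relation.EqvGen IsStarring K L

/-- `L` triangulates the 2-sphere. -/
def IsSphere {V : Type*} [DecidableEq V] (L : PreAbstractSimplicialComplex V) : Prop :=
  ∃ S : Finset V, S.card = 4 ∧ PLHomeo L (simplexBoundary S)

/-- `L` triangulates the 2-disc. -/
def IsDisc {V : Type*} [DecidableEq V] (L : PreAbstractSimplicialComplex V) : Prop :=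
  ∃ S : Finset V, S.card = 3 ∧ PLHomeo L (simplex S)

/-! ### Connected sums of tori and of Klein bottles -/

/-- Take the `3 × 3` grid of squares, with each square cut by a diagonal, identify bottom and top,
and identify the right side with the left side by `φ`; `gridNext φ p` is the right neighbour of
`p`. -/
def gridNext (φ : ZMod 3 → ZMod 3) (p : ZMod 3 × ZMod 3) : ZMod 3 × ZMod 3 :=
  if p.1 = 2 then (0, φ p.2) else (p.1 + 1, p.2)

/-- The upper neighbour of `p` in the grid. -/
def gridUp (p : ZMod 3 × ZMod 3) : ZMod 3 × ZMod 3 := (p.1, p.2 + 1)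

/-- The closed surface obtained from the grid: each square gives two triangles. -/
def gridSurface (φ : ZMod 3 → ZMod 3) : PreAbstractSimplicialComplex (ZMod 3 × ZMod 3) where
  faces := {σ | σ.Nonempty ∧ ∃ p : ZMod 3 × ZMod 3,
    σ ⊆ {p, gridNext φ p, gridNext φ (gridUp p)} ∨ σ ⊆ {p, gridUp p, gridNext φ (gridUp p)}}
  isRelLowerSet_faces := by
    rintro σ ⟨hn, p, hp⟩
    exact ⟨hn, fun τ hτ hτn => ⟨hτn, p, hp.imp (Finset.Subset.trans hτ) (Finset.Subset.trans hτ)⟩⟩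

/-- `L` triangulates the torus: the sides of the grid are glued by a translation. -/
def IsTorus {V : Type*} [DecidableEq V] (L : PreAbstractSimplicialComplex V) : Prop :=
  ∃ e : (ZMod 3 × ZMod 3) ↪ V, PLHomeo L ((gridSurface (fun j => j)).map e)

/-- `L` triangulates the Klein bottle: one pair of sides of the grid is glued by a reflection. -/
def IsKleinBottle {V : Type*} [DecidableEq V] (L : PreAbstractSimplicialComplex V) : Prop :=
  ∃ e : (ZMod 3 × ZMod 3) ↪ V, PLHomeo L ((gridSurface (fun j => -j)).map e)

/-- `L` is the simplicial connected sum of the surfaces `L₁` and `L₂`: these are already labelled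
so that the two triangles to be identified are the same triangle `T` and nothing else is shared, and
`T` is removed from the union. -/
def IsConnectedSum {V : Type*} (L L₁ L₂ : PreAbstractSimplicialComplex V) : Prop :=
  ∃ T : Finset V, T.card = 3 ∧ L₁ ⊓ L₂ = simplex T ∧ L.faces = (L₁ ⊔ L₂).faces \ {T}

/-- `IsSumOfCopies P h L`: `L` triangulates the connected sum of `h ≥ 1` copies of the surface that
is triangulated by the complexes satisfying `P`. -/
inductive IsSumOfCopies {V : Type*} [DecidableEq V] (P : PreAbstractSimplicialComplex V → Prop) :
    ℕ → PreAbstractSimplicialComplex V → Prop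
  | one (L : PreAbstractSimplicialComplex V) : P L → IsSumOfCopies P 1 L
  | add (h : ℕ) (L L₁ L₂ : PreAbstractSimplicialComplex V) :
      IsSumOfCopies P h L₁ → P L₂ → IsConnectedSum L L₁ L₂ → IsSumOfCopies P (h + 1) L
  | homeo (h : ℕ) (L L' : PreAbstractSimplicialComplex V) :
      IsSumOfCopies P h L → PLHomeo L L' → IsSumOfCopies P h L'

/-! ### Normal 3-pseudomanifolds -/

/-- Any two vertices are joined by a path of edges. -/
def IsConnected {V : Type*} [DecidableEq V] (K : PreAbstractSimplicialComplex V) : Prop :=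
  ∀ x y : V, {x} ∈ K.faces → {y} ∈ K.faces →
    Relation.ReflTransGen (fun a b : V => ({a, b} : Finset V) ∈ K.faces) x y

/-- Normal 3-pseudomanifolds (without boundary). -/
structure IsNormalPseudomanifold {V : Type*} [DecidableEq V]
    (K : PreAbstractSimplicialComplex V) : Prop where
  finite : K.faces.Finite
  nonempty : K.faces.Nonempty
  /-- pure of dimension three -/
  pure : ∀ σ ∈ K.faces, ∃ τ ∈ K.faces, σ ⊆ τ ∧ τ.card = 4 ∧ ∀ ρ ∈ K.faces, τ ⊆ ρ → ρ = τ
  /-- strongly connected -/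
  strong : ∀ σ ∈ K.faces, ∀ τ ∈ K.faces, σ.card = 4 → τ.card = 4 →
    Relation.ReflTransGen (fun α β : Finset V =>
      α ∈ K.faces ∧ β ∈ K.faces ∧ α.card = 4 ∧ β.card = 4 ∧ (α ∩ β).card = 3) σ τ
  /-- every triangle lies in exactly two tetrahedra -/
  two : ∀ σ ∈ K.faces, σ.card = 3 → {τ | τ ∈ K.faces ∧ τ.card = 4 ∧ σ ⊆ τ}.ncard = 2
  /-- links of vertices and edges are connected -/
  link_connected : ∀ σ ∈ K.faces, σ.card ≤ 2 → IsConnected (link K σ)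

/-- `v` is a singular vertex of `K`: its link is not a 2-sphere. -/
def IsSingular {V : Type*} [DecidableEq V] (K : PreAbstractSimplicialComplex V) (v : V) : Prop :=
  {v} ∈ K.faces ∧ ¬ IsSphere (link K {v})

/-- `v` is a non-singular vertex of `K`: its link is a 2-sphere. -/
def IsNonsingular {V : Type*} [DecidableEq V] (K : PreAbstractSimplicialComplex V) (v : V) : Prop :=
  {v} ∈ K.faces ∧ IsSphere (link K {v})

/-- `K` has no missing tetrahedron. -/
def NoMissingTetrahedra {V : Type*} (K : PreAbstractSimplicialComplex V) : Prop :=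
  ∀ S : Finset V, S.card = 4 → simplexBoundary S ≤ K → S ∈ K.faces

/-! ### The combinatorial operations -/

/-- (A) Bistellar 2-move: `lk(uv) = ∂T` for a triangle `T` which is not a face; remove all faces
containing `uv` and insert `T`, `uT` and `vT`. -/
def OpA {V : Type*} [DecidableEq V] (K K' : PreAbstractSimplicialComplex V) : Prop :=
  ∃ (u v : V) (T : Finset V), u ≠ v ∧ {u, v} ∈ K.faces ∧ T.card = 3 ∧
    link K {u, v} = simplexBoundary T ∧ T ∉ K.faces ∧
    K'.faces = (deleteStar K {u, v}).faces ∪ {T, insert u T, insert v T}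

/-- (B) Edge contraction: `uv` is an edge with `lk(u) ∩ lk(v) = lk(uv)`, where `v` is non-singular;
`u` and `v` are identified to a vertex `w`. -/
def OpB {V : Type*} [DecidableEq V] (K K' : PreAbstractSimplicialComplex V) : Prop :=
  ∃ u v w : V, u ≠ v ∧ {u, v} ∈ K.faces ∧ IsNonsingular K v ∧
    link K {u} ⊓ link K {v} = link K {u, v} ∧ {w} ∉ K.faces ∧
    K' = K.map (fun x => if x = u ∨ x = v then w else x)

/-- `C` is a cycle with `n ≥ 3` vertices. -/
def IsCycle {V : Type*} [DecidableEq V] (C : PreAbstractSimplicialComplex V) : Prop :=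
  ∃ (n : ℕ) (c : ZMod n ↪ V), 3 ≤ n ∧ C.faces = {σ | ∃ i, σ = {c i} ∨ σ = {c i, c (i + 1)}}

/-- (B') Edge expansion: a cycle `C` cuts `lk(w)` into two portions `D₁`, `D₂`, of which `D₁` is a
disc; remove `w`, cone off `D₁` by a new vertex `u` and `D₂` by a new vertex `v`, and insert all
tetrahedra spanned by `uv` and an edge of `C`. -/
def OpExpansion {V : Type*} [DecidableEq V] (K K' : PreAbstractSimplicialComplex V) : Prop :=
  ∃ (w u v : V) (C D₁ D₂ : PreAbstractSimplicialComplex V),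
    {w} ∈ K.faces ∧ {u} ∉ K.faces ∧ {v} ∉ K.faces ∧ u ≠ v ∧
    IsCycle C ∧ D₁ ⊔ D₂ = link K {w} ∧ D₁ ⊓ D₂ = C ∧ IsDisc D₁ ∧
    K' = deleteStar K {w} ⊔ cone D₁ u ⊔ cone D₂ v ⊔ cone (cone C u) v

/-- (C) `w` is non-singular and `lk(w)` contains `∂T` for a triangle `T` which is not a face of `K`.
The cycle `∂T` cuts the sphere `lk(w)` into two portions `D₁`, `D₂` (neither of them `∂T` alone);
remove `w`, insert `T`, and cone off `D₁ ∪ T` and `D₂ ∪ T` by two new vertices. -/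
def OpC {V : Type*} [DecidableEq V] (K K' : PreAbstractSimplicialComplex V) : Prop :=
  ∃ (w x₁ x₂ : V) (T : Finset V) (D₁ D₂ : PreAbstractSimplicialComplex V),
    IsNonsingular K w ∧ {x₁} ∉ K.faces ∧ {x₂} ∉ K.faces ∧ x₁ ≠ x₂ ∧
    T.card = 3 ∧ T ∉ K.faces ∧
    D₁ ⊔ D₂ = link K {w} ∧ D₁ ⊓ D₂ = simplexBoundary T ∧
    D₁ ≠ simplexBoundary T ∧ D₂ ≠ simplexBoundary T ∧
    K' = deleteStar K {w} ⊔ cone (D₁ ⊔ simplex T) x₁ ⊔ cone (D₂ ⊔ simplex T) x₂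

/-- (D) An edge expansion followed by an edge contraction. -/
def OpD {V : Type*} [DecidableEq V] (K K' : PreAbstractSimplicialComplex V) : Prop :=
  ∃ L : PreAbstractSimplicialComplex V, OpExpansion K L ∧ OpB L K'

/-- Some normal 3-pseudomanifold with smaller `g_2` is obtained from `K` by one of the operations
(A), (B), (C), (D). -/
def IsReducible {V : Type*} [DecidableEq V] (K : PreAbstractSimplicialComplex V) : Prop :=
  ∃ K' : PreAbstractSimplicialComplex V, IsNormalPseudomanifold K' ∧
    (OpA K K' ∨ OpB K K' ∨ OpC K K' ∨ OpD K K') ∧ g2 K' < g2 K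

/-- The class `R₁`. -/
structure InR1 {V : Type*} [DecidableEq V] (K : PreAbstractSimplicialComplex V) : Prop where
  normal : IsNormalPseudomanifold K
  one_singularity : ∃! v : V, IsSingular K v
  no_missing : NoMissingTetrahedra K
  irreducible : ¬ IsReducible K

end SimplicialPM

/-!
The only topological information about the link of the singular vertex `t` that is needed is its
Euler characteristic `2 - 2h`, which is computed in `IsSumOfCopies.finite_and_eulerChar` from the
invariance of the Euler characteristic under stellar subdivision. As `h ≥ 1`, the vertex `t` is
singular, so every other vertex has a spherical link.

Irreducibility gives three local rules, each because the failure of the rule permits an operation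
that lowers `g₂`.
* Every edge has degree at least four (`four_le_card_exts`): the link of an edge of degree three
  is the boundary of a triangle `T`. If `T` is not a face, then `OpA` applies; if it is a
  face, then, no tetrahedron being missing, all tetrahedra on five vertices are present and there
  are no others.
* Every edge `uv` lies in a missing triangle `uvw` (`exists_missing_triangle`): otherwise, no
  tetrahedron being missing, `lk(u) ∩ lk(v) = lk(uv)`, and `OpB` contracts the edge.
* A circuit of length three in the link of a vertex `x ≠ t` bounds a triangle of that link
  (`insert_mem_of_forall_pair`): otherwise `OpC` applies. That the circuit separates the link is the
  Jordan theorem for a circuit in a sphere, in the form of `exists_coloring`: modulo two, a closed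
  surface of Euler characteristic two has no first homology.

For each operation it has to be checked that the result is again a normal pseudomanifold. To this
end strong connectedness is replaced by connectedness of the complex and of the links of its faces
(`IsPM`), which is transported along the vertex map of the operation (`LinkConn.map`).

The rest is a count with the degrees `d`. Let `A` be the set of the `n` neighbours of `t` and `O`
the set of the vertices that are neither `t` nor in `A`. For `v ∈ A` let `i(v) = D(v) + a(v)`,
where `D(v)` is the number of chords at `v`, that is of edges `vw` with `w ∈ A` that form no
triangle with `t`, and `a(v)` is the number of neighbours of `v` in `O`. The Euler characteristic
of the link of `t` gives `∑_A d(tv) = 6n + 12h - 12`, and hence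

  `2 f₁ - 8 f₀ - 12 h = -20 + ∑_A i(v) + ∑_O (d(u) - 8)`.

The left hand side is even, so it suffices that the two sums together exceed eighteen.

A vertex `u ∈ O` has degree at least six, and `d(u) + d(v) ≥ 16` for its neighbours `v`
(`LinkSystem.six_le_card`): take a missing triangle `uvw` and count the neighbours that the links
of its edges provide. Vertices of `O` of degree six and seven are therefore surrounded by vertices
of large degree, and discharging (`LinkSystem.card_outside_le`) gives

  `6 (∑_A i(v) + ∑_O (d(u) - 8)) ≥ 2 ∑_A (3 D(v) + 2 a(v))`.

It remains to show that the weights `3 D(v) + 2 a(v)` of the vertices of `A` add up to at least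
`55`. Every `D(v)` is positive, since the edge `vt` lies in a missing triangle, and the link of a
chord `vw` is covered by the further chords at `v` and `w` and the outer neighbours of `v`
(`LinkSystem.chord_link_subset`). Thus a vertex of small weight has a chord to a vertex with many
chords, and this decides each of the cases `n = 8`, `9`, `10` and `n ≥ 11`
(`LinkSystem.sum_weight_of_not_pendant`). The exception are vertices with `i(v) = 1`; the link of
such a vertex is a suspension with apices `t` and `w`, so that `w` has at least five chords
(`LinkSystem.sum_weight_of_pendant`).
-/

namespace SimplicialPM

variable {V : Type*} [DecidableEq V]

/-! ### Links, cofaces and normal pseudomanifolds of any dimension -/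

theorem face_mono {K : PreAbstractSimplicialComplex V} {σ τ : Finset V} (hσ : σ ∈ K.faces)
    (h : τ ⊆ σ) (hτ : τ.Nonempty) : τ ∈ K.faces :=
  (K.isRelLowerSet_faces hσ).2 h hτ

theorem face_nonempty {K : PreAbstractSimplicialComplex V} {σ : Finset V} (hσ : σ ∈ K.faces) :
    σ.Nonempty :=
  (K.isRelLowerSet_faces hσ).1

theorem face_congr {K : PreAbstractSimplicialComplex V} {σ τ : Finset V} (hσ : σ ∈ K.faces)
    (h : σ = τ) : τ ∈ K.faces :=
  h ▸ hσ

/-- `p` is a vertex of the link of `σ`; here `σ` may be empty. -/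
def Ext (K : PreAbstractSimplicialComplex V) (σ : Finset V) (p : V) : Prop :=
  p ∉ σ ∧ insert p σ ∈ K.faces

/-- `a` and `b` are equal or adjacent vertices of the link of `σ`; here `σ` may be empty. -/
def LinkAdj (K : PreAbstractSimplicialComplex V) (σ : Finset V) (a b : V) : Prop :=
  a ∉ σ ∧ b ∉ σ ∧ insert a (insert b σ) ∈ K.faces

/-- `a` and `b` are joined by an edge path in the link of `σ`. -/
def LinkPath (K : PreAbstractSimplicialComplex V) (σ : Finset V) : V → V → Prop :=
  Relation.ReflTransGen (LinkAdj K σ)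

/-- The link of `σ` is connected; for `σ = ∅` this says that `K` is connected. -/
def LinkConn (K : PreAbstractSimplicialComplex V) (σ : Finset V) : Prop :=
  ∀ a b, Ext K σ a → Ext K σ b → LinkPath K σ a b

/-- Exactly two faces are obtained from `σ` by adding one vertex. -/
def TwoExt (K : PreAbstractSimplicialComplex V) (σ : Finset V) : Prop :=
  ∃ p q, p ≠ q ∧ ∀ r, Ext K σ r ↔ r = p ∨ r = q

/-- Normal `d`-pseudomanifolds, with strong connectedness replaced by connectedness of the complex
and of the links of all faces of codimension at least two. -/
structure IsPM (d : ℕ) (K : PreAbstractSimplicialComplex V) : Prop where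
  finite : K.faces.Finite
  nonempty : K.faces.Nonempty
  dim : ∀ σ ∈ K.faces, σ.card ≤ d + 1
  pure : ∀ σ ∈ K.faces, ∃ τ ∈ K.faces, σ ⊆ τ ∧ τ.card = d + 1
  two : ∀ σ ∈ K.faces, σ.card = d → TwoExt K σ
  conn : ∀ σ, σ = ∅ ∨ σ ∈ K.faces → σ.card + 1 ≤ d → LinkConn K σ

theorem LinkAdj.symm {K : PreAbstractSimplicialComplex V} {σ : Finset V} {a b : V}
    (h : LinkAdj K σ a b) : LinkAdj K σ b a :=
  ⟨h.2.1, h.1, Finset.insert_comm a b σ ▸ h.2.2⟩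

theorem LinkPath.symm {K : PreAbstractSimplicialComplex V} {σ : Finset V} {a b : V}
    (h : LinkPath K σ a b) : LinkPath K σ b a := by
  induction h with
  | refl => exact .refl
  | tail _ h ih => exact .head h.symm ih

theorem LinkAdj.left {K : PreAbstractSimplicialComplex V} {σ : Finset V} {a b : V}
    (h : LinkAdj K σ a b) : Ext K σ a :=
  ⟨h.1, face_mono h.2.2 (by grind) (by simp)⟩

theorem LinkAdj.right {K : PreAbstractSimplicialComplex V} {σ : Finset V} {a b : V}
    (h : LinkAdj K σ a b) : Ext K σ b :=
  h.symm.left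

/-- A vertex map that sends adjacent vertices of a link to joined vertices of another link sends
joined vertices to joined vertices. -/
theorem LinkPath.map {K K' : PreAbstractSimplicialComplex V} {σ σ' : Finset V} {a b : V}
    (h : LinkPath K σ a b) (φ : V → V)
    (hφ : ∀ a b, LinkAdj K σ a b → LinkPath K' σ' (φ a) (φ b)) : LinkPath K' σ' (φ a) (φ b) := by
  induction h with
  | refl => exact .refl
  | tail _ h ih => exact ih.trans (hφ _ _ h)

theorem LinkConn.map {K K' : PreAbstractSimplicialComplex V} {σ σ' : Finset V}
    (h : LinkConn K σ) (φ : V → V)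
    (hφ : ∀ a b, LinkAdj K σ a b → LinkPath K' σ' (φ a) (φ b))
    (hs : ∀ y, Ext K' σ' y → ∃ a, Ext K σ a ∧ LinkPath K' σ' (φ a) y) : LinkConn K' σ' := by
  intro x y hx hy
  obtain ⟨a, ha, hax⟩ := hs x hx
  obtain ⟨b, hb, hby⟩ := hs y hy
  exact hax.symm.trans (((h a b ha hb).map φ hφ).trans hby)

theorem mem_link {K : PreAbstractSimplicialComplex V} {σ γ : Finset V} :
    γ ∈ (link K σ).faces ↔ γ.Nonempty ∧ Disjoint γ σ ∧ γ ∪ σ ∈ K.faces :=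
  Iff.rfl

theorem ext_link {K : PreAbstractSimplicialComplex V} {σ τ : Finset V} {p : V}
    (h : Disjoint τ σ) : Ext (link K σ) τ p ↔ Ext K (τ ∪ σ) p := by
  unfold Ext
  rw [mem_link, ← Finset.insert_union, Finset.disjoint_insert_left, Finset.mem_union]
  have := Finset.insert_nonempty p τ
  tauto

theorem linkAdj_link {K : PreAbstractSimplicialComplex V} {σ τ : Finset V} {p q : V}
    (h : Disjoint τ σ) : LinkAdj (link K σ) τ p q ↔ LinkAdj K (τ ∪ σ) p q := by
  unfold LinkAdj
  rw [mem_link, ← Finset.insert_union, ← Finset.insert_union, Finset.disjoint_insert_left,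
    Finset.disjoint_insert_left, Finset.mem_union, Finset.mem_union]
  have := Finset.insert_nonempty p (insert q τ)
  tauto

theorem linkConn_link {K : PreAbstractSimplicialComplex V} {σ τ : Finset V}
    (h : Disjoint τ σ) : LinkConn (link K σ) τ ↔ LinkConn K (τ ∪ σ) := by
  have : LinkAdj (link K σ) τ = LinkAdj K (τ ∪ σ) := by
    ext p q; exact linkAdj_link h
  simp only [LinkConn, LinkPath, ext_link h, this]

theorem isConnected_iff {K : PreAbstractSimplicialComplex V} :
    IsConnected K ↔ LinkConn K ∅ := by
  have : (fun a b : V => ({a, b} : Finset V) ∈ K.faces) = LinkAdj K ∅ := by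
    ext a b; simp [LinkAdj]
  simp [IsConnected, LinkConn, LinkPath, this, Ext]

theorem isConnected_link_iff {K : PreAbstractSimplicialComplex V} {σ : Finset V} :
    IsConnected (link K σ) ↔ LinkConn K σ := by
  rw [isConnected_iff, linkConn_link (Finset.disjoint_empty_left σ), Finset.empty_union]

/-- The link of a vertex of a normal pseudomanifold is a normal pseudomanifold. -/
theorem IsPM.link {d : ℕ} {K : PreAbstractSimplicialComplex V} (h : IsPM (d + 1) K) {v : V}
    (hv : {v} ∈ K.faces) : IsPM d (link K {v}) := by
  have key : ∀ γ ∈ (SimplicialPM.link K {v}).faces, v ∉ γ ∧ γ ∪ {v} ∈ K.faces ∧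
      (γ ∪ {v}).card = γ.card + 1 := by
    rintro γ ⟨-, hd, hK⟩
    exact ⟨by simpa using hd, hK, by rw [Finset.card_union_of_disjoint hd]; simp⟩
  refine ⟨?_, ?_, ?_, ?_, ?_, ?_⟩
  · refine (h.finite.image fun σ => σ.erase v).subset ?_
    intro γ hγ
    obtain ⟨h1, h2, -⟩ := key γ hγ
    exact ⟨_, h2, by grind⟩
  · obtain ⟨τ, hτ, hvτ, hc⟩ := h.pure _ hv
    have he : τ.erase v ∪ {v} = τ := by
      rw [Finset.union_comm, ← Finset.insert_eq, Finset.insert_erase (by simpa using hvτ)]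
    refine ⟨τ.erase v, ?_, by simp, face_congr hτ he.symm⟩
    rw [← Finset.card_pos, Finset.card_erase_of_mem (by simpa using hvτ)]
    omega
  · intro γ hγ
    obtain ⟨h1, h2, h3⟩ := key γ hγ
    have := h.dim _ h2
    omega
  · intro γ hγ
    obtain ⟨h1, h2, h3⟩ := key γ hγ
    obtain ⟨τ, hτ, hs, hc⟩ := h.pure _ h2
    have hvτ : v ∈ τ := hs (by simp)
    have hc' : (τ.erase v).card = d + 1 := by rw [Finset.card_erase_of_mem hvτ]; omega
    have he : τ.erase v ∪ {v} = τ := by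
      rw [Finset.union_comm, ← Finset.insert_eq, Finset.insert_erase hvτ]
    refine ⟨τ.erase v, ⟨by rw [← Finset.card_pos]; omega, by simp, face_congr hτ he.symm⟩, ?_, hc'⟩
    exact fun x hx => Finset.mem_erase.mpr ⟨fun e => h1 (e ▸ hx), hs (Finset.mem_union_left _ hx)⟩
  · intro γ hγ hc
    obtain ⟨h1, h2, h3⟩ := key γ hγ
    obtain ⟨p, q, hpq, hr⟩ := h.two _ h2 (by omega)
    exact ⟨p, q, hpq, fun r => by rw [ext_link (by simpa using h1), hr]⟩
  · intro γ hγ hc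
    have h1 : v ∉ γ := by
      rcases hγ with rfl | hγ
      · simp
      · exact (key γ hγ).1
    have hd : Disjoint γ {v} := by simpa using h1
    rw [linkConn_link hd]
    refine h.conn _ (Or.inr ?_) (by rw [Finset.card_union_of_disjoint hd]; simpa using hc)
    rcases hγ with rfl | hγ
    · simpa using hv
    · exact (key γ hγ).2.1

/-- Faces with `n` vertices that contain `σ` are joined by paths of such faces, consecutive ones
having a common face of codimension one. -/
def FacetConn (n : ℕ) (K : PreAbstractSimplicialComplex V) (σ : Finset V) : Prop :=
  ∀ τ₁ ∈ K.faces, ∀ τ₂ ∈ K.faces, τ₁.card = n + 1 → τ₂.card = n + 1 → σ ⊆ τ₁ → σ ⊆ τ₂ →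
    Relation.ReflTransGen (fun α β : Finset V =>
      α ∈ K.faces ∧ β ∈ K.faces ∧ α.card = n + 1 ∧ β.card = n + 1 ∧ (α ∩ β).card = n) τ₁ τ₂

theorem facetConn_of_card_eq {n : ℕ} {K : PreAbstractSimplicialComplex V} {σ : Finset V}
    (hσ : σ.card = n) : FacetConn n K σ := by
  intro τ₁ h₁ τ₂ h₂ c₁ c₂ s₁ s₂
  by_cases h : τ₁ = τ₂
  · rw [h]
  · refine .single ⟨h₁, h₂, c₁, c₂, ?_⟩
    have h3 : n ≤ (τ₁ ∩ τ₂).card := hσ ▸ Finset.card_le_card (Finset.subset_inter s₁ s₂)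
    by_contra hne
    have h4 : τ₁.card ≤ (τ₁ ∩ τ₂).card := by omega
    have e1 := Finset.eq_of_subset_of_card_le Finset.inter_subset_left h4
    have e2 := Finset.eq_of_subset_of_card_le (Finset.inter_subset_right (s₁ := τ₁) (s₂ := τ₂))
      (by omega)
    exact h (e1.symm.trans e2)

theorem facetConn_of_linkConn {n : ℕ} {K : PreAbstractSimplicialComplex V} {σ : Finset V}
    (hpure : ∀ ρ ∈ K.faces, ∃ τ ∈ K.faces, ρ ⊆ τ ∧ τ.card = n + 1)
    (hσ : σ.card < n + 1) (hc : LinkConn K σ)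
    (h : ∀ x, Ext K σ x → FacetConn n K (insert x σ)) : FacetConn n K σ := by
  intro τ₁ h₁ τ₂ h₂ c₁ c₂ s₁ s₂
  have ex : ∀ τ ∈ K.faces, τ.card = n + 1 → σ ⊆ τ → ∃ x ∈ τ, Ext K σ x := by
    intro τ hτ c s
    obtain ⟨x, hx, hxσ⟩ := Finset.exists_mem_notMem_of_card_lt_card (c.symm ▸ hσ)
    exact ⟨x, hx, hxσ, face_mono hτ (Finset.insert_subset hx s) (by simp)⟩
  obtain ⟨x, hx, ex₁⟩ := ex τ₁ h₁ c₁ s₁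
  obtain ⟨y, hy, ey⟩ := ex τ₂ h₂ c₂ s₂
  have hp := hc x y ex₁ ey
  clear ey
  induction hp generalizing τ₂ with
  | refl =>
    exact h x ex₁ _ h₁ _ h₂ c₁ c₂ (Finset.insert_subset hx s₁) (Finset.insert_subset hy s₂)
  | @tail b c hb hbc ih =>
    obtain ⟨τ, hτ, hsτ, cτ⟩ := hpure _ hbc.2.2
    refine (ih τ hτ cτ ?_ (hsτ (by simp))).trans ?_
    · exact fun z hz => hsτ (by grind)
    · exact h c hbc.right _ hτ _ h₂ cτ c₂ (fun z hz => hsτ (by grind))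
        (Finset.insert_subset hy s₂)

/-- Normal pseudomanifolds are strongly connected, and so are the stars of their faces. -/
theorem IsPM.facetConn {d : ℕ} {K : PreAbstractSimplicialComplex V} (h : IsPM d K) {σ : Finset V}
    (hσ : σ = ∅ ∨ σ ∈ K.faces) (hc : σ.card ≤ d) : FacetConn d K σ := by
  obtain ⟨k, hk⟩ := Nat.exists_eq_add_of_le hc
  induction k generalizing σ with
  | zero => exact facetConn_of_card_eq hk.symm
  | succ k ih =>
    refine facetConn_of_linkConn h.pure (by omega) (h.conn σ hσ (by omega)) fun x hx => ?_
    have := Finset.card_insert_of_notMem hx.1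
    exact ih (Or.inr hx.2) (by omega) (by omega)

theorem setOf_coface_eq {K : PreAbstractSimplicialComplex V} {σ : Finset V} {n : ℕ}
    (hσ : σ.card = n) :
    {τ | τ ∈ K.faces ∧ τ.card = n + 1 ∧ σ ⊆ τ} = (fun p => insert p σ) '' {p | Ext K σ p} := by
  ext τ
  constructor
  · rintro ⟨h1, h2, h3⟩
    obtain ⟨x, hx, hxσ⟩ := Finset.exists_mem_notMem_of_card_lt_card (show σ.card < τ.card by omega)
    have : insert x σ = τ := Finset.eq_of_subset_of_card_le (Finset.insert_subset hx h3)
      (by rw [Finset.card_insert_of_notMem hxσ]; omega)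
    exact ⟨x, ⟨hxσ, by rwa [this]⟩, this⟩
  · rintro ⟨p, ⟨hp, hK⟩, rfl⟩
    exact ⟨hK, by simp [hp, hσ], Finset.subset_insert _ _⟩

theorem injOn_insert_ext {K : PreAbstractSimplicialComplex V} {σ : Finset V} :
    Set.InjOn (fun p => insert p σ) {p | Ext K σ p} := by
  rintro p ⟨hp, -⟩ q ⟨hq, -⟩ h
  have : p ∈ insert q σ := (show insert p σ = insert q σ from h) ▸ Finset.mem_insert_self p σ
  exact (Finset.mem_insert.mp this).resolve_right hp

theorem ncard_eq_two_iff_twoExt {K : PreAbstractSimplicialComplex V} {σ : Finset V} {n : ℕ}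
    (hσ : σ.card = n) :
    {τ | τ ∈ K.faces ∧ τ.card = n + 1 ∧ σ ⊆ τ}.ncard = 2 ↔ TwoExt K σ := by
  rw [setOf_coface_eq hσ, injOn_insert_ext.ncard_image, Set.ncard_eq_two]
  constructor
  · rintro ⟨p, q, hpq, h⟩
    exact ⟨p, q, hpq, fun r => by simpa using Set.ext_iff.mp h r⟩
  · rintro ⟨p, q, hpq, h⟩
    exact ⟨p, q, hpq, Set.ext fun r => by simpa using h r⟩

theorem IsNormalPseudomanifold.isPM {K : PreAbstractSimplicialComplex V}
    (h : IsNormalPseudomanifold K) : IsPM 3 K := by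
  have hpure : ∀ σ ∈ K.faces, ∃ τ ∈ K.faces, σ ⊆ τ ∧ τ.card = 4 := by
    intro σ hσ
    obtain ⟨τ, hτ, hs, hc, -⟩ := h.pure σ hσ
    exact ⟨τ, hτ, hs, hc⟩
  refine ⟨h.finite, h.nonempty, ?_, hpure, ?_, ?_⟩
  · intro σ hσ
    obtain ⟨τ, hτ, hs, hc, -⟩ := h.pure σ hσ
    exact (Finset.card_le_card hs).trans hc.le
  · intro σ hσ hc
    exact (ncard_eq_two_iff_twoExt hc).mp (h.two σ hσ hc)
  · rintro σ (rfl | hσ) hc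
    · intro x y hx hy
      obtain ⟨τ₁, h₁, s₁, c₁⟩ := hpure _ hx.2
      obtain ⟨τ₂, h₂, s₂, c₂⟩ := hpure _ hy.2
      have hp := h.strong τ₁ h₁ τ₂ h₂ c₁ c₂
      have adj : ∀ τ ∈ K.faces, ∀ a ∈ τ, ∀ b ∈ τ, LinkAdj K ∅ a b := fun τ hτ a ha b hb =>
        ⟨by simp, by simp, face_mono hτ (by grind) (by simp)⟩
      replace s₁ : x ∈ τ₁ := s₁ (by simp)
      replace s₂ : y ∈ τ₂ := s₂ (by simp)
      clear hx hy
      induction hp generalizing y with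
      | refl => exact .single (adj _ h₁ _ s₁ _ s₂)
      | @tail β γ _ hβ ih =>
        obtain ⟨hb, hc, cb, cc, ci⟩ := hβ
        obtain ⟨z, hz⟩ := Finset.card_pos.mp (show 0 < (β ∩ γ).card by omega)
        rw [Finset.mem_inter] at hz
        exact (ih z hb cb hz.1).tail (adj _ hc _ hz.2 _ s₂)
    · exact isConnected_link_iff.mp (h.link_connected σ hσ (by omega))

theorem IsPM.isNormalPseudomanifold {K : PreAbstractSimplicialComplex V} (h : IsPM 3 K) :
    IsNormalPseudomanifold K := by
  refine ⟨h.finite, h.nonempty, ?_, ?_, ?_, ?_⟩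
  · intro σ hσ
    obtain ⟨τ, hτ, hs, hc⟩ := h.pure σ hσ
    refine ⟨τ, hτ, hs, hc, fun ρ hρ hτρ => ?_⟩
    exact (Finset.eq_of_subset_of_card_le hτρ (by have := h.dim ρ hρ; omega)).symm
  · exact fun σ hσ τ hτ cσ cτ =>
      h.facetConn (Or.inl rfl) (by simp) σ hσ τ hτ cσ cτ (by simp) (by simp)
  · intro σ hσ hc
    exact (ncard_eq_two_iff_twoExt hc).mpr (h.two σ hσ hc)
  · intro σ hσ hc
    exact isConnected_link_iff.mpr (h.conn σ (Or.inr hσ) (by omega))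

/-! ### The Euler characteristic -/

/-- The Euler characteristic of a finite complex. -/
noncomputable def eulerChar {W : Type*} (K : PreAbstractSimplicialComplex W) : ℤ :=
  ∑ᶠ σ ∈ K.faces, (-1) ^ (σ.card + 1)

theorem eulerChar_eq_sum {W : Type*} {K : PreAbstractSimplicialComplex W} (S : Finset (Finset W))
    (h : ∀ σ, σ ∈ S ↔ σ ∈ K.faces) : eulerChar K = ∑ σ ∈ S, (-1) ^ (σ.card + 1) := by
  have : K.faces = ↑S := by ext σ; simp [h]
  rw [eulerChar, this, finsum_mem_coe_finset]

theorem finite_starring_iff {K : PreAbstractSimplicialComplex V} {A : Finset V} {a : V}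
    (hA : A ∈ K.faces) (ha : {a} ∉ K.faces) :
    (starring K A a).faces.Finite ↔ K.faces.Finite := by
  have hAn := face_nonempty hA
  constructor
  · intro h
    refine (h.union (h.image fun ρ => A ∪ ρ.erase a)).subset ?_
    intro σ hσ
    by_cases hs : A ⊆ σ
    · refine Or.inr ⟨insert a (σ \ A), Or.inr ⟨σ \ A, ?_, ?_, rfl⟩, ?_⟩
      · intro h'
        obtain ⟨x, hx⟩ := hAn
        exact (Finset.mem_sdiff.mp (h' hx)).2 hx
      · rwa [Finset.sdiff_union_of_subset hs]
      · have : a ∉ σ := fun h => ha (face_mono hσ (by simpa using h) (by simp))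
        simp only
        rw [Finset.erase_insert (by grind), Finset.union_comm, Finset.sdiff_union_of_subset hs]
    · exact Or.inl (Or.inl ⟨hσ, hs⟩)
  · intro h
    have hf : (⋃ ρ ∈ K.faces, (↑(ρ.powerset) : Set (Finset V))).Finite :=
      h.biUnion fun ρ _ => Finset.finite_toSet _
    refine (h.union (hf.image fun τ => insert a τ)).subset ?_
    rintro σ (⟨hσ, -⟩ | ⟨τ, -, hτ, rfl⟩)
    · exact Or.inl hσ
    · refine Or.inr ⟨τ, ?_, rfl⟩
      simp only [Set.mem_iUnion]
      exact ⟨_, hτ, Finset.mem_coe.mpr (Finset.mem_powerset.mpr Finset.subset_union_left)⟩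

/-- The signed count of the sets `τ` with `τ ∪ A` a face vanishes, as toggling a vertex of `A`
shows; this count is the change of the Euler characteristic under a stellar subdivision at `A`. -/
theorem eulerChar_starring {K : PreAbstractSimplicialComplex V} {A : Finset V} {a : V}
    (hfin : K.faces.Finite) (hA : A ∈ K.faces) (ha : {a} ∉ K.faces) :
    eulerChar (starring K A a) = eulerChar K := by
  classical
  obtain ⟨x, hx⟩ := face_nonempty hA
  have hna : ∀ σ ∈ K.faces, a ∉ σ := fun σ hσ h => ha (face_mono hσ (by simpa using h) (by simp))
  set S := hfin.toFinset with hS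
  have memS : ∀ σ, σ ∈ S ↔ σ ∈ K.faces := by simp [hS]
  set P : Finset (Finset V) := (S.biUnion Finset.powerset).filter fun τ => τ ∪ A ∈ K.faces with hP
  have memP : ∀ τ, τ ∈ P ↔ τ ∪ A ∈ K.faces := by
    intro τ
    simp only [hP, Finset.mem_filter, Finset.mem_biUnion, Finset.mem_powerset,
      and_iff_right_iff_imp]
    exact fun h => ⟨_, (memS _).2 h, Finset.subset_union_left⟩
  have hzero : ∑ τ ∈ P, (-1 : ℤ) ^ (τ.card + 1) = 0 := by
    refine Finset.sum_involution
      (fun τ _ => if x ∈ τ then τ.erase x else insert x τ) ?_ ?_ ?_ ?_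
    · intro τ _
      by_cases h : x ∈ τ
      · simp only [h, if_true]
        rw [← Finset.card_erase_add_one h]; ring
      · simp only [h, if_false]
        rw [Finset.card_insert_of_notMem h]; ring
    · intro τ _ _
      by_cases h : x ∈ τ
      · simp only [h, if_true]; exact fun e => absurd h (Finset.erase_eq_self.mp e)
      · simp only [h, if_false]; exact fun e => h (Finset.insert_eq_self.mp e)
    · intro τ hτ
      rw [memP] at hτ ⊢
      refine face_congr hτ ?_
      by_cases h : x ∈ τ
      · simp only [h, if_true]; ext y; simp only [Finset.mem_union, Finset.mem_erase]; grind
      · simp only [h, if_false]; ext y; simp only [Finset.mem_union, Finset.mem_insert]; grind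
    · intro τ _
      by_cases h : x ∈ τ
      · simp [h]
      · simp [h]
  have hK : eulerChar K = ∑ σ ∈ S.filter (fun σ => ¬ A ⊆ σ), (-1 : ℤ) ^ (σ.card + 1) +
      ∑ σ ∈ P.filter (fun σ => A ⊆ σ), (-1 : ℤ) ^ (σ.card + 1) := by
    have : P.filter (fun σ => A ⊆ σ) = S.filter (fun σ => A ⊆ σ) := by
      ext σ
      simp only [Finset.mem_filter, memP, memS]
      constructor <;> rintro ⟨h1, h2⟩ <;> refine ⟨?_, h2⟩
      · rwa [Finset.union_eq_left.mpr h2] at h1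
      · rwa [Finset.union_eq_left.mpr h2]
    rw [eulerChar_eq_sum S memS, this, add_comm, Finset.sum_filter_add_sum_filter_not]
  have hL : eulerChar (starring K A a) =
      ∑ σ ∈ S.filter (fun σ => ¬ A ⊆ σ), (-1 : ℤ) ^ (σ.card + 1) -
      ∑ σ ∈ P.filter (fun σ => ¬ A ⊆ σ), (-1 : ℤ) ^ (σ.card + 1) := by
    have hnaP : ∀ τ ∈ P, a ∉ τ := fun τ hτ h =>
      hna _ ((memP τ).1 hτ) (Finset.mem_union_left _ h)
    rw [eulerChar_eq_sum (S.filter (fun σ => ¬ A ⊆ σ) ∪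
      (P.filter (fun σ => ¬ A ⊆ σ)).image (insert a)), Finset.sum_union, Finset.sum_image,
      sub_eq_add_neg, ← Finset.sum_neg_distrib]
    · congr 1
      refine Finset.sum_congr rfl fun τ hτ => ?_
      rw [Finset.card_insert_of_notMem (hnaP τ (Finset.mem_filter.mp hτ).1)]
      ring
    · intro τ hτ ρ hρ h
      have h1 := hnaP τ (Finset.mem_filter.mp hτ).1
      have h2 := hnaP ρ (Finset.mem_filter.mp hρ).1
      rw [← Finset.erase_insert h1, ← Finset.erase_insert h2]
      exact congrArg (fun s => s.erase a) h
    · rw [Finset.disjoint_left]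
      intro σ hσ hσ'
      obtain ⟨τ, -, rfl⟩ := Finset.mem_image.mp hσ'
      exact hna _ ((memS _).1 (Finset.mem_filter.mp hσ).1) (by simp)
    · intro σ
      simp only [Finset.mem_union, Finset.mem_filter, memS, Finset.mem_image, memP]
      refine or_congr Iff.rfl ⟨?_, ?_⟩
      · rintro ⟨τ, ⟨h1, h2⟩, rfl⟩
        exact ⟨τ, h2, h1, rfl⟩
      · rintro ⟨τ, h1, h2, rfl⟩
        exact ⟨τ, ⟨h2, h1⟩, rfl⟩
  have := Finset.sum_filter_add_sum_filter_not P (fun σ => A ⊆ σ) fun τ => (-1 : ℤ) ^ (τ.card + 1)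
  rw [hK, hL]
  linarith

/-- Finiteness and the Euler characteristic are invariant under PL homeomorphism. -/
theorem PLHomeo.finite_and_eulerChar {K L : PreAbstractSimplicialComplex V} (h : PLHomeo K L) :
    (K.faces.Finite ↔ L.faces.Finite) ∧ (K.faces.Finite → eulerChar K = eulerChar L) := by
  induction h with
  | rel K L h =>
    obtain ⟨A, a, hA, ha, rfl⟩ := h
    exact ⟨(finite_starring_iff hA ha).symm, fun hf => (eulerChar_starring hf hA ha).symm⟩
  | refl K => exact ⟨Iff.rfl, fun _ => rfl⟩
  | symm K L _ ih => exact ⟨ih.1.symm, fun hf => (ih.2 (ih.1.mpr hf)).symm⟩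
  | trans K L M _ _ ih₁ ih₂ =>
    exact ⟨ih₁.1.trans ih₂.1, fun hf => (ih₁.2 hf).trans (ih₂.2 (ih₁.1.mp hf))⟩

theorem eulerChar_simplexBoundary {S : Finset V} (hS : S.card = 4) :
    eulerChar (simplexBoundary S) = 2 := by
  have hne : S.Nonempty := Finset.card_pos.mp (by omega)
  have hmem : ∀ σ, σ ∈ (S.powerset.erase S).erase ∅ ↔ σ ∈ (simplexBoundary S).faces := by
    intro σ
    change _ ↔ σ.Nonempty ∧ σ ⊂ S
    rw [Finset.mem_erase, Finset.mem_erase, Finset.mem_powerset, Finset.nonempty_iff_ne_empty,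
      Finset.ssubset_iff_subset_ne]
    tauto
  have h0 := Finset.sum_powerset_neg_one_pow_card_of_nonempty hne
  rw [← Finset.add_sum_erase _ _ (Finset.mem_powerset_self S), ← Finset.add_sum_erase _ _
    (show ∅ ∈ S.powerset.erase S by simp [hne.ne_empty.symm]), hS] at h0
  rw [eulerChar_eq_sum _ hmem]
  simp only [pow_succ, mul_neg, mul_one, Finset.sum_neg_distrib]
  norm_num at h0
  linarith

theorem IsSphere.eulerChar {L : PreAbstractSimplicialComplex V} (h : IsSphere L)
    (hfin : L.faces.Finite) : eulerChar L = 2 := by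
  obtain ⟨S, hS, hL⟩ := h
  rw [hL.finite_and_eulerChar.2 hfin, eulerChar_simplexBoundary hS]

theorem finite_faces_of_finite {W : Type*} [Finite W] (K : PreAbstractSimplicialComplex W) :
    K.faces.Finite :=
  Set.toFinite _

theorem finite_map {W : Type*} {K : PreAbstractSimplicialComplex W} (hK : K.faces.Finite)
    (f : W → V) : (K.map f).faces.Finite :=
  hK.image _

theorem eulerChar_map {W : Type*} (K : PreAbstractSimplicialComplex W)
    (e : W ↪ V) : eulerChar (K.map e) = eulerChar K := by
  unfold eulerChar
  change ∑ᶠ σ ∈ K.faces.image (fun s => s.image e), _ = _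
  rw [finsum_mem_image (Finset.image_injective e.injective).injOn]
  simp only [Finset.card_image_of_injective _ e.injective]

/-- The faces of the grid surface, as a finite set to compute with. -/
def gridFaces (φ : ZMod 3 → ZMod 3) : Finset (Finset (ZMod 3 × ZMod 3)) :=
  Finset.univ.biUnion fun p =>
    ((({p, gridNext φ p, gridNext φ (gridUp p)} : Finset (ZMod 3 × ZMod 3)).powerset ∪
      ({p, gridUp p, gridNext φ (gridUp p)} : Finset (ZMod 3 × ZMod 3)).powerset).erase ∅)

theorem eulerChar_gridSurface (φ : ZMod 3 → ZMod 3) :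
    eulerChar (gridSurface φ) = ∑ σ ∈ gridFaces φ, (-1) ^ (σ.card + 1) := by
  refine eulerChar_eq_sum _ fun σ => ?_
  change _ ↔ σ.Nonempty ∧ _
  simp only [gridFaces, Finset.mem_biUnion, Finset.mem_univ, true_and, Finset.mem_erase,
    Finset.mem_union, Finset.mem_powerset, Finset.nonempty_iff_ne_empty]
  exact exists_and_left

theorem eulerChar_gridSurface_id : eulerChar (gridSurface fun j => j) = 0 := by
  rw [eulerChar_gridSurface]; decide +kernel

theorem eulerChar_gridSurface_neg : eulerChar (gridSurface fun j => -j) = 0 := by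
  rw [eulerChar_gridSurface]; decide +kernel

theorem IsTorus.finite_and_eulerChar {L : PreAbstractSimplicialComplex V} (h : IsTorus L) :
    L.faces.Finite ∧ eulerChar L = 0 := by
  obtain ⟨e, he⟩ := h
  have hf := finite_map (V := V) (finite_faces_of_finite (gridSurface fun j => j)) e
  have hL := he.finite_and_eulerChar.1.mpr hf
  exact ⟨hL, by rw [he.finite_and_eulerChar.2 hL, eulerChar_map, eulerChar_gridSurface_id]⟩

theorem IsKleinBottle.finite_and_eulerChar {L : PreAbstractSimplicialComplex V}
    (h : IsKleinBottle L) : L.faces.Finite ∧ eulerChar L = 0 := by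
  obtain ⟨e, he⟩ := h
  have hf := finite_map (V := V) (finite_faces_of_finite (gridSurface fun j => -j)) e
  have hL := he.finite_and_eulerChar.1.mpr hf
  exact ⟨hL, by rw [he.finite_and_eulerChar.2 hL, eulerChar_map, eulerChar_gridSurface_neg]⟩

theorem IsConnectedSum.finite_and_eulerChar {L L₁ L₂ : PreAbstractSimplicialComplex V}
    (h : IsConnectedSum L L₁ L₂) (h₁ : L₁.faces.Finite) (h₂ : L₂.faces.Finite) :
    L.faces.Finite ∧ eulerChar L = eulerChar L₁ + eulerChar L₂ - 2 := by
  obtain ⟨T, hT, hinf, hL⟩ := h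
  replace hL : L.faces = (L₁.faces ∪ L₂.faces) \ {T} := hL
  have hTn : T.Nonempty := Finset.card_pos.mp (by omega)
  have hinf' : L₁.faces ∩ L₂.faces = {σ | σ.Nonempty ∧ σ ⊆ T} := congrArg (·.faces) hinf
  refine ⟨hL ▸ (h₁.union h₂).subset Set.sdiff_subset, ?_⟩
  have hI : ∑ᶠ σ ∈ L₁.faces ∩ L₂.faces, (-1 : ℤ) ^ (σ.card + 1) = 1 := by
    have : {σ | σ.Nonempty ∧ σ ⊆ T} = ↑(T.powerset.erase ∅) := by
      ext σ; simp [Finset.nonempty_iff_ne_empty, and_comm]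
    rw [hinf', this, finsum_mem_coe_finset]
    have h0 := Finset.sum_powerset_neg_one_pow_card_of_nonempty hTn
    rw [← Finset.add_sum_erase _ _ (Finset.empty_mem_powerset T)] at h0
    simp only [pow_succ, mul_neg, mul_one, Finset.sum_neg_distrib]
    rw [Finset.card_empty, pow_zero] at h0
    linarith
  have hU := finsum_mem_union_inter (f := fun σ : Finset V => (-1 : ℤ) ^ (σ.card + 1)) h₁ h₂
  have hTm : T ∈ L₁.faces ∪ L₂.faces := by
    have : T ∈ L₁.faces ∩ L₂.faces := by rw [hinf']; exact ⟨hTn, subset_rfl⟩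
    exact Or.inl this.1
  have hD := finsum_mem_inter_add_sdiff (s := L₁.faces ∪ L₂.faces) {T}
    (f := fun σ : Finset V => (-1 : ℤ) ^ (σ.card + 1)) (h₁.union h₂)
  rw [Set.inter_eq_right.mpr (Set.singleton_subset_iff.mpr hTm), finsum_mem_singleton, hT] at hD
  unfold eulerChar
  rw [hL]
  rw [hI] at hU
  rw [show (-1 : ℤ) ^ (3 + 1) = 1 by norm_num] at hD
  linarith

/-- A connected sum of `h` surfaces of Euler characteristic `0` has Euler characteristic
`2 - 2 h`. -/
theorem IsSumOfCopies.finite_and_eulerChar {P : PreAbstractSimplicialComplex V → Prop}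
    (hP : ∀ L, P L → L.faces.Finite ∧ eulerChar L = 0) {h : ℕ}
    {L : PreAbstractSimplicialComplex V} (hL : IsSumOfCopies P h L) :
    1 ≤ h ∧ L.faces.Finite ∧ eulerChar L = 2 - 2 * h := by
  induction hL with
  | one L hL => exact ⟨le_rfl, (hP L hL).1, by rw [(hP L hL).2]; norm_num⟩
  | add h L L₁ L₂ _ h₂ hs ih =>
    obtain ⟨hf, he⟩ := hs.finite_and_eulerChar ih.2.1 (hP _ h₂).1
    exact ⟨by omega, hf, by rw [he, ih.2.2, (hP _ h₂).2]; push_cast; ring⟩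
  | homeo h L L' _ hh ih =>
    have := hh.finite_and_eulerChar
    exact ⟨ih.1, this.1.mp ih.2.1, by rw [← this.2 ih.2.1, ih.2.2]⟩

/-! ### Face numbers of closed surfaces -/

/-- The faces of a finite complex that have `k` vertices. -/
noncomputable def facesOfCard {K : PreAbstractSimplicialComplex V} (h : K.faces.Finite) (k : ℕ) :
    Finset (Finset V) :=
  h.toFinset.filter fun σ => σ.card = k

theorem mem_facesOfCard {K : PreAbstractSimplicialComplex V} {h : K.faces.Finite} {k : ℕ}
    {σ : Finset V} : σ ∈ facesOfCard h k ↔ σ ∈ K.faces ∧ σ.card = k := by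
  simp [facesOfCard]

theorem fNum_eq {K : PreAbstractSimplicialComplex V} (h : K.faces.Finite) (i : ℕ) :
    fNum K i = (facesOfCard h (i + 1)).card := by
  rw [fNum, ← Set.ncard_coe_finset]
  congr 1
  ext σ
  simp [mem_facesOfCard]

theorem card_filter_coface {K : PreAbstractSimplicialComplex V} (h : K.faces.Finite) {n : ℕ}
    {σ : Finset V} (hσ : σ.card = n) (h2 : TwoExt K σ) :
    ((facesOfCard h (n + 1)).filter fun τ => σ ⊆ τ).card = 2 := by
  rw [← (ncard_eq_two_iff_twoExt hσ).mpr h2, ← Set.ncard_coe_finset]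
  congr 1
  ext τ
  simp [mem_facesOfCard, and_assoc]

theorem filter_subset_eq_powersetCard {K : PreAbstractSimplicialComplex V} (h : K.faces.Finite)
    {k : ℕ} {T : Finset V} (hT : ∀ e ⊆ T, e.card = k → e ∈ K.faces) :
    (facesOfCard h k).filter (fun e => e ⊆ T) = T.powersetCard k := by
  ext e
  rw [Finset.mem_filter, mem_facesOfCard, Finset.mem_powersetCard]
  exact ⟨fun h => ⟨h.2, h.1.2⟩, fun h => ⟨⟨hT e h.1 h.2, h.2⟩, h.1⟩⟩

theorem IsPM.eulerChar_eq {L : PreAbstractSimplicialComplex V} (h : IsPM 2 L) :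
    eulerChar L = (facesOfCard h.finite 1).card - (facesOfCard h.finite 2).card +
      (facesOfCard h.finite 3).card := by
  have hd : h.finite.toFinset = facesOfCard h.finite 1 ∪ (facesOfCard h.finite 2 ∪
      facesOfCard h.finite 3) := by
    ext σ
    simp only [Set.Finite.mem_toFinset, Finset.mem_union, mem_facesOfCard]
    constructor
    · intro hσ
      have h1 := h.dim σ hσ
      have h2 := Finset.card_pos.mpr (face_nonempty hσ)
      have : σ.card = 1 ∨ σ.card = 2 ∨ σ.card = 3 := by omega
      tauto
    · tauto
  have hs : ∀ k, ∑ σ ∈ facesOfCard h.finite k, (-1 : ℤ) ^ (σ.card + 1) =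
      (facesOfCard h.finite k).card * (-1) ^ (k + 1) := fun k => by
    rw [Finset.sum_congr rfl fun σ hσ => by rw [(mem_facesOfCard.mp hσ).2], Finset.sum_const,
      nsmul_eq_mul]
  have hdis : ∀ i j, i ≠ j → Disjoint (facesOfCard h.finite i) (facesOfCard h.finite j) := by
    intro i j hij
    rw [Finset.disjoint_left]
    exact fun σ hi hj => hij ((mem_facesOfCard.mp hi).2.symm.trans (mem_facesOfCard.mp hj).2)
  rw [eulerChar_eq_sum h.finite.toFinset (by simp), hd, Finset.sum_union, Finset.sum_union, hs, hs,
    hs]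
  · norm_num; ring
  · exact hdis 2 3 (by norm_num)
  · exact Finset.disjoint_union_right.mpr ⟨hdis 1 2 (by norm_num), hdis 1 3 (by norm_num)⟩

theorem IsPM.three_mul_card {L : PreAbstractSimplicialComplex V} (h : IsPM 2 L) :
    3 * (facesOfCard h.finite 3).card = 2 * (facesOfCard h.finite 2).card := by
  have hdc := Finset.sum_card_bipartiteAbove_eq_sum_card_bipartiteBelow
    (s := facesOfCard h.finite 2) (t := facesOfCard h.finite 3) (fun e T => e ⊆ T)
  have h1 : ∀ e ∈ facesOfCard h.finite 2, (Finset.bipartiteAbove (fun e T => e ⊆ T)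
      (facesOfCard h.finite 3) e).card = 2 := by
    intro e he
    obtain ⟨he, hc⟩ := mem_facesOfCard.mp he
    exact card_filter_coface h.finite hc (h.two e he hc)
  have h2 : ∀ T ∈ facesOfCard h.finite 3, (Finset.bipartiteBelow (fun e T => e ⊆ T)
      (facesOfCard h.finite 2) T).card = 3 := by
    intro T hT
    obtain ⟨hT, hc⟩ := mem_facesOfCard.mp hT
    rw [Finset.bipartiteBelow, filter_subset_eq_powersetCard, Finset.card_powersetCard, hc]
    · rfl
    · exact fun e he hc => face_mono hT he (Finset.card_pos.mp (by omega))
  rw [Finset.sum_congr rfl h1, Finset.sum_const, Finset.sum_congr rfl h2, Finset.sum_const] at hdc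
  simp only [smul_eq_mul] at hdc
  linarith

/-! ### Triangular circuits separate spheres -/

theorem card_filter_edges {S : Finset (Finset V)} {T : Finset V} (hT : T.card = 3)
    (hS : ∀ e ⊆ T, e.card = 2 → e ∈ S) (hS2 : ∀ e ∈ S, e.card = 2) (a : V) :
    Even (S.filter fun e => {a} ⊆ e ∧ e ⊆ T).card := by
  by_cases ha : a ∈ T
  · have : S.filter (fun e => {a} ⊆ e ∧ e ⊆ T) = (T.erase a).image fun b => {a, b} := by
      ext e
      simp only [Finset.mem_filter, Finset.singleton_subset_iff, Finset.mem_image, Finset.mem_erase]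
      constructor
      · rintro ⟨h1, h2, h3⟩
        obtain ⟨b, hb⟩ := Finset.card_eq_one.mp
          (show (e.erase a).card = 1 by rw [Finset.card_erase_of_mem h2, hS2 e h1])
        have hbe : b ∈ e.erase a := by rw [hb]; simp
        refine ⟨b, ⟨Finset.ne_of_mem_erase hbe, h3 (Finset.mem_of_mem_erase hbe)⟩, ?_⟩
        rw [← Finset.insert_erase h2, hb]
      · rintro ⟨b, ⟨hba, hb⟩, rfl⟩
        have hs : ({a, b} : Finset V) ⊆ T := by
          rw [Finset.insert_subset_iff, Finset.singleton_subset_iff]; exact ⟨ha, hb⟩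
        exact ⟨hS _ hs (Finset.card_pair hba.symm), by simp, hs⟩
    rw [this, Finset.card_image_of_injOn, Finset.card_erase_of_mem ha, hT]
    · decide
    · intro b hb c hc h
      have hb' : b ≠ a := Finset.ne_of_mem_erase hb
      have : b ∈ ({a, c} : Finset V) := (show ({a, b} : Finset V) = {a, c} from h) ▸ by simp
      simpa [hb'] using this
  · have : S.filter (fun e => {a} ⊆ e ∧ e ⊆ T) = ∅ := by
      rw [Finset.filter_eq_empty_iff]
      rintro e - ⟨h1, h2⟩
      exact ha (h2 (h1 (by simp)))
    rw [this]; exact ⟨0, rfl⟩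

theorem finrank_le_one_of_forall_const {ι : Type*} [Fintype ι]
    (W : Submodule (ZMod 2) (ι → ZMod 2)) (h : ∀ f ∈ W, ∀ i j, f i = f j) :
    Module.finrank (ZMod 2) W ≤ 1 := by
  have hW : W ≤ Submodule.span (ZMod 2) {fun _ => 1} := by
    intro f hf
    rw [Submodule.mem_span_singleton]
    rcases isEmpty_or_nonempty ι with hι | ⟨⟨i⟩⟩
    · exact ⟨0, Subsingleton.elim _ _⟩
    · exact ⟨f i, by ext j; simp [h f hf i j]⟩
  refine (Submodule.finrank_mono hW).trans ?_
  simpa using finrank_span_le_card (R := ZMod 2) ({fun _ => 1} : Set (ι → ZMod 2))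

/-- In a closed surface of Euler characteristic two every cycle modulo two is a boundary; for the
circuit `∂T` this gives a set `G` of triangles such that the edges of `T` are those that lie in
exactly one triangle of `G`. The dimension count: the kernel of the boundary map `∂₂` consists of
constant functions, as does the kernel of the transpose of `∂₁`, so that
`dim ker ∂₁ ≤ f₁ - f₀ + 1 = f₂ - 1 ≤ rank ∂₂`. -/
theorem exists_coloring {L : PreAbstractSimplicialComplex V} (h : IsPM 2 L)
    (hχ : eulerChar L = 2) {T : Finset V} (hT : T.card = 3)
    (hTL : ∀ e ⊆ T, e.card = 2 → e ∈ L.faces) :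
    ∃ G : Finset V → Prop, ∀ (e : Finset V) (p q : V), e.card = 2 → p ≠ q → Ext L e p →
      Ext L e q → ((G (insert p e) ↔ G (insert q e)) ↔ ¬ e ⊆ T) := by
  classical
  set S := facesOfCard h.finite with hS
  let B₁ : Matrix (S 1) (S 2) (ZMod 2) := fun x e => if x.1 ⊆ e.1 then 1 else 0
  let B₂ : Matrix (S 2) (S 3) (ZMod 2) := fun e τ => if e.1 ⊆ τ.1 then 1 else 0
  have memS : ∀ {k σ}, σ ∈ S k ↔ σ ∈ L.faces ∧ σ.card = k := mem_facesOfCard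
  -- the two cofaces of an edge
  have hB₂ : ∀ (g : S 3 → ZMod 2) (e : S 2) (p q : V) (hp : insert p e.1 ∈ S 3)
      (hq : insert q e.1 ∈ S 3), p ≠ q → p ∉ e.1 → q ∉ e.1 →
      B₂.mulVec g e = g ⟨_, hp⟩ + g ⟨_, hq⟩ := by
    intro g e p q hp hq hpq hpe hqe
    have hne : (⟨_, hp⟩ : S 3) ≠ ⟨_, hq⟩ := by
      intro hh
      have hh' : insert p e.1 = insert q e.1 := congrArg Subtype.val hh
      have : p ∈ insert q e.1 := hh' ▸ Finset.mem_insert_self p e.1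
      rcases Finset.mem_insert.mp this with h1 | h1
      · exact hpq h1
      · exact hpe h1
    have hfil : (Finset.univ.filter fun τ : S 3 => e.1 ⊆ τ.1) = {⟨_, hp⟩, ⟨_, hq⟩} := by
      symm
      apply Finset.eq_of_subset_of_card_le
      · intro τ hτ
        rw [Finset.mem_insert, Finset.mem_singleton] at hτ
        rcases hτ with rfl | rfl <;> simp
      · rw [Finset.card_pair hne]
        have := card_filter_coface h.finite (memS.mp e.2).2
          (h.two _ (memS.mp e.2).1 (memS.mp e.2).2)
        refine le_trans ?_ this.le
        refine Finset.card_le_card_of_injOn Subtype.val ?_ Subtype.val_injective.injOn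
        intro τ hτ
        simp only [Finset.coe_filter, Finset.mem_univ, true_and, Set.mem_ofPred_eq] at hτ ⊢
        exact ⟨τ.2, hτ⟩
    simp only [B₂, Matrix.mulVec, dotProduct, ite_mul, one_mul, zero_mul]
    rw [← Finset.sum_filter, hfil, Finset.sum_pair hne]
  have hker₂ : Module.finrank (ZMod 2) (LinearMap.ker B₂.mulVecLin) ≤ 1 := by
    apply finrank_le_one_of_forall_const
    intro g hg τ₁ τ₂
    have hg' : ∀ e, B₂.mulVec g e = 0 := fun e => congrFun (LinearMap.mem_ker.mp hg) e
    have hpath := h.facetConn (Or.inl rfl) (by simp) τ₁.1 (memS.mp τ₁.2).1 τ₂.1 (memS.mp τ₂.2).1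
      (memS.mp τ₁.2).2 (memS.mp τ₂.2).2 (by simp) (by simp)
    suffices ∀ τ, Relation.ReflTransGen (fun α β : Finset V =>
        α ∈ L.faces ∧ β ∈ L.faces ∧ α.card = 2 + 1 ∧ β.card = 2 + 1 ∧ (α ∩ β).card = 2) τ₁.1 τ →
        ∀ hτ : τ ∈ S 3, g τ₁ = g ⟨τ, hτ⟩ from this _ hpath τ₂.2
    intro τ hp
    induction hp with
    | refl => exact fun _ => rfl
    | @tail α β _ hαβ ih =>
      intro hβ
      obtain ⟨h1, h2, c1, c2, ci⟩ := hαβ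
      have hα : α ∈ S 3 := memS.mpr ⟨h1, c1⟩
      rw [ih hα]
      have he : α ∩ β ∈ S 2 :=
        memS.mpr ⟨face_mono h1 Finset.inter_subset_left (Finset.card_pos.mp (by omega)), ci⟩
      obtain ⟨p, hp, hpe⟩ := Finset.exists_mem_notMem_of_card_lt_card
        (show (α ∩ β).card < α.card by omega)
      obtain ⟨q, hq, hqe⟩ := Finset.exists_mem_notMem_of_card_lt_card
        (show (α ∩ β).card < β.card by omega)
      have ep : insert p (α ∩ β) = α := Finset.eq_of_subset_of_card_le
        (Finset.insert_subset hp Finset.inter_subset_left)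
        (by rw [Finset.card_insert_of_notMem hpe]; omega)
      have eq : insert q (α ∩ β) = β := Finset.eq_of_subset_of_card_le
        (Finset.insert_subset hq Finset.inter_subset_right)
        (by rw [Finset.card_insert_of_notMem hqe]; omega)
      have hpq : p ≠ q := fun hh => hpe (Finset.mem_inter.mpr ⟨hp, hh ▸ hq⟩)
      have := hB₂ g ⟨_, he⟩ p q (by rwa [ep]) (by rwa [eq]) hpq hpe hqe
      rw [hg'] at this
      simp only [ep, eq] at this
      exact (CharTwo.add_eq_zero.mp this.symm)
  have hker₁ : Module.finrank (ZMod 2) (LinearMap.ker B₁.transpose.mulVecLin) ≤ 1 := by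
    apply finrank_le_one_of_forall_const
    intro f hf x y
    have hf' : ∀ e, B₁.transpose.mulVec f e = 0 := fun e => congrFun (LinearMap.mem_ker.mp hf) e
    obtain ⟨a, ha⟩ := Finset.card_eq_one.mp (memS.mp x.2).2
    obtain ⟨b, hb⟩ := Finset.card_eq_one.mp (memS.mp y.2).2
    have hpath := h.conn ∅ (Or.inl rfl) (by simp) a b ⟨by simp, face_congr (memS.mp x.2).1 ha⟩
      ⟨by simp, face_congr (memS.mp y.2).1 hb⟩
    suffices ∀ c, LinkPath L ∅ a c → ∀ hc : {c} ∈ S 1, f x = f ⟨{c}, hc⟩ by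
      have := this b hpath (hb ▸ y.2)
      rw [this]
      exact congrArg f (Subtype.ext hb.symm)
    intro c hc
    induction hc with
    | refl => exact fun hc => congrArg f (Subtype.ext ha)
    | @tail u v _ huv ih =>
      intro hv
      have huv' : ({u, v} : Finset V) ∈ L.faces := by simpa using huv.2.2
      have hu : {u} ∈ S 1 := memS.mpr ⟨face_mono huv' (by simp) (by simp), by simp⟩
      rw [ih hu]
      by_cases hne : u = v
      · subst hne; rfl
      · have he : {u, v} ∈ S 2 := memS.mpr ⟨huv', Finset.card_pair hne⟩
        have hne' : (⟨{u}, hu⟩ : S 1) ≠ ⟨{v}, hv⟩ := fun hh =>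
          hne (Finset.singleton_injective (congrArg Subtype.val hh))
        have hfil : (Finset.univ.filter fun x : S 1 => x.1 ⊆ {u, v}) =
            {⟨{u}, hu⟩, ⟨{v}, hv⟩} := by
          ext z
          obtain ⟨w, hw⟩ := Finset.card_eq_one.mp (memS.mp z.2).2
          simp only [Finset.mem_filter, Finset.mem_univ, true_and, Finset.mem_insert,
            Finset.mem_singleton, Subtype.ext_iff, hw, Finset.singleton_subset_iff,
            Finset.singleton_inj]
        have := hf' ⟨_, he⟩
        change ∑ x : S 1, (if x.1 ⊆ {u, v} then (1 : ZMod 2) else 0) * f x = 0 at this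
        simp only [ite_mul, one_mul, zero_mul] at this
        rw [← Finset.sum_filter, hfil, Finset.sum_pair hne'] at this
        exact CharTwo.add_eq_zero.mp this
  -- a set of edges that meets every vertex in an even number of edges is a cycle
  have hcyc : ∀ R : Finset V, R.card = 3 → (∀ e ⊆ R, e.card = 2 → e ∈ L.faces) →
      B₁.mulVec (fun e => if e.1 ⊆ R then 1 else 0) = 0 := by
    intro R hR hRL
    ext x
    obtain ⟨a, ha⟩ := Finset.card_eq_one.mp (memS.mp x.2).2
    have hev := card_filter_edges (S := S 2) hR (fun e he hc => memS.mpr ⟨hRL e he hc, hc⟩)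
      (fun e he => (memS.mp he).2) a
    simp only [B₁, Matrix.mulVec, dotProduct, ite_mul, one_mul, zero_mul, ← ite_and, ha,
      Pi.zero_apply]
    rw [Finset.sum_coe_sort (S 2) (fun e => if {a} ⊆ e ∧ e ⊆ R then (1 : ZMod 2) else 0),
      Finset.sum_boole]
    exact (ZMod.natCast_eq_zero_iff_even).mpr hev
  have hle : LinearMap.range B₂.mulVecLin ≤ LinearMap.ker B₁.mulVecLin := by
    rintro _ ⟨g, rfl⟩
    have hmul : B₁ * B₂ = 0 := by
      ext x τ
      have := congrFun (hcyc τ.1 (memS.mp τ.2).2 fun e he hc =>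
        face_mono (memS.mp τ.2).1 he (Finset.card_pos.mp (by omega))) x
      exact this
    rw [LinearMap.mem_ker, Matrix.mulVecLin_apply, Matrix.mulVecLin_apply, Matrix.mulVec_mulVec,
      hmul, Matrix.zero_mulVec]
  have heq : LinearMap.range B₂.mulVecLin = LinearMap.ker B₁.mulVecLin := by
    apply Submodule.eq_of_le_of_finrank_le hle
    have r2 := B₂.mulVecLin.finrank_range_add_finrank_ker
    have r1 := B₁.mulVecLin.finrank_range_add_finrank_ker
    have r1t := B₁.transpose.mulVecLin.finrank_range_add_finrank_ker
    have rt : Module.finrank (ZMod 2) (LinearMap.range B₁.transpose.mulVecLin) =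
        Module.finrank (ZMod 2) (LinearMap.range B₁.mulVecLin) := B₁.rank_transpose
    rw [Module.finrank_fintype_fun_eq_card, Fintype.card_coe] at r2 r1 r1t
    have he := h.eulerChar_eq
    rw [hχ] at he
    change (2 : ℤ) = (S 1).card - (S 2).card + (S 3).card at he
    omega
  have hTker : (fun e : S 2 => if e.1 ⊆ T then (1 : ZMod 2) else 0) ∈
      LinearMap.range B₂.mulVecLin := by
    rw [heq, LinearMap.mem_ker, Matrix.mulVecLin_apply, hcyc T hT hTL]
  obtain ⟨g, hg⟩ := hTker
  refine ⟨fun τ => ∃ hτ : τ ∈ S 3, g ⟨τ, hτ⟩ = 1, ?_⟩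
  intro e p q he hpq hp hq
  have hpS : insert p e ∈ S 3 := memS.mpr ⟨hp.2, by rw [Finset.card_insert_of_notMem hp.1, he]⟩
  have hqS : insert q e ∈ S 3 := memS.mpr ⟨hq.2, by rw [Finset.card_insert_of_notMem hq.1, he]⟩
  have heS : e ∈ S 2 :=
    memS.mpr ⟨face_mono hp.2 (Finset.subset_insert _ _) (Finset.card_pos.mp (by omega)), he⟩
  have h1 := hB₂ g ⟨e, heS⟩ p q hpS hqS hpq hp.1 hq.1
  have h2 := congrFun hg ⟨e, heS⟩
  rw [Matrix.mulVecLin_apply, h1] at h2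
  have hz : ∀ a b : ZMod 2, ∀ P : Prop, [Decidable P] → a + b = (if P then 1 else 0) →
      ((a = 1 ↔ b = 1) ↔ ¬ P) := by
    intro a b P _
    by_cases hP : P
    · simp only [hP, if_true]; revert a b; decide
    · simp only [hP, if_false]; revert a b; decide
  have := hz _ _ _ h2
  simpa [hpS, hqS] using this

/-! ### Bistellar moves at edges of degree three -/

/-- `K'` is obtained from `K` by replacing the star of the edge `uv`, whose link is `∂T`, by the
triangle `T` and the tetrahedra `uT`, `vT`. -/
structure IsFlip (K K' : PreAbstractSimplicialComplex V) (u v : V) (T : Finset V) : Prop where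
  ne : u ≠ v
  left : u ∉ T
  right : v ∉ T
  card : T.card = 3
  notMem : T ∉ K.faces
  join : ∀ γ, γ ⊂ T → insert u (insert v γ) ∈ K.faces
  of_join : ∀ γ, u ∉ γ → v ∉ γ → insert u (insert v γ) ∈ K.faces → γ ⊂ T
  mem : ∀ σ, σ ∈ K'.faces ↔
    (σ ∈ K.faces ∧ ¬ (u ∈ σ ∧ v ∈ σ)) ∨ σ = T ∨ σ = insert u T ∨ σ = insert v T

namespace IsFlip

variable {K K' : PreAbstractSimplicialComplex V} {u v : V} {T : Finset V}

theorem symm (h : IsFlip K K' u v T) : IsFlip K K' v u T where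
  ne := h.ne.symm
  left := h.right
  right := h.left
  card := h.card
  notMem := h.notMem
  join γ hγ := by rw [Finset.insert_comm]; exact h.join γ hγ
  of_join γ h1 h2 h3 := h.of_join γ h2 h1 (by rwa [Finset.insert_comm])
  mem σ := by rw [h.mem]; tauto

theorem insert_left (h : IsFlip K K' u v T) {γ : Finset V} (hγ : γ ⊂ T) :
    insert u γ ∈ K.faces :=
  face_mono (h.join γ hγ) (Finset.insert_subset_insert _ (Finset.subset_insert _ _)) (by simp)

theorem insert_left_mem (h : IsFlip K K' u v T) {γ : Finset V} (hγ : γ ⊆ T) :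
    insert u γ ∈ K'.faces := by
  rw [h.mem]
  rcases eq_or_ne γ T with rfl | hne
  · tauto
  · refine Or.inl ⟨h.insert_left (hγ.ssubset_of_ne hne), fun h' => ?_⟩
    have := Finset.mem_insert.mp h'.2
    exact this.elim (fun e => h.ne e.symm) fun h'' => h.right (hγ h'')

theorem pure_aux (h : IsFlip K K' u v T) {σ τ : Finset V} (hτ : τ ∈ K.faces) (hs : σ ⊆ τ)
    (hu : u ∈ τ) (hv : v ∈ τ) (hσ : v ∉ σ) : σ ⊆ insert u T := by
  have h1 : insert u (insert v ((τ.erase u).erase v)) = τ := by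
    rw [Finset.insert_erase (Finset.mem_erase.mpr ⟨h.ne.symm, hv⟩), Finset.insert_erase hu]
  have h2 := h.of_join ((τ.erase u).erase v) (by simp) (by simp) (by rwa [h1])
  intro x hx
  rw [Finset.mem_insert, or_iff_not_imp_left]
  intro hxu
  exact h2.1 (Finset.mem_erase.mpr ⟨fun e => hσ (e ▸ hx), Finset.mem_erase.mpr ⟨hxu, hs hx⟩⟩)

theorem card_insert_left (h : IsFlip K K' u v T) : (insert u T).card = 4 := by
  rw [Finset.card_insert_of_notMem h.left, h.card]

theorem pure (h : IsFlip K K' u v T) (hK : IsPM 3 K) :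
    ∀ σ ∈ K'.faces, ∃ τ ∈ K'.faces, σ ⊆ τ ∧ τ.card = 4 := by
  intro σ hσ
  rcases (h.mem σ).1 hσ with ⟨hσ, hn⟩ | rfl | rfl | rfl
  · obtain ⟨τ, hτ, hs, hc⟩ := hK.pure σ hσ
    by_cases hτ' : u ∈ τ ∧ v ∈ τ
    · by_cases hv : v ∈ σ
      · have hu : u ∉ σ := fun hu => hn ⟨hu, hv⟩
        exact ⟨insert v T, by rw [h.mem]; tauto, h.symm.pure_aux hτ hs hτ'.2 hτ'.1 hu,
          h.symm.card_insert_left⟩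
      · exact ⟨insert u T, by rw [h.mem]; tauto, h.pure_aux hτ hs hτ'.1 hτ'.2 hv,
          h.card_insert_left⟩
    · exact ⟨τ, by rw [h.mem]; tauto, hs, hc⟩
  · exact ⟨insert u σ, by rw [h.mem]; tauto, Finset.subset_insert _ _, h.card_insert_left⟩
  · exact ⟨insert u T, hσ, subset_rfl, h.card_insert_left⟩
  · exact ⟨insert v T, hσ, subset_rfl, h.symm.card_insert_left⟩

/-- A triangle `uxy` with `xy ⊆ T`: the tetrahedron `uvxy` is replaced by `uT`. -/
theorem twoExt_aux (h : IsFlip K K' u v T) {σ : Finset V} (hc : σ.card = 3) (h2 : TwoExt K σ)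
    (hu : u ∈ σ) (hv : Ext K σ v) : TwoExt K' σ := by
  obtain ⟨q, hq, hqv⟩ : ∃ q, q ≠ v ∧ ∀ r, Ext K σ r ↔ r = v ∨ r = q := by
    obtain ⟨p, q, hpq, hr⟩ := h2
    rcases (hr v).1 hv with rfl | rfl
    · exact ⟨q, hpq.symm, hr⟩
    · exact ⟨p, hpq, fun r => (hr r).trans or_comm⟩
  have hγ : σ.erase u ⊂ T := by
    refine h.of_join _ (by simp) (fun hh => hv.1 (Finset.mem_of_mem_erase hh)) ?_
    rw [Finset.insert_comm, Finset.insert_erase hu]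
    exact hv.2
  obtain ⟨c, hcT, hcσ⟩ := Finset.exists_of_ssubset hγ
  have hcu : c ≠ u := fun e => h.left (e ▸ hcT)
  have hcσ' : c ∉ σ := fun hh => hcσ (Finset.mem_erase.mpr ⟨hcu, hh⟩)
  have hT : insert c (σ.erase u) = T := by
    apply Finset.eq_of_subset_of_card_le (Finset.insert_subset hcT hγ.1)
    rw [Finset.card_insert_of_notMem hcσ, Finset.card_erase_of_mem hu, h.card, hc]
  have hcσT : insert c σ = insert u T := by
    rw [← hT, Finset.insert_comm, Finset.insert_erase hu]
  have hqσ := (hqv q).2 (Or.inr rfl)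
  have hcq : c ≠ q := by
    rintro rfl
    exact h.notMem (face_mono hqσ.2 (hcσT ▸ Finset.subset_insert u T)
      (Finset.card_pos.mp (by have := h.card; omega)))
  refine ⟨c, q, hcq, fun r => ⟨?_, ?_⟩⟩
  · rintro ⟨hr, hr'⟩
    rcases (h.mem _).1 hr' with ⟨hK, hn⟩ | e | e | e
    · rcases (hqv r).1 ⟨hr, hK⟩ with rfl | rfl
      · exact absurd ⟨Finset.mem_insert_of_mem hu, Finset.mem_insert_self _ _⟩ hn
      · exact Or.inr rfl
    · exact absurd (e ▸ Finset.mem_insert_of_mem hu) h.left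
    · left
      have : c ∈ insert r σ := by rw [e]; exact Finset.mem_insert_of_mem hcT
      exact ((Finset.mem_insert.mp this).resolve_right hcσ').symm
    · have : u ∈ insert v T := e ▸ Finset.mem_insert_of_mem hu
      exact absurd ((Finset.mem_insert.mp this).resolve_right h.left) h.ne
  · rintro (rfl | rfl)
    · exact ⟨hcσ', by rw [hcσT, h.mem]; tauto⟩
    · refine ⟨hqσ.1, (h.mem _).2 (Or.inl ⟨hqσ.2, fun hh => ?_⟩)⟩
      rcases Finset.mem_insert.mp hh.2 with e | e
      · exact hq e.symm
      · exact hv.1 e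

theorem two (h : IsFlip K K' u v T) (hK : IsPM 3 K) :
    ∀ σ ∈ K'.faces, σ.card = 3 → TwoExt K' σ := by
  intro σ hσ hc
  have c1 := h.card_insert_left
  have c2 := h.symm.card_insert_left
  rcases (h.mem σ).1 hσ with ⟨hσ, hn⟩ | rfl | rfl | rfl
  · have h2 := hK.two σ hσ hc
    by_cases h3 : u ∈ σ ∧ Ext K σ v
    · exact h.twoExt_aux hc h2 h3.1 h3.2
    by_cases h4 : v ∈ σ ∧ Ext K σ u
    · exact h.symm.twoExt_aux hc h2 h4.1 h4.2
    have key : ∀ r, Ext K' σ r ↔ Ext K σ r := by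
      intro r
      refine and_congr_right fun hr => ?_
      rw [h.mem]
      have aux : ∀ {u v : V}, IsFlip K K' u v T → σ ∈ K.faces → ¬ (u ∈ σ ∧ Ext K σ v) →
          r ∉ σ → insert r σ ≠ insert u T := by
        intro u v h hσ h3 hr e
        have hu : u ∈ σ := by
          by_contra hu
          have : u ∈ insert r σ := e ▸ Finset.mem_insert_self _ _
          have hur := (Finset.mem_insert.mp this).resolve_right hu
          subst hur
          have e' : σ = T := by rw [← Finset.erase_insert hu, e, Finset.erase_insert h.left]
          exact h.notMem (e' ▸ hσ)
        have hrT : r ∈ T := by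
          have : r ∈ insert u T := e ▸ Finset.mem_insert_self _ _
          exact (Finset.mem_insert.mp this).resolve_left fun e' => hr (e' ▸ hu)
        have hvσ : v ∉ σ := by
          intro hv
          have : v ∈ insert u T := e ▸ Finset.mem_insert_of_mem hv
          rcases Finset.mem_insert.mp this with e' | e'
          · exact h.ne e'.symm
          · exact h.right e'
        have hs : σ.erase u ⊂ T := by
          refine ⟨fun x hx => ?_, fun hh => hr (Finset.mem_of_mem_erase (hh hrT))⟩
          have : x ∈ insert u T := e ▸ Finset.mem_insert_of_mem (Finset.mem_of_mem_erase hx)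
          exact (Finset.mem_insert.mp this).resolve_left (Finset.ne_of_mem_erase hx)
        have := h.join _ hs
        rw [Finset.insert_comm, Finset.insert_erase hu] at this
        exact h3 ⟨hu, hvσ, this⟩
      constructor
      · rintro (⟨hK, -⟩ | e | e | e)
        · exact hK
        · have := congrArg Finset.card e
          rw [Finset.card_insert_of_notMem hr, h.card] at this
          omega
        · exact absurd e (aux h hσ h3 hr)
        · exact absurd e (aux h.symm hσ h4 hr)
      · intro hK
        refine Or.inl ⟨hK, fun hh => ?_⟩
        rcases Finset.mem_insert.mp hh.1 with rfl | hu
        · rcases Finset.mem_insert.mp hh.2 with e | hv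
          · exact h.ne e.symm
          · exact h4 ⟨hv, hr, hK⟩
        · rcases Finset.mem_insert.mp hh.2 with rfl | hv
          · exact h3 ⟨hu, hr, hK⟩
          · exact hn ⟨hu, hv⟩
    obtain ⟨p, q, hpq, hr⟩ := h2
    exact ⟨p, q, hpq, fun r => (key r).trans (hr r)⟩
  · refine ⟨u, v, h.ne, fun r => ⟨?_, ?_⟩⟩
    · rintro ⟨hr, hr'⟩
      rcases (h.mem _).1 hr' with ⟨hK, -⟩ | e | e | e
      · exact absurd (face_mono hK (Finset.subset_insert _ _) (face_nonempty hσ)) h.notMem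
      · exact absurd (e ▸ Finset.mem_insert_self r σ) hr
      · have : r ∈ insert u σ := e ▸ Finset.mem_insert_self r σ
        exact Or.inl ((Finset.mem_insert.mp this).resolve_right hr)
      · have : r ∈ insert v σ := e ▸ Finset.mem_insert_self r σ
        exact Or.inr ((Finset.mem_insert.mp this).resolve_right hr)
    · rintro (rfl | rfl)
      · exact ⟨h.left, by rw [h.mem]; tauto⟩
      · exact ⟨h.right, by rw [h.mem]; tauto⟩
  · omega
  · omega

/-- In the link of a face that contains `u` but not `v`, the vertex `v` is replaced by a vertex of
`T`. -/
theorem linkConn_of_mem (h : IsFlip K K' u v T) {σ : Finset V} (hσ : σ.card ≤ 2)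
    (hc : LinkConn K σ) (hu : u ∈ σ) (hv : v ∉ σ) : LinkConn K' σ := by
  have c1 := h.card_insert_left
  have c2 := h.symm.card_insert_left
  have hex : ∀ y, Ext K' σ y → Ext K σ y ∧ y ≠ v := by
    rintro y ⟨hy, hy'⟩
    have cy := Finset.card_insert_of_notMem hy
    rcases (h.mem _).1 hy' with ⟨hK, hn⟩ | e | e | e
    · refine ⟨⟨hy, hK⟩, ?_⟩
      rintro rfl
      exact hn ⟨Finset.mem_insert_of_mem hu, Finset.mem_insert_self _ _⟩
    · exact absurd (e ▸ Finset.mem_insert_of_mem hu) h.left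
    · rw [e] at cy; omega
    · rw [e] at cy; omega
  have old : ∀ a b, a ≠ v → b ≠ v → LinkAdj K σ a b → LinkAdj K' σ a b := by
    rintro a b ha hb ⟨h1, h2, h3⟩
    refine ⟨h1, h2, (h.mem _).2 (Or.inl ⟨h3, fun hh => ?_⟩)⟩
    have := hh.2
    simp only [Finset.mem_insert] at this
    tauto
  by_cases hev : Ext K σ v
  · have hγ : σ.erase u ⊂ T := by
      refine h.of_join _ (by simp) (fun hh => hv (Finset.mem_of_mem_erase hh)) ?_
      rw [Finset.insert_comm, Finset.insert_erase hu]
      exact hev.2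
    obtain ⟨c, hcT, hcσ⟩ := Finset.exists_of_ssubset hγ
    have hcu : c ≠ u := fun e => h.left (e ▸ hcT)
    have hcv : c ≠ v := fun e => h.right (e ▸ hcT)
    have hcσ' : c ∉ σ := fun hh => hcσ (Finset.mem_erase.mpr ⟨hcu, hh⟩)
    have hadj : ∀ b, b ≠ v → LinkAdj K σ v b → LinkAdj K' σ c b := by
      rintro b hb ⟨-, hbσ, h3⟩
      have hb' : b ∈ T := by
        have hbu : b ≠ u := fun e => hbσ (e ▸ hu)
        refine (h.of_join (insert b (σ.erase u)) ?_ ?_ ?_).1 (Finset.mem_insert_self _ _)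
        · simpa using hbu.symm
        · simp only [Finset.mem_insert, Finset.mem_erase]
          tauto
        · rw [Finset.insert_comm, Finset.insert_comm u b, Finset.insert_erase hu]
          exact h3
      refine ⟨hcσ', hbσ, ?_⟩
      have := h.insert_left_mem (γ := insert c (insert b (σ.erase u)))
        (Finset.insert_subset hcT (Finset.insert_subset hb' hγ.1))
      rwa [Finset.insert_comm, Finset.insert_comm u b, Finset.insert_erase hu] at this
    refine hc.map (fun x => if x = v then c else x) ?_ ?_
    · intro a b hab
      by_cases ha : a = v <;> by_cases hb : b = v
      · simp only [ha, hb, if_true]; exact .refl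
      · simp only [ha, hb, if_true, if_false]; exact .single (hadj b hb (ha ▸ hab))
      · simp only [ha, hb, if_true, if_false]; exact .single (hadj a ha (hb ▸ hab.symm)).symm
      · simp only [ha, hb, if_false]; exact .single (old a b ha hb hab)
    · intro y hy
      obtain ⟨h1, h2⟩ := hex y hy
      exact ⟨y, h1, by simp only [h2, if_false]; exact .refl⟩
  · refine hc.map id ?_ fun y hy => ⟨y, (hex y hy).1, .refl⟩
    intro a b hab
    exact .single (old a b (fun e => hev (e ▸ hab.left)) (fun e => hev (e ▸ hab.right)) hab)

/-- In the link of a face that contains neither `u` nor `v`, the edge `uv` is replaced by a path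
through a vertex of `T`. -/
theorem linkConn_of_notMem (h : IsFlip K K' u v T) {σ : Finset V} (hσ : σ.card ≤ 2)
    (hc : LinkConn K σ) (hu : u ∉ σ) (hv : v ∉ σ) : LinkConn K' σ := by
  have path : insert u (insert v σ) ∈ K.faces → LinkPath K' σ u v := by
    intro huv
    obtain ⟨c, hcT, hcσ⟩ := Finset.exists_of_ssubset (h.of_join σ hu hv huv)
    have hs : insert c σ ⊆ T := Finset.insert_subset hcT (h.of_join σ hu hv huv).1
    exact (Relation.ReflTransGen.single ⟨hu, hcσ, h.insert_left_mem hs⟩).tail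
      ⟨hcσ, hv, by rw [Finset.insert_comm]; exact h.symm.insert_left_mem hs⟩
  refine hc.map id ?_ ?_
  · intro a b hab
    by_cases hh : u ∈ insert a (insert b σ) ∧ v ∈ insert a (insert b σ)
    · obtain ⟨h1, h2⟩ := hh
      simp only [Finset.mem_insert, hu, hv, or_false] at h1 h2
      rcases h1 with h1 | h1 <;> rcases h2 with h2 | h2
      · exact absurd (h1.trans h2.symm) h.ne
      · subst h1 h2; exact path hab.2.2
      · subst h1 h2; exact (path hab.symm.2.2).symm
      · exact absurd (h1.trans h2.symm) h.ne
    · exact .single ⟨hab.1, hab.2.1, (h.mem _).2 (Or.inl ⟨hab.2.2, hh⟩)⟩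
  · rintro y ⟨hy, hy'⟩
    have c1 := h.card_insert_left
    have c2 := h.symm.card_insert_left
    have cy := Finset.card_insert_of_notMem hy
    rcases (h.mem _).1 hy' with ⟨hK, -⟩ | e | e | e
    · exact ⟨y, ⟨hy, hK⟩, .refl⟩
    · have hσT : σ ⊂ T := e ▸ Finset.ssubset_insert hy
      exact ⟨u, ⟨hu, h.insert_left hσT⟩, .single ⟨hu, hy, by rw [e, h.mem]; tauto⟩⟩
    · rw [e] at cy; omega
    · rw [e] at cy; omega

theorem isPM (h : IsFlip K K' u v T) (hK : IsPM 3 K) : IsPM 3 K' := by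
  have hmemT : T ∈ K'.faces := by rw [h.mem]; tauto
  refine ⟨?_, ⟨T, hmemT⟩, ?_, h.pure hK, h.two hK, ?_⟩
  · refine (hK.finite.union (Set.toFinite {T, insert u T, insert v T})).subset ?_
    intro σ hσ
    rcases (h.mem σ).1 hσ with h1 | h1
    · exact Or.inl h1.1
    · exact Or.inr h1
  · intro σ hσ
    obtain ⟨τ, -, hs, hc⟩ := h.pure hK σ hσ
    exact (Finset.card_le_card hs).trans hc.le
  · intro σ hσ hc
    have c1 := h.card_insert_left
    have c2 := h.symm.card_insert_left
    have c3 := h.card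
    have hσK : (σ = ∅ ∨ σ ∈ K.faces) ∧ ¬ (u ∈ σ ∧ v ∈ σ) := by
      rcases hσ with rfl | hσ
      · simp
      · rcases (h.mem σ).1 hσ with h1 | rfl | rfl | rfl
        · exact ⟨Or.inr h1.1, h1.2⟩
        all_goals omega
    have hcon := hK.conn σ hσK.1 hc
    by_cases hu : u ∈ σ
    · exact h.linkConn_of_mem (by omega) hcon hu fun hv => hσK.2 ⟨hu, hv⟩
    · by_cases hv : v ∈ σ
      · exact h.symm.linkConn_of_mem (by omega) hcon hv hu
      · exact h.linkConn_of_notMem (by omega) hcon hu hv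

/-- A bistellar move at an edge of degree three removes this edge and no vertex. -/
theorem g2_lt (h : IsFlip K K' u v T) (hK : IsPM 3 K) : g2 K' < g2 K := by
  have hf' := (h.isPM hK).finite
  have c1 := h.card_insert_left
  have c2 := h.symm.card_insert_left
  have c3 := h.card
  have hne : T.Nonempty := Finset.card_pos.mp (by omega)
  have huv : {u, v} ∈ K.faces := h.join ∅ (Finset.empty_ssubset.mpr hne)
  have h0 : facesOfCard hf' 1 = facesOfCard hK.finite 1 := by
    ext σ
    rw [mem_facesOfCard, mem_facesOfCard, h.mem]
    refine and_congr_left fun hc => ⟨?_, fun hσ => Or.inl ⟨hσ, fun hh => ?_⟩⟩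
    · rintro (h1 | rfl | rfl | rfl)
      · exact h1.1
      all_goals omega
    · exact h.ne (Finset.card_le_one.mp hc.le _ hh.1 _ hh.2)
  have h1 : facesOfCard hf' 2 = (facesOfCard hK.finite 2).erase {u, v} := by
    ext σ
    rw [Finset.mem_erase, mem_facesOfCard, mem_facesOfCard, h.mem]
    constructor
    · rintro ⟨h1 | rfl | rfl | rfl, hc⟩
      · refine ⟨?_, h1.1, hc⟩
        rintro rfl
        exact h1.2 (by simp)
      all_goals omega
    · rintro ⟨hn, hσ, hc⟩
      refine ⟨Or.inl ⟨hσ, fun hh => hn ?_⟩, hc⟩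
      symm
      apply Finset.eq_of_subset_of_card_le
      · intro x hx
        rw [Finset.mem_insert, Finset.mem_singleton] at hx
        rcases hx with rfl | rfl
        exacts [hh.1, hh.2]
      · rw [Finset.card_pair h.ne, hc]
  have huv' : {u, v} ∈ facesOfCard hK.finite 2 := mem_facesOfCard.mpr ⟨huv, Finset.card_pair h.ne⟩
  have e0 : fNum K' 0 = fNum K 0 := by
    rw [fNum_eq hf', fNum_eq hK.finite]; exact congrArg Finset.card h0
  have e1 : fNum K' 1 + 1 = fNum K 1 := by
    rw [fNum_eq hf', fNum_eq hK.finite]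
    change (facesOfCard hf' 2).card + 1 = (facesOfCard hK.finite 2).card
    rw [h1, Finset.card_erase_add_one huv']
  rw [g2, g2]
  omega

end IsFlip

/-- An edge whose link is the boundary of a missing triangle makes `K` reducible. -/
theorem isReducible_of_link_eq_simplexBoundary {K : PreAbstractSimplicialComplex V} (hK : IsPM 3 K)
    {u v : V} {T : Finset V} (huv : u ≠ v) (he : {u, v} ∈ K.faces) (hT : T.card = 3)
    (hl : link K {u, v} = simplexBoundary T) (hTK : T ∉ K.faces) : IsReducible K := by
  have hTn : T.Nonempty := Finset.card_pos.mp (by omega)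
  have hmem : ∀ γ : Finset V, (γ.Nonempty ∧ Disjoint γ {u, v} ∧ γ ∪ {u, v} ∈ K.faces) ↔
      γ.Nonempty ∧ γ ⊂ T := fun γ => Set.ext_iff.mp (congrArg (·.faces) hl) γ
  have hins : ∀ γ : Finset V, γ ∪ {u, v} = insert u (insert v γ) := by
    intro γ; ext x; simp only [Finset.mem_union, Finset.mem_insert, Finset.mem_singleton]; tauto
  have hdis : ∀ x ∈ T, x ≠ u ∧ x ≠ v := by
    intro x hx
    have hs : {x} ⊂ T := (Finset.singleton_subset_iff.mpr hx).ssubset_of_ne fun e => by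
      rw [← e] at hT; simp at hT
    have := ((hmem {x}).2 ⟨by simp, hs⟩).2.1
    simpa using this
  have hu : u ∉ T := fun hh => (hdis u hh).1 rfl
  have hv : v ∉ T := fun hh => (hdis v hh).2 rfl
  have join : ∀ γ, γ ⊂ T → insert u (insert v γ) ∈ K.faces := by
    intro γ hγ
    rcases Finset.eq_empty_or_nonempty γ with rfl | hn
    · simpa using he
    · rw [← hins]; exact ((hmem γ).2 ⟨hn, hγ⟩).2.2
  let K' : PreAbstractSimplicialComplex V :=
    deleteStar K {u, v} ⊔ simplex (insert u T) ⊔ simplex (insert v T)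
  have hfaces : K'.faces = (deleteStar K {u, v}).faces ∪ {T, insert u T, insert v T} := by
    have aux : ∀ a ∈ ({u, v} : Finset V), ∀ σ : Finset V, σ.Nonempty → σ ⊆ insert a T →
        σ ∈ (deleteStar K {u, v}).faces ∨ σ = T ∨ σ = insert a T := by
      intro a ha σ hn hs
      by_cases h1 : σ = T
      · tauto
      by_cases h2 : σ = insert a T
      · tauto
      left
      have hss : σ.erase a ⊂ T := by
        refine (Finset.subset_insert_iff.mp hs).ssubset_of_ne fun e => ?_
        by_cases haσ : a ∈ σ
        · exact h2 (by rw [← e, Finset.insert_erase haσ])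
        · exact h1 (by rwa [Finset.erase_eq_of_notMem haσ] at e)
      refine ⟨face_mono (join _ hss) ?_ hn, fun hh => ?_⟩
      · intro x hx
        simp only [Finset.mem_insert, Finset.mem_erase, Finset.mem_singleton] at ha ⊢
        by_cases hxa : x = a
        · subst hxa; tauto
        · tauto
      · have h3 := hs (hh (show u ∈ ({u, v} : Finset V) by simp))
        have h4 := hs (hh (show v ∈ ({u, v} : Finset V) by simp))
        rw [Finset.mem_insert] at h3 h4
        exact huv ((h3.resolve_right hu).trans (h4.resolve_right hv).symm)
    ext σ
    change (σ ∈ (deleteStar K {u, v}).faces ∨ (σ.Nonempty ∧ σ ⊆ insert u T)) ∨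
      (σ.Nonempty ∧ σ ⊆ insert v T) ↔ _ ∨ σ = T ∨ σ = insert u T ∨ σ = insert v T
    constructor
    · rintro ((h1 | ⟨h1, h2⟩) | ⟨h1, h2⟩)
      · exact Or.inl h1
      · have := aux u (by simp) σ h1 h2; tauto
      · have := aux v (by simp) σ h1 h2; tauto
    · rintro (h1 | rfl | rfl | rfl)
      · exact Or.inl (Or.inl h1)
      · exact Or.inl (Or.inr ⟨hTn, Finset.subset_insert _ _⟩)
      · exact Or.inl (Or.inr ⟨by simp, subset_rfl⟩)
      · exact Or.inr ⟨by simp, subset_rfl⟩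
  have hflip : IsFlip K K' u v T := by
    refine ⟨huv, hu, hv, hT, hTK, join, ?_, ?_⟩
    · intro γ h1 h2 h3
      rcases Finset.eq_empty_or_nonempty γ with rfl | hn
      · exact Finset.empty_ssubset.mpr hTn
      · exact ((hmem γ).1 ⟨hn, by simp [h1, h2], by rwa [hins]⟩).2
    · intro σ
      rw [hfaces]
      change (σ ∈ K.faces ∧ ¬ {u, v} ⊆ σ) ∨ σ = T ∨ σ = insert u T ∨ σ = insert v T ↔ _
      rw [Finset.insert_subset_iff, Finset.singleton_subset_iff]
  exact ⟨K', (hflip.isPM hK).isNormalPseudomanifold,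
    Or.inl ⟨u, v, T, huv, he, hT, hl, hTK, hfaces⟩, hflip.g2_lt hK⟩

/-! ### Neighbourhoods -/

/-- The vertices of the link of `σ` in a finite complex. -/
noncomputable def exts {K : PreAbstractSimplicialComplex V} (h : K.faces.Finite) (σ : Finset V) :
    Finset V :=
  @Finset.filter _ (Ext K σ) (Classical.decPred _) (h.toFinset.biUnion id)

theorem mem_exts {K : PreAbstractSimplicialComplex V} {h : K.faces.Finite} {σ : Finset V} {x : V} :
    x ∈ exts h σ ↔ Ext K σ x := by
  classical
  rw [exts, Finset.mem_filter, and_iff_right_iff_imp]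
  intro hx
  rw [Finset.mem_biUnion]
  exact ⟨_, h.mem_toFinset.mpr hx.2, Finset.mem_insert_self _ _⟩

theorem card_filter_mem_edges {K : PreAbstractSimplicialComplex V} (h : K.faces.Finite) (a : V) :
    ((facesOfCard h 2).filter fun e => a ∈ e).card = (exts h {a}).card := by
  rw [← Finset.card_image_of_injOn (s := exts h {a}) (f := fun p => insert p ({a} : Finset V))]
  · congr 1
    ext e
    simp only [Finset.mem_filter, mem_facesOfCard, Finset.mem_image, mem_exts]
    rw [← Finset.singleton_subset_iff, and_assoc]
    exact Set.ext_iff.mp (setOf_coface_eq (K := K) (Finset.card_singleton a)) e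
  · intro p hp q hq
    exact injOn_insert_ext (K := K) (mem_exts.mp hp) (mem_exts.mp hq)

theorem TwoExt.card_exts {K : PreAbstractSimplicialComplex V} (h : K.faces.Finite) {σ : Finset V}
    (h2 : TwoExt K σ) : (exts h σ).card = 2 := by
  obtain ⟨p, q, hpq, hr⟩ := h2
  have : exts h σ = {p, q} := by
    ext r; rw [mem_exts, hr]; simp
  rw [this, Finset.card_pair hpq]

theorem TwoExt.exists_ne {K : PreAbstractSimplicialComplex V} {σ : Finset V} (h2 : TwoExt K σ)
    {p : V} (hp : Ext K σ p) : ∃ q, q ≠ p ∧ ∀ r, Ext K σ r ↔ r = p ∨ r = q := by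
  obtain ⟨a, b, hab, hr⟩ := h2
  rcases (hr p).1 hp with rfl | rfl
  · exact ⟨b, hab.symm, hr⟩
  · exact ⟨a, hab, fun r => (hr r).trans or_comm⟩

/-- In a cycle, the two neighbours of a vertex `v` are joined by a path that avoids `v`: otherwise
the component of one of them would have a single vertex of odd degree. -/
theorem exists_path_avoiding {K : PreAbstractSimplicialComplex V} (hfin : K.faces.Finite)
    {σ : Finset V} {v p q : V} (hvσ : v ∉ σ) (h2 : ∀ y, Ext K σ y → TwoExt K (insert y σ))
    (hv : ∀ r, Ext K (insert v σ) r ↔ r = p ∨ r = q) :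
    Relation.ReflTransGen (fun a b => a ≠ v ∧ b ≠ v ∧ LinkAdj K σ a b) p q := by
  classical
  have hp := (hv p).2 (Or.inl rfl)
  have ext_comm : ∀ {a b : V}, a ∉ σ → Ext K (insert a σ) b → Ext K (insert b σ) a := by
    intro a b ha hab
    have hba := hab.1
    rw [Finset.mem_insert, not_or] at hba
    refine ⟨?_, by rw [Finset.insert_comm]; exact hab.2⟩
    rw [Finset.mem_insert, not_or]
    exact ⟨fun e => hba.1 e.symm, ha⟩
  have ext_of : ∀ {a b : V}, Ext K (insert a σ) b → Ext K σ b := by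
    intro a b hab
    have hba := hab.1
    rw [Finset.mem_insert, not_or] at hba
    exact ⟨hba.2, face_mono hab.2
      (Finset.insert_subset_insert _ (Finset.subset_insert _ _)) (by simp)⟩
  have ne_of : ∀ {a b : V}, Ext K (insert a σ) b → b ≠ a := fun hab e => hab.1 (by simp [e])
  set R : V → V → Prop := fun a b => a ≠ v ∧ b ≠ v ∧ LinkAdj K σ a b with hR
  set C : Finset V := (exts hfin σ).filter (fun y => y ≠ v ∧ Relation.ReflTransGen R p y) with hC
  have memC : ∀ y, y ∈ C ↔ Ext K σ y ∧ y ≠ v ∧ Relation.ReflTransGen R p y := by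
    intro y; rw [hC, Finset.mem_filter, mem_exts]
  let G : SimpleGraph C :=
    { Adj := fun a b => Ext K (insert a.1 σ) b.1
      symm := ⟨fun a b hab => ext_comm ((memC _).1 a.2).1.1 hab⟩
      loopless := ⟨fun a ha => ne_of ha rfl⟩ }
  have hdeg : ∀ y : C, G.degree y = ((exts hfin (insert y.1 σ)).erase v).card := by
    intro y
    rw [← SimpleGraph.card_neighborFinset_eq_degree]
    rw [← Finset.card_map (Function.Embedding.subtype (· ∈ C))]
    congr 1
    ext z
    simp only [Finset.mem_map, SimpleGraph.mem_neighborFinset, Function.Embedding.coe_subtype,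
      Finset.mem_erase, mem_exts]
    constructor
    · rintro ⟨z', hz', rfl⟩
      exact ⟨((memC _).1 z'.2).2.1, hz'⟩
    · rintro ⟨hzv, hz⟩
      have hy := (memC _).1 y.2
      have hz' := ext_of hz
      have : R y.1 z := ⟨hy.2.1, hzv, hy.1.1, hz'.1, by rw [Finset.insert_comm]; exact hz.2⟩
      exact ⟨⟨z, (memC z).2 ⟨hz', hzv, hy.2.2.tail this⟩⟩, hz, rfl⟩
  have hpC : p ∈ C := (memC p).2 ⟨ext_of hp, ne_of hp, .refl⟩
  have hodd : Odd (G.degree ⟨p, hpC⟩) := by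
    rw [hdeg, Finset.card_erase_of_mem (mem_exts.mpr (ext_comm hvσ hp)),
      (h2 p (ext_of hp)).card_exts]
    decide
  obtain ⟨y, hyp, hy⟩ := G.exists_ne_odd_degree_of_exists_odd_degree _ hodd
  have hyC := (memC _).1 y.2
  have hvy : Ext K (insert y.1 σ) v := by
    by_contra hn
    rw [hdeg, Finset.erase_eq_of_notMem (fun hh => hn (mem_exts.mp hh)),
      (h2 y.1 hyC.1).card_exts] at hy
    exact absurd hy (by decide)
  have := (hv y.1).1 (ext_comm hyC.1.1 hvy)
  rcases this with e | e
  · exact absurd (Subtype.ext e) hyp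
  · exact e ▸ hyC.2.2

/-! ### Edge contractions -/

/-- `K'` is obtained from `K` by contracting the edge `uv` to the new vertex `w`, where
`lk(u) ∩ lk(v) = lk(uv)`. -/
structure IsContraction (K K' : PreAbstractSimplicialComplex V) (u v w : V) : Prop where
  ne : u ≠ v
  edge : {u, v} ∈ K.faces
  fresh : ∀ σ ∈ K.faces, w ∉ σ
  link : ∀ γ, u ∉ γ → v ∉ γ → insert u γ ∈ K.faces → insert v γ ∈ K.faces →
    insert u (insert v γ) ∈ K.faces
  finite : K'.faces.Finite
  notMem : ∀ σ ∈ K'.faces, u ∉ σ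
  notMem' : ∀ σ ∈ K'.faces, v ∉ σ
  mem : ∀ σ, u ∉ σ → v ∉ σ → w ∉ σ → (σ ∈ K'.faces ↔ σ ∈ K.faces)
  mem_insert : ∀ σ, u ∉ σ → v ∉ σ → w ∉ σ →
    (insert w σ ∈ K'.faces ↔ insert u σ ∈ K.faces ∨ insert v σ ∈ K.faces)

namespace IsContraction

variable {K K' : PreAbstractSimplicialComplex V} {u v w : V}

theorem symm (h : IsContraction K K' u v w) : IsContraction K K' v u w where
  ne := h.ne.symm
  edge := by rw [Finset.pair_comm]; exact h.edge
  fresh := h.fresh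
  link γ h1 h2 h3 h4 := by rw [Finset.insert_comm]; exact h.link γ h2 h1 h4 h3
  finite := h.finite
  notMem := h.notMem'
  notMem' := h.notMem
  mem σ h1 h2 h3 := h.mem σ h2 h1 h3
  mem_insert σ h1 h2 h3 := (h.mem_insert σ h2 h1 h3).trans or_comm

/-- Every face of `K'` not containing `w` is a face of `K`; the other ones are of the form
`insert w γ`. -/
theorem cases_mem (h : IsContraction K K' u v w) {σ : Finset V} (hσ : σ ∈ K'.faces) :
    (u ∉ σ ∧ v ∉ σ ∧ w ∉ σ ∧ σ ∈ K.faces) ∨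
    ∃ γ, σ = insert w γ ∧ u ∉ γ ∧ v ∉ γ ∧ w ∉ γ ∧
      (insert u γ ∈ K.faces ∨ insert v γ ∈ K.faces) := by
  have hu := h.notMem σ hσ
  have hv := h.notMem' σ hσ
  by_cases hw : w ∈ σ
  · right
    have hu' : u ∉ σ.erase w := fun hh => hu (Finset.mem_of_mem_erase hh)
    have hv' : v ∉ σ.erase w := fun hh => hv (Finset.mem_of_mem_erase hh)
    exact ⟨σ.erase w, (Finset.insert_erase hw).symm, hu', hv', Finset.notMem_erase w σ,
      (h.mem_insert _ hu' hv' (Finset.notMem_erase w σ)).1 (by rwa [Finset.insert_erase hw])⟩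
  · exact Or.inl ⟨hu, hv, hw, (h.mem σ hu hv hw).1 hσ⟩

theorem insert_mem (h : IsContraction K K' u v w) {γ : Finset V} (hu : u ∉ γ) (hv : v ∉ γ)
    (hγ : insert u γ ∈ K.faces) : insert w γ ∈ K'.faces :=
  (h.mem_insert γ hu hv fun hw => h.fresh _ hγ (Finset.mem_insert_of_mem hw)).2 (Or.inl hγ)

theorem pure_aux (h : IsContraction K K' u v w) (hK : IsPM 3 K) {γ : Finset V} (hu : u ∉ γ)
    (hv : v ∉ γ) (hγ : insert u γ ∈ K.faces) :
    ∃ τ ∈ K'.faces, insert w γ ⊆ τ ∧ τ.card = 4 := by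
  suffices ∃ δ, γ ⊆ δ ∧ u ∉ δ ∧ v ∉ δ ∧ insert u δ ∈ K.faces ∧ δ.card = 3 by
    obtain ⟨δ, h1, h2, h3, h4, h5⟩ := this
    refine ⟨insert w δ, h.insert_mem h2 h3 h4, Finset.insert_subset_insert _ h1, ?_⟩
    rw [Finset.card_insert_of_notMem fun hw => h.fresh _ h4 (Finset.mem_insert_of_mem hw), h5]
  obtain ⟨τ, hτ, hs, hc⟩ := hK.pure _ hγ
  have huτ : u ∈ τ := hs (Finset.mem_insert_self _ _)
  have hγτ : γ ⊆ τ := (Finset.subset_insert _ _).trans hs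
  by_cases hvτ : v ∈ τ
  · have hc3 : (τ.erase v).card = 3 := by rw [Finset.card_erase_of_mem hvτ, hc]
    have h3 : τ.erase v ∈ K.faces :=
      face_mono hτ (Finset.erase_subset _ _) (Finset.card_pos.mp (by omega))
    obtain ⟨p, hp, hr⟩ := (hK.two _ h3 hc3).exists_ne (p := v)
      ⟨Finset.notMem_erase v τ, by rwa [Finset.insert_erase hvτ]⟩
    obtain ⟨hp1, hp2⟩ := (hr p).2 (Or.inr rfl)
    have huv : u ∈ τ.erase v := Finset.mem_erase.mpr ⟨h.ne, huτ⟩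
    have hup : u ∈ insert p (τ.erase v) := Finset.mem_insert_of_mem huv
    refine ⟨(insert p (τ.erase v)).erase u, ?_, Finset.notMem_erase _ _, ?_, ?_, ?_⟩
    · intro x hx
      refine Finset.mem_erase.mpr ⟨fun e => hu (e ▸ hx), Finset.mem_insert_of_mem ?_⟩
      exact Finset.mem_erase.mpr ⟨fun e => hv (e ▸ hx), hγτ hx⟩
    · simp only [Finset.mem_erase, Finset.mem_insert]
      have := hp.symm
      tauto
    · rwa [Finset.insert_erase hup]
    · rw [Finset.card_erase_of_mem hup, Finset.card_insert_of_notMem hp1, hc3]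
  · refine ⟨τ.erase u, ?_, Finset.notMem_erase _ _,
      fun hh => hvτ (Finset.mem_of_mem_erase hh), by rwa [Finset.insert_erase huτ],
      by rw [Finset.card_erase_of_mem huτ, hc]⟩
    exact fun x hx => Finset.mem_erase.mpr ⟨fun e => hu (e ▸ hx), hγτ hx⟩

theorem pure (h : IsContraction K K' u v w) (hK : IsPM 3 K) :
    ∀ σ ∈ K'.faces, ∃ τ ∈ K'.faces, σ ⊆ τ ∧ τ.card = 4 := by
  intro σ hσ
  rcases h.cases_mem hσ with ⟨hu, hv, hw, hσK⟩ | ⟨γ, rfl, hu, hv, hw, hγ | hγ⟩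
  · obtain ⟨τ, hτ, hs, hc⟩ := hK.pure σ hσK
    by_cases huτ : u ∈ τ
    · obtain ⟨ρ, hρ, hs', hc'⟩ := h.pure_aux hK hu hv
        (face_mono hτ (Finset.insert_subset huτ hs) (by simp))
      exact ⟨ρ, hρ, (Finset.subset_insert _ _).trans hs', hc'⟩
    by_cases hvτ : v ∈ τ
    · obtain ⟨ρ, hρ, hs', hc'⟩ := h.symm.pure_aux hK hv hu
        (face_mono hτ (Finset.insert_subset hvτ hs) (by simp))
      exact ⟨ρ, hρ, (Finset.subset_insert _ _).trans hs', hc'⟩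
    exact ⟨τ, (h.mem τ huτ hvτ (h.fresh τ hτ)).2 hτ, hs, hc⟩
  · exact h.pure_aux hK hu hv hγ
  · exact h.symm.pure_aux hK hv hu hγ

theorem two_of_ext (h : IsContraction K K' u v w) {σ : Finset V}
    (hu : u ∉ σ) (hv : v ∉ σ) (hw : w ∉ σ) (hnot : ¬ (Ext K σ u ∧ Ext K σ v))
    (h2 : TwoExt K σ) (hue : Ext K σ u) : TwoExt K' σ := by
  obtain ⟨q, hq, hr⟩ := h2.exists_ne hue
  have hqe := (hr q).2 (Or.inr rfl)
  have hqv : q ≠ v := fun e => hnot ⟨hue, e ▸ hqe⟩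
  have hwq : w ≠ q := fun e => h.fresh _ hqe.2 (by simp [e])
  refine ⟨w, q, hwq, fun r => ⟨?_, ?_⟩⟩
  · rintro ⟨h1, h2⟩
    rw [or_iff_not_imp_left]
    intro hrw
    have hur : u ∉ insert r σ := h.notMem _ h2
    have hK := (h.mem _ hur (h.notMem' _ h2) (by
      rw [Finset.mem_insert, not_or]; exact ⟨fun e => hrw e.symm, hw⟩)).1 h2
    refine ((hr r).1 ⟨h1, hK⟩).resolve_left fun e => hur (by simp [e])
  · rintro (rfl | rfl)
    · exact ⟨hw, h.insert_mem hu hv hue.2⟩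
    · refine ⟨hqe.1, (h.mem _ ?_ ?_ (h.fresh _ hqe.2)).2 hqe.2⟩
      · rw [Finset.mem_insert, not_or]; exact ⟨fun e => hq e.symm, hu⟩
      · rw [Finset.mem_insert, not_or]; exact ⟨fun e => hqv e.symm, hv⟩

theorem ext_insert_iff (h : IsContraction K K' u v w) {γ : Finset V} (hu : u ∉ γ) (hv : v ∉ γ)
    (hw : w ∉ γ) (r : V) : Ext K' (insert w γ) r ↔
      (r ≠ v ∧ Ext K (insert u γ) r) ∨ (r ≠ u ∧ Ext K (insert v γ) r) := by
  have key : ∀ r, r ≠ u → r ≠ v → r ≠ w → (insert r (insert w γ) ∈ K'.faces ↔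
      insert r (insert u γ) ∈ K.faces ∨ insert r (insert v γ) ∈ K.faces) := by
    intro r hru hrv hrw
    rw [Finset.insert_comm, Finset.insert_comm r u, Finset.insert_comm r v]
    apply h.mem_insert <;> rw [Finset.mem_insert, not_or]
    · exact ⟨hru.symm, hu⟩
    · exact ⟨hrv.symm, hv⟩
    · exact ⟨hrw.symm, hw⟩
  constructor
  · rintro ⟨h1, h2⟩
    rw [Finset.mem_insert, not_or] at h1
    have hru : r ≠ u := fun e => h.notMem _ h2 (by simp [e])
    have hrv : r ≠ v := fun e => h.notMem' _ h2 (by simp [e])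
    rcases (key r hru hrv h1.1).1 h2 with h3 | h3
    · exact Or.inl ⟨hrv, by simp [hru, h1.2], h3⟩
    · exact Or.inr ⟨hru, by simp [hrv, h1.2], h3⟩
  · rintro (⟨hr, h1, h2⟩ | ⟨hr, h1, h2⟩) <;> rw [Finset.mem_insert, not_or] at h1
    · have hrw : r ≠ w := fun e => h.fresh _ h2 (by simp [e])
      exact ⟨by simp [hrw, h1.2], (key r h1.1 hr hrw).2 (Or.inl h2)⟩
    · have hrw : r ≠ w := fun e => h.fresh _ h2 (by simp [e])
      exact ⟨by simp [hrw, h1.2], (key r hr h1.1 hrw).2 (Or.inr h2)⟩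

theorem two_insert (h : IsContraction K K' u v w) (hK : IsPM 3 K) {γ : Finset V} (hu : u ∉ γ)
    (hv : v ∉ γ) (hw : w ∉ γ) (hc : γ.card = 2) (hγ : insert u γ ∈ K.faces) :
    TwoExt K' (insert w γ) := by
  have hcu : (insert u γ).card = 3 := by rw [Finset.card_insert_of_notMem hu, hc]
  have hcv : (insert v γ).card = 3 := by rw [Finset.card_insert_of_notMem hv, hc]
  by_cases hγ' : insert v γ ∈ K.faces
  · have huv := h.link γ hu hv hγ hγ'
    have e1 : Ext K (insert u γ) v :=
      ⟨by simp [h.ne.symm, hv], by rw [Finset.insert_comm]; exact huv⟩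
    have e2 : Ext K (insert v γ) u := ⟨by simp [h.ne, hu], huv⟩
    obtain ⟨p, hp, hpr⟩ := (hK.two _ hγ hcu).exists_ne e1
    obtain ⟨q, hq, hqr⟩ := (hK.two _ hγ' hcv).exists_ne e2
    have hpe := (hpr p).2 (Or.inr rfl)
    have hqe := (hqr q).2 (Or.inr rfl)
    refine ⟨p, q, ?_, fun r => ?_⟩
    · rintro rfl
      have hp1 := hpe.1
      have hp2 := hqe.1
      simp only [Finset.mem_insert, not_or] at hp1 hp2
      have h5 := h.link (insert p γ) (by simp [Ne.symm hp1.1, hu]) (by simp [Ne.symm hp2.1, hv])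
        (by rw [Finset.insert_comm]; exact hpe.2) (by rw [Finset.insert_comm]; exact hqe.2)
      have := hK.dim _ h5
      rw [Finset.card_insert_of_notMem (by simp [h.ne, Ne.symm hp1.1, hu]),
        Finset.card_insert_of_notMem (by simp [Ne.symm hp2.1, hv]),
        Finset.card_insert_of_notMem hp1.2, hc] at this
      omega
    · rw [h.ext_insert_iff hu hv hw, hpr, hqr]
      constructor
      · rintro (⟨h1, h2⟩ | ⟨h1, h2⟩) <;> tauto
      · rintro (rfl | rfl) <;> tauto
  · obtain ⟨p, q, hpq, hr⟩ := hK.two _ hγ hcu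
    refine ⟨p, q, hpq, fun r => ?_⟩
    rw [h.ext_insert_iff hu hv hw, ← hr]
    constructor
    · rintro (⟨-, h2⟩ | ⟨-, h2⟩)
      · exact h2
      · exact absurd (face_mono h2.2 (Finset.subset_insert _ _) (by simp)) hγ'
    · refine fun h2 => Or.inl ⟨?_, h2⟩
      rintro rfl
      exact hγ' (face_mono h2.2 (Finset.insert_subset_insert _ (Finset.subset_insert _ _))
        (by simp))

theorem two (h : IsContraction K K' u v w) (hK : IsPM 3 K) :
    ∀ σ ∈ K'.faces, σ.card = 3 → TwoExt K' σ := by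
  intro σ hσ hc
  rcases h.cases_mem hσ with ⟨hu, hv, hw, hσK⟩ | ⟨γ, rfl, hu, hv, hw, hγ | hγ⟩
  · have h2 := hK.two σ hσK hc
    have hnot : ¬ (Ext K σ u ∧ Ext K σ v) := by
      rintro ⟨h1, h2⟩
      have := hK.dim _ (h.link σ hu hv h1.2 h2.2)
      rw [Finset.card_insert_of_notMem (by simp [h.ne, hu]), Finset.card_insert_of_notMem hv,
        hc] at this
      omega
    by_cases hue : Ext K σ u
    · exact h.two_of_ext hu hv hw hnot h2 hue
    by_cases hve : Ext K σ v
    · exact h.symm.two_of_ext hv hu hw (fun hh => hnot hh.symm) h2 hve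
    obtain ⟨p, q, hpq, hr⟩ := h2
    refine ⟨p, q, hpq, fun r => ?_⟩
    rw [← hr]
    constructor
    · rintro ⟨h1, h2⟩
      refine ⟨h1, (h.mem _ (h.notMem _ h2) (h.notMem' _ h2) ?_).1 h2⟩
      rw [Finset.mem_insert, not_or]
      refine ⟨?_, hw⟩
      rintro rfl
      rcases (h.mem_insert σ hu hv hw).1 h2 with h3 | h3
      · exact hue ⟨hu, h3⟩
      · exact hve ⟨hv, h3⟩
    · rintro ⟨h1, h2⟩
      refine ⟨h1, (h.mem _ ?_ ?_ (h.fresh _ h2)).2 h2⟩ <;> rw [Finset.mem_insert, not_or]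
      · exact ⟨fun e => hue (e ▸ ⟨h1, h2⟩), hu⟩
      · exact ⟨fun e => hve (e ▸ ⟨h1, h2⟩), hv⟩
  · exact h.two_insert hK hu hv hw (by rw [Finset.card_insert_of_notMem hw] at hc; omega) hγ
  · exact h.symm.two_insert hK hv hu hw (by rw [Finset.card_insert_of_notMem hw] at hc; omega) hγ

/-- The link of a face of `K` is mapped onto its link in `K'` by sending `u` and `v` to `w`. -/
theorem linkConn_of_notMem (h : IsContraction K K' u v w) {σ : Finset V}
    (hc : LinkConn K σ) (hu : u ∉ σ) (hv : v ∉ σ) (hw : w ∉ σ) : LinkConn K' σ := by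
  have old : ∀ a b, a ≠ u → a ≠ v → b ≠ u → b ≠ v → LinkAdj K σ a b → LinkAdj K' σ a b := by
    rintro a b h1 h2 h3 h4 ⟨ha, hb, hab⟩
    exact ⟨ha, hb, (h.mem _ (by simp [h1.symm, h3.symm, hu]) (by simp [h2.symm, h4.symm, hv])
      (h.fresh _ hab)).2 hab⟩
  have new : ∀ b, b ≠ u → b ≠ v → LinkAdj K σ u b ∨ LinkAdj K σ v b → LinkAdj K' σ w b := by
    intro b h1 h2 hab
    have hb : b ∉ σ := by rcases hab with hab | hab <;> exact hab.2.1
    have hbw : w ∉ insert b σ := by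
      rcases hab with hab | hab <;>
      exact fun hh => h.fresh _ hab.2.2 (Finset.mem_insert_of_mem hh)
    refine ⟨hw, hb, (h.mem_insert _ (by simp [h1.symm, hu]) (by simp [h2.symm, hv]) hbw).2 ?_⟩
    exact hab.imp (·.2.2) (·.2.2)
  refine hc.map (fun x => if x = u ∨ x = v then w else x) ?_ ?_
  · intro a b hab
    by_cases ha : a = u ∨ a = v <;> by_cases hb : b = u ∨ b = v
    · simp only [ha, hb, if_true]; exact .refl
    · simp only [ha, hb, if_true, if_false]
      rw [not_or] at hb
      exact .single (new b hb.1 hb.2 (by rcases ha with rfl | rfl; exacts [Or.inl hab, Or.inr hab]))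
    · simp only [ha, hb, if_true, if_false]
      rw [not_or] at ha
      exact .single (new a ha.1 ha.2
        (by rcases hb with rfl | rfl; exacts [Or.inl hab.symm, Or.inr hab.symm])).symm
    · simp only [ha, hb, if_false]
      rw [not_or] at ha hb
      exact .single (old a b ha.1 ha.2 hb.1 hb.2 hab)
  · rintro y ⟨h1, h2⟩
    by_cases hyw : y = w
    · subst hyw
      rcases (h.mem_insert σ hu hv hw).1 h2 with h3 | h3
      · exact ⟨u, ⟨hu, h3⟩, by simp only [true_or, if_true]; exact .refl⟩
      · exact ⟨v, ⟨hv, h3⟩, by simp only [or_true, if_true]; exact .refl⟩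
    · have h3 := h.notMem _ h2
      have h4 := h.notMem' _ h2
      have hK := (h.mem _ h3 h4 (by
        rw [Finset.mem_insert, not_or]; exact ⟨fun e => hyw e.symm, hw⟩)).1 h2
      refine ⟨y, ⟨h1, hK⟩, ?_⟩
      rw [if_neg]
      · exact .refl
      · rintro (rfl | rfl)
        · exact h3 (Finset.mem_insert_self _ _)
        · exact h4 (Finset.mem_insert_self _ _)

theorem linkAdj_insert (h : IsContraction K K' u v w) {γ : Finset V} (hu : u ∉ γ) (hv : v ∉ γ)
    {a b : V} (ha : a ≠ v) (hb : b ≠ v) (hab : LinkAdj K (insert u γ) a b) :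
    LinkAdj K' (insert w γ) a b := by
  obtain ⟨h1, h2, h3⟩ := hab
  simp only [Finset.mem_insert, not_or] at h1 h2
  have hf := h.fresh _ h3
  simp only [Finset.mem_insert, not_or] at hf
  refine ⟨by simp [h1.2, Ne.symm hf.1], by simp [h2.2, Ne.symm hf.2.1], ?_⟩
  have := h.insert_mem (γ := insert a (insert b γ)) (by simp [Ne.symm h1.1, Ne.symm h2.1, hu])
    (by simp [ha.symm, hb.symm, hv]) (by
      rwa [Finset.insert_comm, Finset.insert_comm u b])
  rwa [Finset.insert_comm, Finset.insert_comm w b] at this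

/-- If `uγ` is a face but `vγ` is not, then the link of `wγ` is that of `uγ`. -/
theorem linkConn_insert_of_notMem (h : IsContraction K K' u v w) {γ : Finset V} (hu : u ∉ γ)
    (hv : v ∉ γ) (hw : w ∉ γ) (hc : LinkConn K (insert u γ)) (hγ : insert v γ ∉ K.faces) :
    LinkConn K' (insert w γ) := by
  have hne : ∀ a, Ext K (insert u γ) a → a ≠ v := by
    rintro a ha rfl
    exact hγ (face_mono ha.2 (Finset.insert_subset_insert _ (Finset.subset_insert _ _)) (by simp))
  refine hc.map id (fun a b hab => .single ?_) fun y hy => ⟨y, ?_, .refl⟩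
  · exact h.linkAdj_insert hu hv (hne a hab.left) (hne b hab.right) hab
  · rcases (h.ext_insert_iff hu hv hw y).1 hy with hy | hy
    · exact hy.2
    · exact absurd (face_mono hy.2.2 (Finset.subset_insert _ _) (by simp)) hγ

/-- The link of `w` is connected, since those of `u`, `v` and `uv` are. -/
theorem linkConn_singleton (h : IsContraction K K' u v w) (hK : IsPM 3 K) :
    LinkConn K' {w} := by
  obtain ⟨τ, hτ, hs, hc⟩ := hK.pure _ h.edge
  obtain ⟨x₀, hx₀, hx₀'⟩ := Finset.exists_mem_notMem_of_card_lt_card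
    (show ({u, v} : Finset V).card < τ.card by rw [hc, Finset.card_pair h.ne]; omega)
  have hx : Ext K {u, v} x₀ := ⟨hx₀', face_mono hτ (Finset.insert_subset hx₀ hs) (by simp)⟩
  have aux : ∀ {u v : V}, IsContraction K K' u v w → Ext K {u, v} x₀ → ∀ y, y ≠ v →
      Ext K {u} y → LinkPath K' {w} x₀ y := by
    intro u v h hx y hyv hy
    have hx0 := hx.1
    simp only [Finset.mem_insert, Finset.mem_singleton, not_or] at hx0
    have hfin : ∀ b, Ext K {u, v} b → LinkPath K' {w} x₀ b := by
      intro b hb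
      have hp := hK.conn {u, v} (Or.inr h.edge) (by rw [Finset.card_pair h.ne]) x₀ b hx hb
      refine hp.map id fun a c hac => .single ?_
      have h1 := hac.1
      have h2 := hac.2.1
      simp only [Finset.mem_insert, Finset.mem_singleton, not_or] at h1 h2
      refine h.linkAdj_insert (γ := ∅) (by simp) (by simp) h1.2 h2.2 ?_
      refine ⟨by simpa using h1.1, by simpa using h2.1, face_mono hac.2.2 ?_ (by simp)⟩
      exact Finset.insert_subset_insert _ (Finset.insert_subset_insert _ (by simp))
    have hadj : ∀ b, b ≠ v → LinkAdj K {u} v b → LinkPath K' {w} x₀ b := by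
      intro b hb hvb
      refine hfin b ⟨?_, ?_⟩
      · have := hvb.2.1
        simp only [Finset.mem_singleton] at this
        simp [this, hb]
      · exact face_congr hvb.2.2 (by
          ext z; simp only [Finset.mem_insert, Finset.mem_singleton]; tauto)
    have hxu : Ext K {u} x₀ := ⟨by simp [hx0.1], face_mono hx.2
      (Finset.insert_subset_insert _ (by simp)) (by simp)⟩
    have hp := (hK.conn {u} (Or.inr (face_mono h.edge (by simp) (by simp))) (by simp) x₀ y hxu
      hy).map (K' := K') (σ' := {w}) (fun z => if z = v then x₀ else z) (by
      intro a b hab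
      by_cases ha : a = v <;> by_cases hb : b = v
      · simp only [ha, hb, if_true]; exact .refl
      · simp only [ha, hb, if_true, if_false]; exact hadj b hb (ha ▸ hab)
      · simp only [ha, hb, if_true, if_false]; exact (hadj a ha (hb ▸ hab.symm)).symm
      · simp only [ha, hb, if_false]
        exact .single (h.linkAdj_insert (γ := ∅) (by simp) (by simp) ha hb hab))
    simpa only [hx0.2, hyv, if_false] using hp
  intro a b ha hb
  have key : ∀ y, Ext K' {w} y → LinkPath K' {w} x₀ y := by
    intro y hy
    rcases (h.ext_insert_iff (γ := ∅) (by simp) (by simp) (by simp) y).1 hy with ⟨h1, h2⟩ | ⟨h1, h2⟩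
    · exact aux h hx y h1 h2
    · exact aux h.symm (by rw [Finset.pair_comm]; exact hx) y h1 h2
  exact (key a ha).symm.trans (key b hb)

/-- The link of an edge `wx` with `x` in the link of `uv`: the cycles `lk(ux)` and `lk(vx)` lose the
vertices `v` and `u`, and the remaining paths have the same ends. -/
theorem linkConn_insert (h : IsContraction K K' u v w) (hK : IsPM 3 K) {γ : Finset V} (hu : u ∉ γ)
    (hv : v ∉ γ) (hw : w ∉ γ) (hc : γ.card = 1) (hγ : insert u γ ∈ K.faces)
    (hγ' : insert v γ ∈ K.faces) : LinkConn K' (insert w γ) := by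
  have huv := h.link γ hu hv hγ hγ'
  have hu' : u ∉ insert v γ := by simp [h.ne, hu]
  have hv' : v ∉ insert u γ := by simp [h.ne.symm, hv]
  obtain ⟨p, q, hpq, hr⟩ := hK.two _ huv (by
    rw [Finset.card_insert_of_notMem hu', Finset.card_insert_of_notMem hv, hc])
  have hpath : LinkPath K' (insert w γ) p q := by
    have := exists_path_avoiding hK.finite (K := K) (σ := insert u γ) (v := v) (p := p) (q := q)
      hv' (fun y hy => hK.two _ hy.2 (by
        rw [Finset.card_insert_of_notMem hy.1, Finset.card_insert_of_notMem hu, hc]))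
      (fun r => by rw [Finset.insert_comm]; exact hr r)
    exact Relation.ReflTransGen.mono
      (fun a b (hab : a ≠ v ∧ b ≠ v ∧ LinkAdj K (insert u γ) a b) =>
        h.linkAdj_insert hu hv hab.1 hab.2.1 hab.2.2) p q this
  have aux : ∀ {u v : V}, IsContraction K K' u v w → u ∉ γ → v ∉ γ → insert u γ ∈ K.faces →
      Ext K (insert u γ) v → (∀ r, Ext K (insert u (insert v γ)) r → r = p ∨ r = q) →
      ∀ y, y ≠ v → Ext K (insert u γ) y → LinkPath K' (insert w γ) y p := by
    intro u v h hu hv hγ hev hr y hyv hy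
    have hp := hK.conn _ (Or.inr hγ) (by rw [Finset.card_insert_of_notMem hu, hc]) y v hy hev
    clear hy
    induction hp using Relation.ReflTransGen.head_induction_on with
    | refl => exact absurd rfl hyv
    | @head a b hab _ ih =>
      by_cases hb : b = v
      · subst hb
        have ha : Ext K (insert u (insert b γ)) a := by
          refine ⟨?_, ?_⟩
          · have := hab.1
            simp only [Finset.mem_insert, not_or] at this ⊢
            exact ⟨this.1, hyv, this.2⟩
          · rw [Finset.insert_comm u b]; exact hab.2.2
        rcases hr a ha with rfl | rfl
        · exact .refl
        · exact hpath.symm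
      · exact .head (h.linkAdj_insert hu hv hyv hb hab) (ih hb)
  have key : ∀ y, Ext K' (insert w γ) y → LinkPath K' (insert w γ) y p := by
    intro y hy
    rcases (h.ext_insert_iff hu hv hw y).1 hy with ⟨h1, h2⟩ | ⟨h1, h2⟩
    · exact aux h hu hv hγ ⟨hv', by rw [Finset.insert_comm]; exact huv⟩
        (fun r => (hr r).1) y h1 h2
    · exact aux h.symm hv hu hγ' ⟨hu', huv⟩
        (fun r => by rw [Finset.insert_comm]; exact (hr r).1) y h1 h2
  exact fun a b ha hb => (key a ha).trans (key b hb).symm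

theorem isPM (h : IsContraction K K' u v w) (hK : IsPM 3 K) : IsPM 3 K' := by
  refine ⟨h.finite, ⟨{w}, ?_⟩, ?_, h.pure hK, h.two hK, ?_⟩
  · exact h.insert_mem (γ := ∅) (by simp) (by simp) (face_mono h.edge (by simp) (by simp))
  · intro σ hσ
    obtain ⟨τ, -, hs, hc⟩ := h.pure hK σ hσ
    exact (Finset.card_le_card hs).trans hc.le
  · rintro σ (rfl | hσ) hc
    · exact h.linkConn_of_notMem (hK.conn ∅ (Or.inl rfl) hc) (by simp) (by simp) (by simp)
    rcases h.cases_mem hσ with ⟨hu, hv, hw, hσK⟩ | ⟨γ, rfl, hu, hv, hw, hγ⟩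
    · exact h.linkConn_of_notMem (hK.conn σ (Or.inr hσK) hc) hu hv hw
    · rw [Finset.card_insert_of_notMem hw] at hc
      rcases Finset.eq_empty_or_nonempty γ with rfl | hne
      · exact h.linkConn_singleton hK
      have hc1 : γ.card = 1 := by have := Finset.card_pos.mpr hne; omega
      have hcu : (insert u γ).card = 2 := by rw [Finset.card_insert_of_notMem hu, hc1]
      have hcv : (insert v γ).card = 2 := by rw [Finset.card_insert_of_notMem hv, hc1]
      by_cases h1 : insert u γ ∈ K.faces <;> by_cases h2 : insert v γ ∈ K.faces
      · exact h.linkConn_insert hK hu hv hw hc1 h1 h2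
      · exact h.linkConn_insert_of_notMem hu hv hw (hK.conn _ (Or.inr h1) (by omega)) h2
      · exact h.symm.linkConn_insert_of_notMem hv hu hw (hK.conn _ (Or.inr h2) (by omega)) h1
      · tauto

theorem card_vertices (h : IsContraction K K' u v w) (hK : K.faces.Finite) :
    (facesOfCard h.finite 1).card + 1 = (facesOfCard hK 1).card := by
  have hu : {u} ∈ facesOfCard hK 1 :=
    mem_facesOfCard.mpr ⟨face_mono h.edge (by simp) (by simp), by simp⟩
  have hv : {v} ∈ (facesOfCard hK 1).erase {u} := by
    rw [Finset.mem_erase, mem_facesOfCard]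
    exact ⟨by simpa using h.ne.symm, face_mono h.edge (by simp) (by simp), by simp⟩
  have hw : {w} ∉ ((facesOfCard hK 1).erase {u}).erase {v} := by
    intro hh
    have := (mem_facesOfCard.mp (Finset.mem_of_mem_erase (Finset.mem_of_mem_erase hh))).1
    exact h.fresh _ this (by simp)
  have : facesOfCard h.finite 1 = insert {w} (((facesOfCard hK 1).erase {u}).erase {v}) := by
    ext σ
    simp only [Finset.mem_insert, Finset.mem_erase, mem_facesOfCard]
    constructor
    · rintro ⟨hσ, hc⟩
      rcases h.cases_mem hσ with ⟨h1, h2, h3, h4⟩ | ⟨γ, rfl, h1, h2, h3, -⟩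
      · refine Or.inr ⟨?_, ?_, h4, hc⟩ <;> rintro rfl
        · exact h2 (by simp)
        · exact h1 (by simp)
      · rw [Finset.card_insert_of_notMem h3] at hc
        have : γ = ∅ := Finset.card_eq_zero.mp (by omega)
        subst this
        exact Or.inl rfl
    · rintro (rfl | ⟨h1, h2, h3, hc⟩)
      · exact ⟨h.insert_mem (γ := ∅) (by simp) (by simp) (face_mono h.edge (by simp) (by simp)),
          by simp⟩
      · obtain ⟨x, rfl⟩ := Finset.card_eq_one.mp hc
        refine ⟨(h.mem _ ?_ ?_ (h.fresh _ h3)).2 h3, hc⟩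
        · simpa using fun e : u = x => h2 (by rw [e])
        · simpa using fun e : v = x => h1 (by rw [e])
  rw [this, Finset.card_insert_of_notMem hw, Finset.card_erase_add_one hv,
    Finset.card_erase_add_one hu]

theorem card_edges (h : IsContraction K K' u v w) (hK : K.faces.Finite) :
    (facesOfCard h.finite 2).card + 1 + (exts hK {u, v}).card = (facesOfCard hK 2).card := by
  have e1 : (facesOfCard hK 2).card = (exts hK {u}).card + (((exts hK {v}).card - 1) +
      ((facesOfCard hK 2).filter fun e => ¬ u ∈ e ∧ ¬ v ∈ e).card) := by
    rw [← Finset.card_filter_add_card_filter_not (s := facesOfCard hK 2) (fun e => u ∈ e),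
      card_filter_mem_edges]
    congr 1
    rw [← Finset.card_filter_add_card_filter_not
      (s := (facesOfCard hK 2).filter fun e => ¬ u ∈ e) (fun e => v ∈ e),
      Finset.filter_filter, Finset.filter_filter]
    congr 1
    rw [← card_filter_mem_edges, ← Finset.card_erase_of_mem (a := {u, v})]
    · congr 1
      ext e
      simp only [Finset.mem_filter, Finset.mem_erase, mem_facesOfCard]
      constructor
      · rintro ⟨⟨h1, h2⟩, h3, h4⟩
        refine ⟨?_, ⟨h1, h2⟩, h4⟩
        rintro rfl
        exact h3 (by simp)
      · rintro ⟨h1, ⟨h2, h3⟩, h4⟩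
        refine ⟨⟨h2, h3⟩, fun hu => h1 ?_, h4⟩
        symm
        refine Finset.eq_of_subset_of_card_le ?_ (by rw [h3, Finset.card_pair h.ne])
        exact Finset.insert_subset hu (Finset.singleton_subset_iff.mpr h4)
    · exact Finset.mem_filter.mpr
        ⟨mem_facesOfCard.mpr ⟨h.edge, Finset.card_pair h.ne⟩, by simp⟩
  have e2 : (facesOfCard h.finite 2).card = (exts h.finite {w}).card +
      ((facesOfCard hK 2).filter fun e => ¬ u ∈ e ∧ ¬ v ∈ e).card := by
    rw [← Finset.card_filter_add_card_filter_not (s := facesOfCard h.finite 2) (fun e => w ∈ e),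
      card_filter_mem_edges]
    congr 2
    ext e
    simp only [Finset.mem_filter, mem_facesOfCard]
    constructor
    · rintro ⟨⟨h1, h2⟩, h3⟩
      have hu := h.notMem _ h1
      have hv := h.notMem' _ h1
      exact ⟨⟨(h.mem _ hu hv h3).1 h1, h2⟩, hu, hv⟩
    · rintro ⟨⟨h1, h2⟩, h3, h4⟩
      have hw := h.fresh _ h1
      exact ⟨⟨(h.mem _ h3 h4 hw).2 h1, h2⟩, hw⟩
  have hvu : v ∈ exts hK {u} := mem_exts.mpr ⟨by simpa using h.ne.symm, by
    rw [Finset.pair_comm]; exact h.edge⟩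
  have huv : u ∈ exts hK {v} := mem_exts.mpr ⟨by simpa using h.ne, h.edge⟩
  have e3 : exts h.finite {w} = (exts hK {u}).erase v ∪ (exts hK {v}).erase u := by
    ext r
    simp only [Finset.mem_union, Finset.mem_erase, mem_exts]
    exact h.ext_insert_iff (γ := ∅) (by simp) (by simp) (by simp) r
  have e4 : exts hK {u, v} = (exts hK {u}).erase v ∩ (exts hK {v}).erase u := by
    ext r
    simp only [Finset.mem_inter, Finset.mem_erase, mem_exts, Ext, Finset.mem_insert,
      Finset.mem_singleton, not_or]
    constructor
    · rintro ⟨⟨h1, h2⟩, h3⟩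
      exact ⟨⟨h2, h1, face_mono h3 (Finset.insert_subset_insert _ (by simp)) (by simp)⟩,
        h1, h2, face_mono h3 (Finset.insert_subset_insert _ (by simp)) (by simp)⟩
    · rintro ⟨⟨h2, h1, h3⟩, -, -, h4⟩
      refine ⟨⟨h1, h2⟩, ?_⟩
      have := h.link {r} (by simpa using Ne.symm h1) (by simpa using Ne.symm h2)
        (by rw [Finset.pair_comm]; exact h3) (by rw [Finset.pair_comm]; exact h4)
      exact face_congr this (by
        ext z; simp only [Finset.mem_insert, Finset.mem_singleton]; tauto)
  have e5 := Finset.card_union_add_card_inter ((exts hK {u}).erase v) ((exts hK {v}).erase u)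
  rw [← e3, ← e4, Finset.card_erase_of_mem hvu, Finset.card_erase_of_mem huv] at e5
  have p1 := Finset.card_pos.mpr ⟨_, hvu⟩
  have p2 := Finset.card_pos.mpr ⟨_, huv⟩
  omega

/-- A contraction removes one vertex, the edge `uv`, and one edge for each vertex of its link. -/
theorem g2_lt (h : IsContraction K K' u v w) (hK : IsPM 3 K)
    (hd : 4 ≤ (exts hK.finite {u, v}).card) : g2 K' < g2 K := by
  have h0 := h.card_vertices hK.finite
  have h1 := h.card_edges hK.finite
  have e0 : fNum K' 0 = (facesOfCard h.finite 1).card := fNum_eq _ _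
  have e1 : fNum K' 1 = (facesOfCard h.finite 2).card := fNum_eq _ _
  have e2 : fNum K 0 = (facesOfCard hK.finite 1).card := fNum_eq _ _
  have e3 : fNum K 1 = (facesOfCard hK.finite 2).card := fNum_eq _ _
  rw [g2, g2]
  omega

end IsContraction

/-- An edge of degree at least four that has a non-singular end and satisfies the link condition
makes `K` reducible. -/
theorem isReducible_of_link_inf_link [Infinite V] {K : PreAbstractSimplicialComplex V}
    (hK : IsPM 3 K) {u v : V} (huv : u ≠ v) (he : {u, v} ∈ K.faces) (hv : IsNonsingular K v)
    (hl : link K {u} ⊓ link K {v} = link K {u, v}) (hd : 4 ≤ (exts hK.finite {u, v}).card) :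
    IsReducible K := by
  obtain ⟨w, hw⟩ := Infinite.exists_notMem_finset (hK.finite.toFinset.biUnion id)
  have fresh : ∀ σ ∈ K.faces, w ∉ σ := by
    intro σ hσ hh
    exact hw (Finset.mem_biUnion.mpr ⟨σ, hK.finite.mem_toFinset.mpr hσ, hh⟩)
  have hwK : {w} ∉ K.faces := fun hh => fresh _ hh (by simp)
  set f : V → V := fun x => if x = u ∨ x = v then w else x with hf
  have hins : ∀ γ : Finset V, γ ∪ {u, v} = insert u (insert v γ) := by
    intro γ; ext x; simp only [Finset.mem_union, Finset.mem_insert, Finset.mem_singleton]; tauto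
  have hwu : w ≠ u := fun e => fresh _ he (by simp [e])
  have hwv : w ≠ v := fun e => fresh _ he (by simp [e])
  have fu : f u = w := by simp [hf]
  have fv : f v = w := by simp [hf]
  have fid : ∀ γ : Finset V, u ∉ γ → v ∉ γ → γ.image f = γ := by
    intro γ h1 h2
    have : ∀ x ∈ γ, f x = x := by
      intro x hx
      simp only [hf]
      rw [if_neg]
      rintro (rfl | rfl)
      · exact h1 hx
      · exact h2 hx
    rw [Finset.image_congr (g := id) this, Finset.image_id]
  have hmem : ∀ σ, σ ∈ (K.map f).faces ↔ ∃ τ ∈ K.faces, τ.image f = σ := fun σ => Iff.rfl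
  have fne : ∀ x, f x ≠ u ∧ f x ≠ v := by
    intro x
    simp only [hf]
    split_ifs with h
    · exact ⟨hwu, hwv⟩
    · rwa [not_or] at h
  have fw : ∀ x, f x = w → x ≠ w → x = u ∨ x = v := by
    intro x hx hxw
    by_contra hn
    exact hxw (by simpa only [hf, hn, if_false] using hx)
  have hc : IsContraction K (K.map f) u v w := by
    refine ⟨huv, he, fresh, ?_, finite_map hK.finite f, ?_, ?_, ?_, ?_⟩
    · intro γ h1 h2 h3 h4
      rcases Finset.eq_empty_or_nonempty γ with rfl | hn
      · exact he
      · have hγ : γ ∈ (link K {u} ⊓ link K {v}).faces :=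
          ⟨⟨hn, by simpa using h1, by rwa [Finset.union_comm, ← Finset.insert_eq]⟩,
            ⟨hn, by simpa using h2, by rwa [Finset.union_comm, ← Finset.insert_eq]⟩⟩
        rw [hl] at hγ
        rw [← hins]
        exact hγ.2.2
    · rintro σ ⟨τ, -, rfl⟩ hh
      obtain ⟨x, -, hx⟩ := Finset.mem_image.mp hh
      exact (fne x).1 hx
    · rintro σ ⟨τ, -, rfl⟩ hh
      obtain ⟨x, -, hx⟩ := Finset.mem_image.mp hh
      exact (fne x).2 hx
    · intro σ h1 h2 h3
      rw [hmem]
      constructor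
      · rintro ⟨τ, hτ, rfl⟩
        have h4 : u ∉ τ := fun hh => h3 (Finset.mem_image.mpr ⟨u, hh, fu⟩)
        have h5 : v ∉ τ := fun hh => h3 (Finset.mem_image.mpr ⟨v, hh, fv⟩)
        rwa [fid τ h4 h5]
      · exact fun hσ => ⟨σ, hσ, fid σ h1 h2⟩
    · intro σ h1 h2 h3
      rw [hmem]
      constructor
      · rintro ⟨τ, hτ, hτσ⟩
        have hsub : ∀ x ∈ τ, x ≠ u → x ≠ v → x ∈ σ := by
          intro x hx hxu hxv
          have hfx : f x = x := by simp only [hf, hxu, hxv, or_self, if_false]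
          have : x ∈ insert w σ := by
            rw [← hτσ]; exact Finset.mem_image.mpr ⟨x, hx, hfx⟩
          exact (Finset.mem_insert.mp this).resolve_left fun e => fresh _ hτ (e ▸ hx)
        have hsup : σ ⊆ τ := by
          intro x hx
          have : x ∈ τ.image f := by rw [hτσ]; exact Finset.mem_insert_of_mem hx
          obtain ⟨y, hy, hyx⟩ := Finset.mem_image.mp this
          have hyu : ¬ (y = u ∨ y = v) := fun hh => by
            have : f y = w := by simp only [hf, hh, if_true]
            exact h3 (by rw [← this, hyx]; exact hx)
          have : f y = y := by simp only [hf, hyu, if_false]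
          rwa [← hyx, this]
        have : w ∈ τ.image f := by rw [hτσ]; simp
        obtain ⟨y, hy, hyw⟩ := Finset.mem_image.mp this
        rcases fw y hyw (fun e => fresh _ hτ (e ▸ hy)) with rfl | rfl
        · exact Or.inl (face_mono hτ (Finset.insert_subset hy hsup) (by simp))
        · exact Or.inr (face_mono hτ (Finset.insert_subset hy hsup) (by simp))
      · rintro (h4 | h4)
        · exact ⟨_, h4, by rw [Finset.image_insert, fid σ h1 h2, fu]⟩
        · exact ⟨_, h4, by rw [Finset.image_insert, fid σ h1 h2, fv]⟩
  exact ⟨K.map f, (hc.isPM hK).isNormalPseudomanifold,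
    Or.inr (Or.inl ⟨u, v, w, huv, he, hv, hl, hwK, rfl⟩), hc.g2_lt hK hd⟩

/-! ### Splitting a vertex along a triangular circuit of its link -/

/-- `K'` is obtained from `K` by splitting the vertex `w` into `x₁` and `x₂` along the circuit `∂T`,
which cuts the link of `w` into `D₁` and `D₂`: the star of `w` is replaced by the cones over
`D₁ ∪ T` and `D₂ ∪ T` with apices `x₁` and `x₂`. -/
structure IsSplit (K K' : PreAbstractSimplicialComplex V) (w x₁ x₂ : V) (T : Finset V)
    (D₁ D₂ : PreAbstractSimplicialComplex V) : Prop where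
  ne : x₁ ≠ x₂
  fresh : ∀ σ ∈ K.faces, x₁ ∉ σ
  fresh' : ∀ σ ∈ K.faces, x₂ ∉ σ
  card : T.card = 3
  notMem : T ∉ K.faces
  link : ∀ σ : Finset V, σ.Nonempty →
    ((w ∉ σ ∧ insert w σ ∈ K.faces) ↔ σ ∈ D₁.faces ∨ σ ∈ D₂.faces)
  inter : ∀ σ, σ ∈ D₁.faces → σ ∈ D₂.faces → σ ⊂ T
  left : ∀ σ : Finset V, σ.Nonempty → σ ⊂ T → σ ∈ D₁.faces
  right : ∀ σ : Finset V, σ.Nonempty → σ ⊂ T → σ ∈ D₂.faces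
  pure_left : ∀ σ ∈ D₁.faces, ∃ τ ∈ D₁.faces, σ ⊆ τ ∧ τ.card = 3
  pure_right : ∀ σ ∈ D₂.faces, ∃ τ ∈ D₂.faces, σ ⊆ τ ∧ τ.card = 3
  ext_left : ∀ e ⊆ T, e.card = 2 → ∃ q, ∀ r, Ext D₁ e r ↔ r = q
  ext_right : ∀ e ⊆ T, e.card = 2 → ∃ q, ∀ r, Ext D₂ e r ↔ r = q
  base : ∀ σ ∈ K'.faces, w ∉ σ
  disj : ∀ σ ∈ K'.faces, x₁ ∈ σ → x₂ ∉ σ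
  mem : ∀ σ, w ∉ σ → x₁ ∉ σ → x₂ ∉ σ → (σ ∈ K'.faces ↔ σ ∈ K.faces ∨ σ = T)
  mem_left : ∀ σ, w ∉ σ → x₁ ∉ σ → x₂ ∉ σ →
    (insert x₁ σ ∈ K'.faces ↔ σ = ∅ ∨ σ ∈ D₁.faces ∨ σ ⊆ T)
  mem_right : ∀ σ, w ∉ σ → x₁ ∉ σ → x₂ ∉ σ →
    (insert x₂ σ ∈ K'.faces ↔ σ = ∅ ∨ σ ∈ D₂.faces ∨ σ ⊆ T)

namespace IsSplit

variable {K K' D₁ D₂ : PreAbstractSimplicialComplex V} {w x₁ x₂ : V} {T : Finset V}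

theorem symm (h : IsSplit K K' w x₁ x₂ T D₁ D₂) : IsSplit K K' w x₂ x₁ T D₂ D₁ where
  ne := h.ne.symm
  fresh := h.fresh'
  fresh' := h.fresh
  card := h.card
  notMem := h.notMem
  link σ hσ := by rw [h.link σ hσ, or_comm]
  inter σ h1 h2 := h.inter σ h2 h1
  left := h.right
  right := h.left
  pure_left := h.pure_right
  pure_right := h.pure_left
  ext_left := h.ext_right
  ext_right := h.ext_left
  base := h.base
  disj σ hσ h2 h1 := h.disj σ hσ h1 h2
  mem σ hw h1 h2 := h.mem σ hw h2 h1
  mem_left σ hw h1 h2 := h.mem_right σ hw h2 h1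
  mem_right σ hw h1 h2 := h.mem_left σ hw h2 h1

theorem insert_of_left (h : IsSplit K K' w x₁ x₂ T D₁ D₂) {σ : Finset V} (hσ : σ ∈ D₁.faces) :
    w ∉ σ ∧ insert w σ ∈ K.faces :=
  (h.link σ (face_nonempty hσ)).2 (Or.inl hσ)

theorem face_of_left (h : IsSplit K K' w x₁ x₂ T D₁ D₂) {σ : Finset V} (hσ : σ ∈ D₁.faces) :
    σ ∈ K.faces :=
  face_mono (h.insert_of_left hσ).2 (Finset.subset_insert _ _) (face_nonempty hσ)

theorem singleton_ssubset (h : IsSplit K K' w x₁ x₂ T D₁ D₂) {c : V} (hc : c ∈ T) :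
    {c} ⊂ T := by
  refine (Finset.singleton_subset_iff.mpr hc).ssubset_of_ne fun e => ?_
  have := h.card
  rw [← e, Finset.card_singleton] at this
  omega

theorem singleton_mem (h : IsSplit K K' w x₁ x₂ T D₁ D₂) : {w} ∈ K.faces := by
  have hT : T.Nonempty := Finset.card_pos.mp (by have := h.card; omega)
  obtain ⟨c, hc⟩ := hT
  exact face_mono (h.insert_of_left (h.left {c} (by simp) (h.singleton_ssubset hc))).2
    (by simp) (by simp)

theorem ne_of_mem (h : IsSplit K K' w x₁ x₂ T D₁ D₂) {c : V} (hc : c ∈ T) :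
    c ≠ w ∧ c ≠ x₁ ∧ c ≠ x₂ := by
  have hc' := h.left {c} (by simp) (h.singleton_ssubset hc)
  have h1 := (h.insert_of_left hc').1
  have h2 := h.fresh _ (h.face_of_left hc')
  have h3 := h.fresh' _ (h.face_of_left hc')
  rw [Finset.mem_singleton] at h1 h2 h3
  exact ⟨Ne.symm h1, Ne.symm h2, Ne.symm h3⟩

theorem notMem_of_subset (h : IsSplit K K' w x₁ x₂ T D₁ D₂) {σ : Finset V} (hσ : σ ⊆ T) :
    w ∉ σ ∧ x₁ ∉ σ ∧ x₂ ∉ σ :=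
  ⟨fun hh => (h.ne_of_mem (hσ hh)).1 rfl, fun hh => (h.ne_of_mem (hσ hh)).2.1 rfl,
    fun hh => (h.ne_of_mem (hσ hh)).2.2 rfl⟩

theorem insert_of_subset (h : IsSplit K K' w x₁ x₂ T D₁ D₂) {σ : Finset V} (hσ : σ ⊆ T) :
    insert x₁ σ ∈ K'.faces := by
  obtain ⟨h1, h2, h3⟩ := h.notMem_of_subset hσ
  exact (h.mem_left σ h1 h2 h3).2 (Or.inr (Or.inr hσ))

theorem insert_of_mem (h : IsSplit K K' w x₁ x₂ T D₁ D₂) {σ : Finset V} (hσ : σ ∈ D₁.faces) :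
    insert x₁ σ ∈ K'.faces :=
  (h.mem_left σ (h.insert_of_left hσ).1 (h.fresh _ (h.face_of_left hσ))
    (h.fresh' _ (h.face_of_left hσ))).2 (Or.inr (Or.inl hσ))

theorem left_of_ssubset (h : IsSplit K K' w x₁ x₂ T D₁ D₂) {σ : Finset V} (hσ : σ ⊂ T) :
    σ = ∅ ∨ σ ∈ D₁.faces := by
  rcases Finset.eq_empty_or_nonempty σ with he | hn
  · exact Or.inl he
  · exact Or.inr (h.left σ hn hσ)

theorem ssubset_of_subset (h : IsSplit K K' w x₁ x₂ T D₁ D₂) {σ : Finset V} (hσ : σ ⊆ T)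
    (hc : σ.card ≤ 2) : σ ⊂ T := by
  refine hσ.ssubset_of_ne fun e => ?_
  have := h.card
  rw [← e] at this
  omega

/-- The faces of the new complex that contain `x₁` form the cone over `D₁ ∪ T`. -/
theorem left_of_insert (h : IsSplit K K' w x₁ x₂ T D₁ D₂) {σ : Finset V} (h1 : x₁ ∉ σ)
    (hσ : insert x₁ σ ∈ K'.faces) :
    w ∉ σ ∧ x₂ ∉ σ ∧ (σ = ∅ ∨ σ ∈ D₁.faces ∨ σ = T) := by
  have h2 := h.base _ hσ
  have h3 := h.disj _ hσ (Finset.mem_insert_self _ _)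
  simp only [Finset.mem_insert, not_or] at h2 h3
  refine ⟨h2.2, h3.2, ?_⟩
  rcases (h.mem_left σ h2.2 h1 h3.2).1 hσ with h4 | h4 | h4
  · exact Or.inl h4
  · exact Or.inr (Or.inl h4)
  · rcases eq_or_ne σ T with e | e
    · exact Or.inr (Or.inr e)
    · exact (h.left_of_ssubset (h4.ssubset_of_ne e)).imp_right Or.inl

theorem cases_mem (h : IsSplit K K' w x₁ x₂ T D₁ D₂) {σ : Finset V} (hσ : σ ∈ K'.faces) :
    (w ∉ σ ∧ x₁ ∉ σ ∧ x₂ ∉ σ ∧ (σ ∈ K.faces ∨ σ = T)) ∨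
    (∃ γ, σ = insert x₁ γ ∧ x₁ ∉ γ ∧ (γ = ∅ ∨ γ ∈ D₁.faces ∨ γ = T)) ∨
    (∃ γ, σ = insert x₂ γ ∧ x₂ ∉ γ ∧ (γ = ∅ ∨ γ ∈ D₂.faces ∨ γ = T)) := by
  by_cases h1 : x₁ ∈ σ
  · have e := Finset.insert_erase h1
    refine Or.inr (Or.inl ⟨σ.erase x₁, e.symm, by simp, ?_⟩)
    exact (h.left_of_insert (by simp) (by rwa [e])).2.2
  by_cases h2 : x₂ ∈ σ
  · have e := Finset.insert_erase h2
    refine Or.inr (Or.inr ⟨σ.erase x₂, e.symm, by simp, ?_⟩)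
    exact (h.symm.left_of_insert (by simp) (by rwa [e])).2.2
  exact Or.inl ⟨h.base _ hσ, h1, h2, (h.mem _ (h.base _ hσ) h1 h2).1 hσ⟩

theorem finite (h : IsSplit K K' w x₁ x₂ T D₁ D₂) (hK : K.faces.Finite) : K'.faces.Finite := by
  have hf : (K.faces ∪ {∅, T}).Finite := hK.union (Set.toFinite _)
  refine (hf.union ((hf.image (insert x₁)).union (hf.image (insert x₂)))).subset ?_
  intro σ hσ
  rcases h.cases_mem hσ with ⟨-, -, -, h1 | h1⟩ | ⟨γ, rfl, -, h1⟩ | ⟨γ, rfl, -, h1⟩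
  · exact Or.inl (Or.inl h1)
  · exact Or.inl (Or.inr (Or.inr h1))
  · refine Or.inr (Or.inl ⟨γ, ?_, rfl⟩)
    rcases h1 with h1 | h1 | h1
    · exact Or.inr (Or.inl h1)
    · exact Or.inl (h.face_of_left h1)
    · exact Or.inr (Or.inr h1)
  · refine Or.inr (Or.inr ⟨γ, ?_, rfl⟩)
    rcases h1 with h1 | h1 | h1
    · exact Or.inr (Or.inl h1)
    · exact Or.inl (h.symm.face_of_left h1)
    · exact Or.inr (Or.inr h1)

theorem card_insert (h : IsSplit K K' w x₁ x₂ T D₁ D₂) : (insert x₁ T).card = 4 := by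
  rw [Finset.card_insert_of_notMem (h.notMem_of_subset subset_rfl).2.1, h.card]

theorem pure_insert (h : IsSplit K K' w x₁ x₂ T D₁ D₂) {γ : Finset V}
    (hγ : γ = ∅ ∨ γ ∈ D₁.faces ∨ γ = T) :
    ∃ τ ∈ K'.faces, insert x₁ γ ⊆ τ ∧ τ.card = 4 := by
  by_cases hT : γ ⊆ T
  · exact ⟨insert x₁ T, h.insert_of_subset subset_rfl, Finset.insert_subset_insert _ hT,
      h.card_insert⟩
  · rcases hγ with rfl | hγ | rfl
    · exact absurd (Finset.empty_subset _) hT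
    · obtain ⟨τ, hτ, hs, hc⟩ := h.pure_left γ hγ
      exact ⟨insert x₁ τ, h.insert_of_mem hτ, Finset.insert_subset_insert _ hs, by
        rw [Finset.card_insert_of_notMem (h.fresh _ (h.face_of_left hτ)), hc]⟩
    · exact absurd subset_rfl hT

theorem pure (h : IsSplit K K' w x₁ x₂ T D₁ D₂) (hK : IsPM 3 K) :
    ∀ σ ∈ K'.faces, ∃ τ ∈ K'.faces, σ ⊆ τ ∧ τ.card = 4 := by
  intro σ hσ
  rcases h.cases_mem hσ with ⟨hw, h1, h2, hσK | rfl⟩ | ⟨γ, rfl, -, hγ⟩ | ⟨γ, rfl, -, hγ⟩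
  · obtain ⟨τ, hτ, hs, hc⟩ := hK.pure σ hσK
    by_cases hwτ : w ∈ τ
    · have hsub : σ ⊆ τ.erase w := fun x hx => Finset.mem_erase.mpr ⟨fun e => hw (e ▸ hx), hs hx⟩
      have hl := (h.link (τ.erase w) ((face_nonempty hσ).mono hsub)).1
        ⟨by simp, by rwa [Finset.insert_erase hwτ]⟩
      rcases hl with hl | hl
      · obtain ⟨τ', h3, h4, h5⟩ := h.pure_insert (Or.inr (Or.inl hl))
        exact ⟨τ', h3, hsub.trans ((Finset.subset_insert _ _).trans h4), h5⟩
      · obtain ⟨τ', h3, h4, h5⟩ := h.symm.pure_insert (Or.inr (Or.inl hl))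
        exact ⟨τ', h3, hsub.trans ((Finset.subset_insert _ _).trans h4), h5⟩
    · exact ⟨τ, (h.mem τ hwτ (h.fresh _ hτ) (h.fresh' _ hτ)).2 (Or.inl hτ), hs, hc⟩
  · obtain ⟨τ', h3, h4, h5⟩ := h.pure_insert (Or.inr (Or.inr rfl))
    exact ⟨τ', h3, (Finset.subset_insert _ _).trans h4, h5⟩
  · exact h.pure_insert hγ
  · exact h.symm.pure_insert hγ

theorem two_of_left (h : IsSplit K K' w x₁ x₂ T D₁ D₂) {σ : Finset V} (hσ : σ ∈ D₁.faces)
    (hc : σ.card = 3) (h2 : TwoExt K σ) : TwoExt K' σ := by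
  obtain ⟨hw, hwσ⟩ := h.insert_of_left hσ
  have hσK := h.face_of_left hσ
  have hσ1 := h.fresh _ hσK
  have hσ2 := h.fresh' _ hσK
  have hσT : ¬ σ ⊆ T := fun hs => h.notMem
    (Finset.eq_of_subset_of_card_le hs (by rw [hc, h.card]) ▸ hσK)
  obtain ⟨p, hp, hr⟩ := h2.exists_ne ⟨hw, hwσ⟩
  have hpe := (hr p).2 (Or.inr rfl)
  refine ⟨x₁, p, ?_, fun r => ⟨?_, ?_⟩⟩
  · rintro rfl
    exact h.fresh _ hpe.2 (Finset.mem_insert_self _ _)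
  · rintro ⟨h3, h4⟩
    by_cases hr1 : r = x₁
    · exact Or.inl hr1
    have hr2 : r ≠ x₂ := by
      rintro rfl
      rcases (h.symm.left_of_insert hσ2 h4).2.2 with h5 | h5 | h5
      · rw [h5] at hc; simp at hc
      · exact hσT (h.inter σ hσ h5).1
      · exact hσT h5.le
    have hwr := h.base _ h4
    have h5 := (h.mem _ hwr (by simp [Ne.symm hr1, hσ1]) (by simp [hr2.symm, hσ2])).1 h4
    rcases h5 with h5 | h5
    · rcases (hr r).1 ⟨h3, h5⟩ with e | e
      · exact absurd (e ▸ Finset.mem_insert_self r σ) hwr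
      · exact Or.inr e
    · exact absurd (h5 ▸ Finset.subset_insert r σ) hσT
  · rintro (rfl | rfl)
    · exact ⟨hσ1, h.insert_of_mem hσ⟩
    · refine ⟨hpe.1, (h.mem _ ?_ (h.fresh _ hpe.2) (h.fresh' _ hpe.2)).2 (Or.inl hpe.2)⟩
      simp [hp.symm, hw]

theorem ext_insert_iff (h : IsSplit K K' w x₁ x₂ T D₁ D₂) {γ : Finset V} (hx : x₁ ∉ γ) (r : V) :
    Ext K' (insert x₁ γ) r ↔ r ∉ γ ∧ (insert r γ ∈ D₁.faces ∨ insert r γ = T) := by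
  constructor
  · rintro ⟨h1, h2⟩
    rw [Finset.mem_insert, not_or] at h1
    rw [Finset.insert_comm] at h2
    refine ⟨h1.2, ?_⟩
    exact (h.left_of_insert (by simp [Ne.symm h1.1, hx]) h2).2.2.resolve_left
      (Finset.insert_ne_empty _ _)
  · rintro ⟨h1, h2⟩
    have h3 : insert x₁ (insert r γ) ∈ K'.faces := by
      rcases h2 with h2 | h2
      · exact h.insert_of_mem h2
      · exact h.insert_of_subset h2.le
    refine ⟨?_, by rwa [Finset.insert_comm]⟩
    rw [Finset.mem_insert, not_or]
    refine ⟨?_, h1⟩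
    rintro rfl
    rcases h2 with h2 | h2
    · exact h.fresh _ (h.face_of_left h2) (Finset.mem_insert_self _ _)
    · exact (h.notMem_of_subset h2.le).2.1 (Finset.mem_insert_self _ _)

theorem two_insert (h : IsSplit K K' w x₁ x₂ T D₁ D₂) (hK : IsPM 3 K) {γ : Finset V}
    (hγ : γ ∈ D₁.faces) (hc : γ.card = 2) : TwoExt K' (insert x₁ γ) := by
  have hx := h.fresh _ (h.face_of_left hγ)
  by_cases hT : γ ⊆ T
  · obtain ⟨c, hcT, hcγ⟩ := Finset.exists_of_ssubset (h.ssubset_of_subset hT hc.le)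
    have hcT' : insert c γ = T := Finset.eq_of_subset_of_card_le (Finset.insert_subset hcT hT) (by
      rw [Finset.card_insert_of_notMem hcγ, hc, h.card])
    obtain ⟨q, hq⟩ := h.ext_left γ hT hc
    have hqe := (hq q).2 rfl
    refine ⟨c, q, ?_, fun r => ?_⟩
    · rintro rfl
      exact h.notMem (hcT' ▸ h.face_of_left hqe.2)
    · rw [h.ext_insert_iff hx, and_or_left]
      have h1 : (r ∉ γ ∧ insert r γ = T) ↔ r = c := by
        constructor
        · rintro ⟨h1, h2⟩
          have : r ∈ insert c γ := by rw [hcT', ← h2]; simp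
          exact (Finset.mem_insert.mp this).resolve_right h1
        · rintro rfl
          exact ⟨hcγ, hcT'⟩
      rw [h1, or_comm]
      exact or_congr_right (hq r)
  · obtain ⟨hw, hwγ⟩ := h.insert_of_left hγ
    obtain ⟨p, q, hpq, hr⟩ := hK.two _ hwγ (by rw [Finset.card_insert_of_notMem hw, hc])
    refine ⟨p, q, hpq, fun r => ?_⟩
    rw [h.ext_insert_iff hx, ← hr, Ext, Finset.insert_comm]
    have hl := h.link (insert r γ) (Finset.insert_nonempty _ _)
    have h2 : insert r γ ∉ D₂.faces := fun hh =>
      hT (h.inter γ hγ (face_mono hh (Finset.subset_insert _ _) (face_nonempty hγ))).1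
    have h3 : insert r γ ≠ T := fun e => hT (e ▸ Finset.subset_insert r γ)
    simp only [h2, h3, or_false] at hl ⊢
    rw [← hl]
    simp only [Finset.mem_insert]
    constructor
    · rintro ⟨h4, h5, h6⟩
      exact ⟨fun hh => hh.elim (fun e => h5 (Or.inl e.symm)) h4, h6⟩
    · rintro ⟨h4, h5⟩
      exact ⟨fun hh => h4 (Or.inr hh), fun hh => hh.elim (fun e => h4 (Or.inl e.symm)) hw, h5⟩

theorem two (h : IsSplit K K' w x₁ x₂ T D₁ D₂) (hK : IsPM 3 K) :
    ∀ σ ∈ K'.faces, σ.card = 3 → TwoExt K' σ := by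
  have aux : ∀ {x₁ x₂ : V} {D₁ D₂ : PreAbstractSimplicialComplex V},
      IsSplit K K' w x₁ x₂ T D₁ D₂ → ∀ γ, x₁ ∉ γ → (γ = ∅ ∨ γ ∈ D₁.faces ∨ γ = T) →
      (insert x₁ γ).card = 3 → TwoExt K' (insert x₁ γ) := by
    intro x₁ x₂ D₁ D₂ h γ hx hγ hc
    rw [Finset.card_insert_of_notMem hx] at hc
    rcases hγ with rfl | hγ | rfl
    · simp at hc
    · exact h.two_insert hK hγ (by omega)
    · have := h.card; omega
  intro σ hσ hc
  rcases h.cases_mem hσ with ⟨hw, h1, h2, hσK | rfl⟩ | ⟨γ, rfl, hx, hγ⟩ | ⟨γ, rfl, hx, hγ⟩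
  · have h2' := hK.two σ hσK hc
    by_cases hwσ : insert w σ ∈ K.faces
    · rcases (h.link σ (face_nonempty hσ)).1 ⟨hw, hwσ⟩ with hl | hl
      · exact h.two_of_left hl hc h2'
      · exact h.symm.two_of_left hl hc h2'
    · have hσT : σ ≠ T := fun e => h.notMem (e ▸ hσK)
      obtain ⟨p, q, hpq, hr⟩ := h2'
      refine ⟨p, q, hpq, fun r => ?_⟩
      rw [← hr]
      have aux : ∀ {x₁ x₂ : V} {D₁ D₂ : PreAbstractSimplicialComplex V},
          IsSplit K K' w x₁ x₂ T D₁ D₂ → x₁ ∉ σ → insert x₁ σ ∉ K'.faces := by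
        intro x₁ x₂ D₁ D₂ h h1 hh
        rcases (h.left_of_insert h1 hh).2.2 with h5 | h5 | h5
        · rw [h5] at hc; simp at hc
        · exact hwσ (h.insert_of_left h5).2
        · exact hσT h5
      have e : ∀ r, insert r σ ≠ T ∨ r ∈ σ := by
        intro r
        by_contra! hh
        have := Finset.card_insert_of_notMem hh.2
        rw [hh.1, h.card] at this
        omega
      constructor
      · rintro ⟨h3, h4⟩
        refine ⟨h3, ((h.mem _ (h.base _ h4) ?_ ?_).1 h4).resolve_right
          ((e r).resolve_right h3)⟩ <;> rw [Finset.mem_insert, not_or]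
        · exact ⟨fun e => aux h h1 (e ▸ h4), h1⟩
        · exact ⟨fun e => aux h.symm h2 (e ▸ h4), h2⟩
      · rintro ⟨h3, h4⟩
        refine ⟨h3, (h.mem _ ?_ (h.fresh _ h4) (h.fresh' _ h4)).2 (Or.inl h4)⟩
        rw [Finset.mem_insert, not_or]
        exact ⟨fun e => hwσ (e ▸ h4), hw⟩
  · refine ⟨x₁, x₂, h.ne, fun r => ⟨?_, ?_⟩⟩
    · rintro ⟨h3, h4⟩
      by_contra hh
      rw [not_or] at hh
      rcases (h.mem _ (h.base _ h4) (by simp [Ne.symm hh.1, h1]) (by simp [Ne.symm hh.2, h2])).1 h4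
        with h5 | h5
      · exact h.notMem (face_mono h5 (Finset.subset_insert _ _) (face_nonempty hσ))
      · exact h3 (h5 ▸ Finset.mem_insert_self r σ)
    · rintro (rfl | rfl)
      · exact ⟨h1, h.insert_of_subset subset_rfl⟩
      · exact ⟨h2, h.symm.insert_of_subset subset_rfl⟩
  · exact aux h γ hx hγ hc
  · exact aux h.symm γ hx hγ hc

/-- In the link of a face `σ` of `D₁` (or of `∅`) the vertex `w` is replaced by `x₁`. If `w` has
neighbours in the link that belong to `D₂` only, then `σ` is a face of `∂T`, and `x₁` is joined to
`x₂` through a vertex of `T`. -/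
theorem linkConn_of_left (h : IsSplit K K' w x₁ x₂ T D₁ D₂) {σ : Finset V} (hc : LinkConn K σ)
    (hw : w ∉ σ) (h1 : x₁ ∉ σ) (h2 : x₂ ∉ σ) (hw' : insert w σ ∈ K.faces)
    (hσ : σ = ∅ ∨ σ ∈ D₁.faces) (hσT : σ ≠ T) : LinkConn K' σ := by
  have path : σ ⊂ T → LinkPath K' σ x₁ x₂ := by
    intro hs
    obtain ⟨c, hcT, hcσ⟩ := Finset.exists_of_ssubset hs
    have hs' := Finset.insert_subset hcT hs.1
    exact (Relation.ReflTransGen.single ⟨h1, hcσ, h.insert_of_subset hs'⟩).tail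
      ⟨hcσ, h2, by rw [Finset.insert_comm]; exact h.symm.insert_of_subset hs'⟩
  have hss : ∀ {τ}, σ ⊆ τ → τ ∈ D₂.faces → σ ⊂ T := by
    intro τ hτ hD
    rcases hσ with rfl | hσ
    · exact Finset.empty_ssubset.mpr (Finset.card_pos.mp (by have := h.card; omega))
    · exact h.inter σ hσ (face_mono hD hτ (face_nonempty hσ))
  have new : ∀ z, z ≠ w → LinkAdj K σ w z → LinkPath K' σ x₁ z := by
    rintro z hz ⟨-, h3, h4⟩
    rcases (h.link (insert z σ) (Finset.insert_nonempty _ _)).1 ⟨by simp [hz.symm, hw], h4⟩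
      with h5 | h5
    · exact .single ⟨h1, h3, h.insert_of_mem h5⟩
    · exact (path (hss (Finset.subset_insert _ _) h5)).tail ⟨h2, h3, h.symm.insert_of_mem h5⟩
  refine hc.map (fun z => if z = w then x₁ else z) ?_ ?_
  · intro a b hab
    by_cases ha : a = w <;> by_cases hb : b = w
    · simp only [ha, hb, if_true]; exact .refl
    · simp only [ha, hb, if_true, if_false]; exact new b hb (ha ▸ hab)
    · simp only [ha, hb, if_true, if_false]; exact (new a ha (hb ▸ hab.symm)).symm
    · simp only [ha, hb, if_false]
      refine .single ⟨hab.1, hab.2.1, (h.mem _ ?_ (h.fresh _ hab.2.2) (h.fresh' _ hab.2.2)).2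
        (Or.inl hab.2.2)⟩
      simp [Ne.symm ha, Ne.symm hb, hw]
  · rintro y ⟨h3, h4⟩
    have viaw : LinkPath K' σ x₁ y → ∃ a, Ext K σ a ∧ LinkPath K' σ (if a = w then x₁ else a) y :=
      fun hp => ⟨w, ⟨hw, hw'⟩, by simpa only [if_true] using hp⟩
    by_cases hy1 : y = x₁
    · subst hy1; exact viaw .refl
    by_cases hy2 : y = x₂
    · subst hy2
      refine viaw (path ?_)
      rcases (h.symm.left_of_insert h2 h4).2.2 with h5 | h5 | h5
      · subst h5; exact Finset.empty_ssubset.mpr (Finset.card_pos.mp (by have := h.card; omega))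
      · exact hss subset_rfl h5
      · exact absurd h5 hσT
    have hyw := h.base _ h4
    rcases (h.mem _ hyw (by simp [Ne.symm hy1, h1]) (by simp [Ne.symm hy2, h2])).1 h4 with h5 | h5
    · refine ⟨y, ⟨h3, h5⟩, ?_⟩
      rw [if_neg]
      · exact .refl
      · rintro rfl; simp at hyw
    · exact viaw (.single ⟨h1, h3, h.insert_of_subset h5.le⟩)

theorem linkConn_of_notMem (h : IsSplit K K' w x₁ x₂ T D₁ D₂) {σ : Finset V} (hc : LinkConn K σ)
    (h1 : x₁ ∉ σ) (h2 : x₂ ∉ σ) (hw : w ∉ σ) (hσ : σ ∈ K.faces)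
    (hw' : insert w σ ∉ K.faces) : LinkConn K' σ := by
  have hσT : ¬ σ ⊆ T := by
    intro hs
    refine hw' (h.insert_of_left (h.left σ (face_nonempty hσ) (hs.ssubset_of_ne ?_))).2
    rintro rfl
    exact h.notMem hσ
  refine hc.map id ?_ ?_
  · intro a b hab
    have hne : ∀ c, Ext K σ c → c ≠ w := by rintro c hc rfl; exact hw' hc.2
    refine .single ⟨hab.1, hab.2.1, (h.mem _ ?_ (h.fresh _ hab.2.2) (h.fresh' _ hab.2.2)).2
      (Or.inl hab.2.2)⟩
    simp [Ne.symm (hne a hab.left), Ne.symm (hne b hab.right), hw]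
  · rintro y ⟨h3, h4⟩
    have aux : ∀ {x₁ x₂ : V} {D₁ D₂ : PreAbstractSimplicialComplex V},
        IsSplit K K' w x₁ x₂ T D₁ D₂ → x₁ ∉ σ → insert x₁ σ ∉ K'.faces := by
      intro x₁ x₂ D₁ D₂ h h1 hh
      rcases (h.left_of_insert h1 hh).2.2 with h5 | h5 | h5
      · exact (face_nonempty hσ).ne_empty h5
      · exact hw' (h.insert_of_left h5).2
      · exact hσT h5.le
    refine ⟨y, ⟨h3, ((h.mem _ (h.base _ h4) ?_ ?_).1 h4).resolve_right fun e => ?_⟩, .refl⟩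
    · rw [Finset.mem_insert, not_or]; exact ⟨fun e => aux h h1 (e ▸ h4), h1⟩
    · rw [Finset.mem_insert, not_or]; exact ⟨fun e => aux h.symm h2 (e ▸ h4), h2⟩
    · exact hσT (e ▸ Finset.subset_insert y σ)

/-- The links of `x₁` and of the edges at `x₁`: a path in the link of `w`, or of an edge at `w`,
stays in `D₁` until it meets `T`, and the vertices of `T` are adjacent because of the new
triangle. -/
theorem linkConn_insert (h : IsSplit K K' w x₁ x₂ T D₁ D₂) {γ : Finset V}
    (hc : LinkConn K (insert w γ)) (hγc : γ.card ≤ 1) (hγ : γ = ∅ ∨ γ ∈ D₁.faces) :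
    LinkConn K' (insert x₁ γ) := by
  have hx : x₁ ∉ γ := by
    rcases hγ with rfl | hγ
    · simp
    · exact h.fresh _ (h.face_of_left hγ)
  have hex : ∀ z, Ext K' (insert x₁ γ) z → z ∉ γ ∧ insert z γ ∈ D₁.faces := by
    intro z hz
    obtain ⟨h1, h2⟩ := (h.ext_insert_iff hx z).1 hz
    refine ⟨h1, h2.resolve_right fun e => ?_⟩
    have := Finset.card_insert_of_notMem h1
    rw [e, h.card] at this
    omega
  have hext : ∀ z, z ∉ γ → insert z γ ∈ D₁.faces → Ext K (insert w γ) z := by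
    intro z h1 h2
    obtain ⟨h3, h4⟩ := h.insert_of_left h2
    rw [Finset.mem_insert, not_or] at h3
    exact ⟨by simp [Ne.symm h3.1, h1], by rwa [Finset.insert_comm]⟩
  have hadj : ∀ a b, a ∉ γ → b ∉ γ → insert a (insert b γ) ∈ D₁.faces →
      LinkAdj K' (insert x₁ γ) a b := by
    intro a b h1 h2 h3
    have hx' := h.fresh _ (h.face_of_left h3)
    simp only [Finset.mem_insert, not_or] at hx'
    refine ⟨by simp [Ne.symm hx'.1, h1], by simp [Ne.symm hx'.2.1, h2], ?_⟩
    rw [Finset.insert_comm b, Finset.insert_comm a]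
    exact h.insert_of_mem h3
  have hstep : ∀ a b, LinkAdj K (insert w γ) a b → a ∉ γ ∧ b ∉ γ ∧
      (insert a (insert b γ) ∈ D₁.faces ∨ insert a (insert b γ) ∈ D₂.faces) := by
    rintro a b ⟨h1, h2, h3⟩
    rw [Finset.mem_insert, not_or] at h1 h2
    refine ⟨h1.2, h2.2, (h.link _ (Finset.insert_nonempty _ _)).1 ⟨?_, ?_⟩⟩
    · rcases hγ with rfl | hγ
      · simp [Ne.symm h1.1, Ne.symm h2.1]
      · simp [Ne.symm h1.1, Ne.symm h2.1, (h.insert_of_left hγ).1]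
    · rwa [Finset.insert_comm w, Finset.insert_comm w]
  by_cases hT : γ ⊆ T
  · obtain ⟨c, hcT, hcγ⟩ := Finset.exists_of_ssubset (h.ssubset_of_subset hT (by omega))
    have hcs : insert c γ ⊂ T := h.ssubset_of_subset (Finset.insert_subset hcT hT) (by
      rw [Finset.card_insert_of_notMem hcγ]; omega)
    have hcD := h.left _ (Finset.insert_nonempty _ _) hcs
    have key : ∀ z, z ∉ γ → insert z γ ∈ D₁.faces → LinkPath K' (insert x₁ γ) z c := by
      intro z h1 h2
      have hp := hc z c (hext z h1 h2) (hext c hcγ hcD)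
      induction hp using Relation.ReflTransGen.head_induction_on with
      | refl => exact .refl
      | @head a b hab _ ih =>
        obtain ⟨-, hb, h3⟩ := hstep a b hab
        by_cases haT : a ∈ T
        · refine .single ⟨?_, ?_, ?_⟩
          · simp [(h.ne_of_mem haT).2.1, h1]
          · simp [(h.ne_of_mem hcT).2.1, hcγ]
          · rw [Finset.insert_comm c, Finset.insert_comm a]
            exact h.insert_of_subset (Finset.insert_subset haT hcs.1)
        · have h4 := h3.resolve_right fun h4 => haT ((h.inter _ h2
            (face_mono h4 (Finset.insert_subset_insert _ (Finset.subset_insert _ _))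
              (by simp))).1 (Finset.mem_insert_self _ _))
          exact .head (hadj a b h1 hb h4)
            (ih hb (face_mono h4 (Finset.subset_insert _ _) (by simp)))
    intro a b ha hb
    obtain ⟨a1, a2⟩ := hex a ha
    obtain ⟨b1, b2⟩ := hex b hb
    exact (key a a1 a2).trans (key b b1 b2).symm
  · have hγD : γ ∈ D₁.faces := hγ.resolve_left fun e => hT (e ▸ Finset.empty_subset _)
    refine hc.map id ?_ fun y hy => ⟨y, hext y (hex y hy).1 (hex y hy).2, .refl⟩
    intro a b hab
    obtain ⟨h1, h2, h3⟩ := hstep a b hab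
    refine .single (hadj a b h1 h2 (h3.resolve_right fun h4 => hT (h.inter γ hγD ?_).1))
    exact face_mono h4 ((Finset.subset_insert _ _).trans (Finset.subset_insert _ _))
      (face_nonempty hγD)

theorem isPM (h : IsSplit K K' w x₁ x₂ T D₁ D₂) (hK : IsPM 3 K) : IsPM 3 K' := by
  have hcard := h.card
  refine ⟨h.finite hK.finite, ⟨_, h.insert_of_subset subset_rfl⟩, ?_, h.pure hK, h.two hK, ?_⟩
  · intro σ hσ
    obtain ⟨τ, -, hs, hc⟩ := h.pure hK σ hσ
    exact (Finset.card_le_card hs).trans hc.le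
  · have hwK := h.singleton_mem
    have aux : ∀ {x₁ x₂ : V} {D₁ D₂ : PreAbstractSimplicialComplex V},
        IsSplit K K' w x₁ x₂ T D₁ D₂ → ∀ γ, x₁ ∉ γ → (γ = ∅ ∨ γ ∈ D₁.faces ∨ γ = T) →
        (insert x₁ γ).card + 1 ≤ 3 → LinkConn K' (insert x₁ γ) := by
      intro x₁ x₂ D₁ D₂ h γ hx hγ hc
      rw [Finset.card_insert_of_notMem hx] at hc
      have hγ' : γ = ∅ ∨ γ ∈ D₁.faces := by
        rcases hγ with hγ | hγ | rfl
        · exact Or.inl hγ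
        · exact Or.inr hγ
        · omega
      refine h.linkConn_insert (hK.conn _ (Or.inr ?_) ?_) (by omega) hγ'
      · rcases hγ' with rfl | hγ'
        · exact hwK
        · exact (h.insert_of_left hγ').2
      · have := Finset.card_insert_le w γ
        omega
    rintro σ (rfl | hσ) hc
    · exact h.linkConn_of_left (hK.conn ∅ (Or.inl rfl) hc) (by simp) (by simp) (by simp) hwK
        (Or.inl rfl) (by rintro rfl; simp at hcard)
    rcases h.cases_mem hσ with ⟨hw, h1, h2, hσK | rfl⟩ | ⟨γ, rfl, hx, hγ⟩ | ⟨γ, rfl, hx, hγ⟩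
    · have hcon := hK.conn σ (Or.inr hσK) hc
      have hσT : σ ≠ T := fun e => h.notMem (e ▸ hσK)
      by_cases hwσ : insert w σ ∈ K.faces
      · rcases (h.link σ (face_nonempty hσ)).1 ⟨hw, hwσ⟩ with hl | hl
        · exact h.linkConn_of_left hcon hw h1 h2 hwσ (Or.inr hl) hσT
        · exact h.symm.linkConn_of_left hcon hw h2 h1 hwσ (Or.inr hl) hσT
      · exact h.linkConn_of_notMem hcon h1 h2 hw hσK hwσ
    · omega
    · exact aux h γ hx hγ hc
    · exact aux h.symm γ hx hγ hc

theorem card_vertices (h : IsSplit K K' w x₁ x₂ T D₁ D₂) (hK : K.faces.Finite) :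
    (facesOfCard (h.finite hK) 1).card = (facesOfCard hK 1).card + 1 := by
  have e : facesOfCard (h.finite hK) 1 =
      insert {x₁} (insert {x₂} ((facesOfCard hK 1).erase {w})) := by
    ext σ
    simp only [Finset.mem_insert, Finset.mem_erase, mem_facesOfCard, ne_eq]
    constructor
    · rintro ⟨h1, h2⟩
      obtain ⟨a, rfl⟩ := Finset.card_eq_one.mp h2
      by_cases ha : a = x₁
      · subst ha; exact Or.inl rfl
      by_cases hb : a = x₂
      · subst hb; exact Or.inr (Or.inl rfl)
      have hw := h.base _ h1
      refine Or.inr (Or.inr ⟨?_, ?_, h2⟩)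
      · intro e; rw [e] at hw; simp at hw
      · refine ((h.mem _ hw (by simpa using Ne.symm ha) (by simpa using Ne.symm hb)).1
          h1).resolve_right fun e => ?_
        have := h.card
        rw [← e] at this
        omega
    · rintro (rfl | rfl | ⟨h1, h2, h3⟩)
      · exact ⟨h.insert_of_subset (Finset.empty_subset T), by simp⟩
      · exact ⟨h.symm.insert_of_subset (Finset.empty_subset T), by simp⟩
      · refine ⟨(h.mem _ (fun hh => h1 ?_) (h.fresh _ h2) (h.fresh' _ h2)).2 (Or.inl h2), h3⟩
        obtain ⟨a, rfl⟩ := Finset.card_eq_one.mp h3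
        rw [Finset.mem_singleton.mp hh]
  have f1 : {x₂} ∉ (facesOfCard hK 1).erase {w} := by
    intro hh
    exact h.fresh' _ (mem_facesOfCard.mp (Finset.mem_of_mem_erase hh)).1 (by simp)
  have f2 : {x₁} ∉ insert {x₂} ((facesOfCard hK 1).erase {w}) := by
    rw [Finset.mem_insert, not_or]
    refine ⟨by simpa using h.ne, fun hh => ?_⟩
    exact h.fresh _ (mem_facesOfCard.mp (Finset.mem_of_mem_erase hh)).1 (by simp)
  have f3 : {w} ∈ facesOfCard hK 1 := mem_facesOfCard.mpr ⟨h.singleton_mem, by simp⟩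
  rw [e, Finset.card_insert_of_notMem f2, Finset.card_insert_of_notMem f1,
    Finset.card_erase_add_one f3]

theorem ext_singleton_iff (h : IsSplit K K' w x₁ x₂ T D₁ D₂) (r : V) :
    Ext K' {x₁} r ↔ {r} ∈ D₁.faces := by
  have := h.ext_insert_iff (γ := ∅) (by simp) r
  rw [insert_empty_eq] at this
  rw [this]
  simp only [Finset.notMem_empty, not_false_eq_true, true_and, insert_empty_eq]
  refine or_iff_left fun e => ?_
  have := h.card
  rw [← e] at this
  simp at this

/-- The vertices of the circuit are the common neighbours of `w` on both sides, so that the degrees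
of `x₁` and `x₂` add up to that of `w` plus three. -/
theorem card_exts (h : IsSplit K K' w x₁ x₂ T D₁ D₂) (hK : K.faces.Finite) :
    (exts (h.finite hK) {x₁}).card + (exts (h.finite hK) {x₂}).card =
      (exts hK {w}).card + 3 := by
  have e1 : exts hK {w} = exts (h.finite hK) {x₁} ∪ exts (h.finite hK) {x₂} := by
    ext r
    rw [Finset.mem_union, mem_exts, mem_exts, mem_exts, h.ext_singleton_iff,
      h.symm.ext_singleton_iff, ← h.link {r} (by simp), Ext, Finset.pair_comm]
    simp [eq_comm]
  have e2 : T = exts (h.finite hK) {x₁} ∩ exts (h.finite hK) {x₂} := by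
    ext r
    rw [Finset.mem_inter, mem_exts, mem_exts, h.ext_singleton_iff, h.symm.ext_singleton_iff]
    constructor
    · intro hr
      exact ⟨h.left {r} (by simp) (h.singleton_ssubset hr),
        h.right {r} (by simp) (h.singleton_ssubset hr)⟩
    · rintro ⟨h1, h2⟩
      exact (h.inter _ h1 h2).1 (by simp)
  rw [← Finset.card_union_add_card_inter, ← e1, ← e2, h.card]

theorem card_edges (h : IsSplit K K' w x₁ x₂ T D₁ D₂) (hK : K.faces.Finite) :
    (facesOfCard (h.finite hK) 2).card = (facesOfCard hK 2).card + 3 := by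
  have e1 := Finset.card_filter_add_card_filter_not (s := facesOfCard (h.finite hK) 2)
    (fun e => x₁ ∈ e)
  have e2 := Finset.card_filter_add_card_filter_not
    (s := (facesOfCard (h.finite hK) 2).filter (fun e => x₁ ∉ e)) (fun e => x₂ ∈ e)
  have e3 := Finset.card_filter_add_card_filter_not (s := facesOfCard hK 2) (fun e => w ∈ e)
  have e4 : ((facesOfCard (h.finite hK) 2).filter (fun e => x₁ ∉ e)).filter (fun e => x₂ ∈ e) =
      (facesOfCard (h.finite hK) 2).filter (fun e => x₂ ∈ e) := by
    ext e
    simp only [Finset.mem_filter, mem_facesOfCard]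
    constructor
    · tauto
    · rintro ⟨⟨h1, h2⟩, h3⟩
      exact ⟨⟨⟨h1, h2⟩, fun hh => h.disj _ h1 hh h3⟩, h3⟩
  have e5 : ((facesOfCard (h.finite hK) 2).filter (fun e => x₁ ∉ e)).filter (fun e => x₂ ∉ e) =
      (facesOfCard hK 2).filter (fun e => w ∉ e) := by
    ext e
    simp only [Finset.mem_filter, mem_facesOfCard]
    constructor
    · rintro ⟨⟨⟨h1, h2⟩, h3⟩, h4⟩
      have hw := h.base _ h1
      refine ⟨⟨((h.mem _ hw h3 h4).1 h1).resolve_right ?_, h2⟩, hw⟩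
      rintro rfl
      have := h.card
      omega
    · rintro ⟨⟨h1, h2⟩, h3⟩
      have f1 := h.fresh _ h1
      have f2 := h.fresh' _ h1
      exact ⟨⟨⟨(h.mem _ h3 f1 f2).2 (Or.inl h1), h2⟩, f1⟩, f2⟩
  rw [card_filter_mem_edges] at e1 e3
  rw [e4, e5, card_filter_mem_edges] at e2
  have := h.card_exts hK
  omega

/-- A splitting adds one vertex and three edges. -/
theorem g2_lt (h : IsSplit K K' w x₁ x₂ T D₁ D₂) (hK : K.faces.Finite) : g2 K' < g2 K := by
  have h0 := h.card_vertices hK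
  have h1 := h.card_edges hK
  have e0 : fNum K' 0 = (facesOfCard (h.finite hK) 1).card := fNum_eq _ _
  have e1 : fNum K' 1 = (facesOfCard (h.finite hK) 2).card := fNum_eq _ _
  have e2 : fNum K 0 = (facesOfCard hK 1).card := fNum_eq _ _
  have e3 : fNum K 1 = (facesOfCard hK 2).card := fNum_eq _ _
  rw [g2, g2]
  omega

end IsSplit

/-! ### The two sides of a triangular circuit in a sphere -/

/-- The subcomplex consisting of the triangles of `L` that satisfy `G`, with all their faces. -/
def triangleHull (L : PreAbstractSimplicialComplex V) (G : Finset V → Prop) :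
    PreAbstractSimplicialComplex V where
  faces := {σ | σ.Nonempty ∧ ∃ τ ∈ L.faces, τ.card = 3 ∧ G τ ∧ σ ⊆ τ}
  isRelLowerSet_faces := by
    rintro σ ⟨hn, τ, h1, h2, h3, h4⟩
    exact ⟨hn, fun ρ hρ hρn => ⟨hρn, τ, h1, h2, h3, Finset.Subset.trans hρ h4⟩⟩

theorem mem_of_mem_triangleHull {L : PreAbstractSimplicialComplex V} {G : Finset V → Prop}
    {σ : Finset V}    (hσ : σ ∈ (triangleHull L G).faces) : σ ∈ L.faces := by
  obtain ⟨hn, τ, h1, -, -, h2⟩ := hσ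
  exact face_mono h1 h2 hn

theorem triangleHull_pure {L : PreAbstractSimplicialComplex V} {G : Finset V → Prop} {σ : Finset V}
    (hσ : σ ∈ (triangleHull L G).faces) :
    ∃ τ ∈ (triangleHull L G).faces, σ ⊆ τ ∧ τ.card = 3 := by
  obtain ⟨hn, τ, h1, h2, h3, h4⟩ := hσ
  exact ⟨τ, ⟨face_nonempty h1, τ, h1, h2, h3, subset_rfl⟩, h4, h2⟩

theorem triangleHull_or {L : PreAbstractSimplicialComplex V} (h : IsPM 2 L) (G : Finset V → Prop)
    {σ : Finset V} (hσ : σ ∈ L.faces) :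
    σ ∈ (triangleHull L G).faces ∨ σ ∈ (triangleHull L fun τ => ¬ G τ).faces := by
  obtain ⟨τ, h1, h2, h3⟩ := h.pure σ hσ
  by_cases hG : G τ
  · exact Or.inl ⟨face_nonempty hσ, τ, h1, h3, hG, h2⟩
  · exact Or.inr ⟨face_nonempty hσ, τ, h1, h3, hG, h2⟩

theorem ext_triangleHull {L : PreAbstractSimplicialComplex V} {G : Finset V → Prop} {e : Finset V}
    (he : e.card = 2) (r : V) :
    Ext (triangleHull L G) e r ↔ Ext L e r ∧ G (insert r e) := by
  constructor
  · rintro ⟨h1, -, τ, h3, h4, h5, h6⟩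
    have : insert r e = τ := Finset.eq_of_subset_of_card_le h6 (by
      rw [Finset.card_insert_of_notMem h1]; omega)
    subst this
    exact ⟨⟨h1, h3⟩, h5⟩
  · rintro ⟨⟨h1, h2⟩, h3⟩
    exact ⟨h1, by simp, _, h2, by rw [Finset.card_insert_of_notMem h1, he], h3, subset_rfl⟩

/-- The predicate `G` on triangles changes exactly across the edges of `T`. -/
def ChangesAcross (L : PreAbstractSimplicialComplex V) (T : Finset V) (G : Finset V → Prop) :
    Prop :=
  ∀ (e : Finset V) (p q : V), e.card = 2 → p ≠ q → Ext L e p → Ext L e q →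
    ((G (insert p e) ↔ G (insert q e)) ↔ ¬ e ⊆ T)

namespace ChangesAcross

variable {L : PreAbstractSimplicialComplex V} {T : Finset V} {G : Finset V → Prop}

theorem not (hG : ChangesAcross L T G) : ChangesAcross L T fun τ => ¬ G τ := by
  intro e p q he hpq hp hq
  rw [not_iff_not]
  exact hG e p q he hpq hp hq

/-- Across each edge of `T` there is exactly one triangle satisfying `G`. -/
theorem existsUnique (hG : ChangesAcross L T G) (h : IsPM 2 L) {e : Finset V} (he : e.card = 2)
    (heL : e ∈ L.faces) (heT : e ⊆ T) : ∃ q, ∀ r, Ext (triangleHull L G) e r ↔ r = q := by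
  obtain ⟨p, q, hpq, hr⟩ := h.two e heL he
  have hc := hG e p q he hpq ((hr p).2 (Or.inl rfl)) ((hr q).2 (Or.inr rfl))
  by_cases hp : G (insert p e)
  · refine ⟨p, fun r => ?_⟩
    rw [ext_triangleHull he, hr]
    constructor
    · rintro ⟨rfl | rfl, h1⟩
      · rfl
      · tauto
    · rintro rfl; exact ⟨Or.inl rfl, hp⟩
  · refine ⟨q, fun r => ?_⟩
    rw [ext_triangleHull he, hr]
    constructor
    · rintro ⟨rfl | rfl, h1⟩
      · exact absurd h1 hp
      · rfl
    · rintro rfl; exact ⟨Or.inr rfl, by tauto⟩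

theorem exists_mem (hG : ChangesAcross L T G) (h : IsPM 2 L) (hT : T.card = 3)
    (hTL : ∀ e ⊆ T, e.card = 2 → e ∈ L.faces) {σ : Finset V} (hn : σ.Nonempty) (hσ : σ ⊂ T) :
    σ ∈ (triangleHull L G).faces := by
  obtain ⟨e, h1, h2, h3⟩ := Finset.exists_subsuperset_card_eq hσ.1
    (show σ.card ≤ 2 by have := Finset.card_lt_card hσ; omega) (by omega)
  obtain ⟨q, hq⟩ := hG.existsUnique h h3 (hTL e h2 h3) h2
  exact face_mono ((hq q).2 rfl).2 (h1.trans (Finset.subset_insert _ _)) hn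

/-- The triangles around a vertex off `T` lie on the same side. -/
theorem iff_of_notMem (hG : ChangesAcross L T G) (h : IsPM 2 L) {y : V} (hy : y ∉ T)
    {τ₁ τ₂ : Finset V} (h₁ : τ₁ ∈ L.faces) (h₂ : τ₂ ∈ L.faces) (c₁ : τ₁.card = 3)
    (c₂ : τ₂.card = 3) (hy₁ : y ∈ τ₁) (hy₂ : y ∈ τ₂) : G τ₁ ↔ G τ₂ := by
  have same : ∀ a τ τ', a ≠ y → τ ∈ L.faces → τ' ∈ L.faces → τ.card = 3 → τ'.card = 3 →
      y ∈ τ → y ∈ τ' → a ∈ τ → a ∈ τ' → (G τ ↔ G τ') := by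
    intro a τ τ' hay h1 h2 c1 c2 y1 y2 a1 a2
    have hs : ({y, a} : Finset V).card = 2 := Finset.card_pair hay.symm
    have coface : ∀ τ, τ ∈ L.faces → τ.card = 3 → y ∈ τ → a ∈ τ →
        ∃ p, Ext L {y, a} p ∧ insert p {y, a} = τ := by
      intro τ h1 c1 y1 a1
      obtain ⟨p, hp, hpn⟩ := Finset.exists_mem_notMem_of_card_lt_card
        (show ({y, a} : Finset V).card < τ.card by omega)
      have hsub : ({y, a} : Finset V) ⊆ τ := by
        rw [Finset.insert_subset_iff, Finset.singleton_subset_iff]; exact ⟨y1, a1⟩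
      have e : insert p {y, a} = τ :=
        Finset.eq_of_subset_of_card_le (Finset.insert_subset hp hsub) (by
          rw [Finset.card_insert_of_notMem hpn]; omega)
      exact ⟨p, ⟨hpn, e ▸ h1⟩, e⟩
    obtain ⟨p, hp, rfl⟩ := coface τ h1 c1 y1 a1
    obtain ⟨q, hq, rfl⟩ := coface τ' h2 c2 y2 a2
    by_cases hpq : p = q
    · rw [hpq]
    · exact (hG _ p q hs hpq hp hq).2 fun hh => hy (hh (by simp))
  have other : ∀ τ : Finset V, τ ∈ L.faces → τ.card = 3 → y ∈ τ → ∃ a ∈ τ, Ext L {y} a := by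
    intro τ h1 c1 y1
    obtain ⟨a, ha, hay⟩ := Finset.exists_mem_notMem_of_card_lt_card
      (show ({y} : Finset V).card < τ.card by rw [Finset.card_singleton]; omega)
    refine ⟨a, ha, hay, face_mono h1 ?_ (by simp)⟩
    exact Finset.insert_subset ha (Finset.singleton_subset_iff.mpr y1)
  obtain ⟨a, ha, hae⟩ := other τ₁ h₁ c₁ hy₁
  obtain ⟨b, hb, hbe⟩ := other τ₂ h₂ c₂ hy₂
  have hp := h.conn {y} (Or.inr (face_mono h₁ (Finset.singleton_subset_iff.mpr hy₁) (by simp)))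
    (by simp) a b hae hbe
  have hay : ∀ {a}, Ext L {y} a → a ≠ y := fun ha => by simpa using ha.1
  induction hp generalizing τ₂ with
  | refl => exact same a _ _ (hay hae) h₁ h₂ c₁ c₂ hy₁ hy₂ ha hb
  | @tail c d _ hcd ih =>
    obtain ⟨τ, h1, h2, h3⟩ := h.pure _ hcd.2.2
    have hyτ : y ∈ τ := h2 (by simp)
    exact (ih h1 h3 hyτ (h2 (by simp)) hcd.left).trans
      (same d _ _ (hay hbe) h1 h₂ h3 c₂ hyτ hy₂ (h2 (by simp)) hb)

theorem inter (hG : ChangesAcross L T G) (h : IsPM 2 L) (hT : T.card = 3) {σ : Finset V}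
    (h1 : σ ∈ (triangleHull L G).faces) (h2 : σ ∈ (triangleHull L fun τ => ¬ G τ).faces) :
    σ ⊂ T := by
  have hsub : σ ⊆ T := by
    obtain ⟨-, τ₁, a1, a2, a3, a4⟩ := h1
    obtain ⟨-, τ₂, b1, b2, b3, b4⟩ := h2
    intro y hy
    by_contra hyT
    exact b3 ((hG.iff_of_notMem h hyT a1 b1 a2 b2 (a4 hy) (b4 hy)).1 a3)
  refine hsub.ssubset_of_ne ?_
  rintro rfl
  obtain ⟨-, τ₁, a1, a2, a3, a4⟩ := h1
  obtain ⟨-, τ₂, b1, b2, b3, b4⟩ := h2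
  have e1 := Finset.eq_of_subset_of_card_le a4 (by omega)
  have e2 := Finset.eq_of_subset_of_card_le b4 (by omega)
  exact b3 (e2 ▸ e1 ▸ a3)

end ChangesAcross

/-- If the link of the non-singular vertex `w` contains the boundary of a triangle that is not a
face, then `K` is reducible: `w` can be split. -/
theorem isReducible_of_simplexBoundary_le [Infinite V] {K : PreAbstractSimplicialComplex V}
    (hK : IsPM 3 K) {w : V} {T : Finset V} (hw : IsNonsingular K w) (hT : T.card = 3)
    (hTw : ∀ e ⊆ T, e.card = 2 → e ∈ (link K {w}).faces) (hTK : T ∉ K.faces) :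
    IsReducible K := by
  obtain ⟨x₁, hx₁⟩ := Infinite.exists_notMem_finset (hK.finite.toFinset.biUnion id)
  obtain ⟨x₂, hx₂⟩ := Infinite.exists_notMem_finset (insert x₁ (hK.finite.toFinset.biUnion id))
  rw [Finset.mem_insert, not_or] at hx₂
  have fresh : ∀ {x}, x ∉ hK.finite.toFinset.biUnion id → ∀ σ ∈ K.faces, x ∉ σ := by
    intro x hx σ hσ hh
    exact hx (Finset.mem_biUnion.mpr ⟨σ, hK.finite.mem_toFinset.mpr hσ, hh⟩)
  have hL := hK.link hw.1
  obtain ⟨G, hG⟩ := exists_coloring hL (hw.2.eulerChar hL.finite) hT hTw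
  replace hG : ChangesAcross (link K {w}) T G := hG
  set L := link K {w} with hLdef
  have hlink : ∀ σ : Finset V, σ.Nonempty → (σ ∈ L.faces ↔ w ∉ σ ∧ insert w σ ∈ K.faces) := by
    intro σ hσ
    rw [hLdef, mem_link, Finset.disjoint_singleton_right, Finset.union_comm, ← Finset.insert_eq]
    tauto
  have hLK : ∀ σ ∈ L.faces, σ ∈ K.faces := fun σ hσ =>
    face_mono ((hlink σ (face_nonempty hσ)).1 hσ).2 (Finset.subset_insert _ _) (face_nonempty hσ)
  set D₁ := triangleHull L G with hD₁
  set D₂ := triangleHull L (fun τ => ¬ G τ) with hD₂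
  have hD : ∀ σ, σ ∈ D₁.faces ∨ σ ∈ D₂.faces ↔ σ ∈ L.faces :=
    fun σ => ⟨fun hh => hh.elim mem_of_mem_triangleHull mem_of_mem_triangleHull,
      triangleHull_or hL G⟩
  have hTne : T.Nonempty := Finset.card_pos.mp (by omega)
  have hTmem : ∀ c ∈ T, c ≠ w ∧ c ≠ x₁ ∧ c ≠ x₂ := by
    intro c hc
    have hcs : ({c} : Finset V) ⊂ T := by
      refine (Finset.singleton_subset_iff.mpr hc).ssubset_of_ne fun e => ?_
      rw [← e] at hT
      simp at hT
    have h1 := mem_of_mem_triangleHull (hG.exists_mem hL hT hTw (by simp) hcs)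
    have h2 := ((hlink _ (by simp)).1 h1).1
    have h3 := fresh hx₁ _ (hLK _ h1)
    have h4 := fresh hx₂.2 _ (hLK _ h1)
    rw [Finset.mem_singleton] at h2 h3 h4
    exact ⟨Ne.symm h2, Ne.symm h3, Ne.symm h4⟩
  have hwT : w ∉ T := fun hh => (hTmem w hh).1 rfl
  have hxT₁ : x₁ ∉ T := fun hh => (hTmem x₁ hh).2.1 rfl
  have hxT₂ : x₂ ∉ T := fun hh => (hTmem x₂ hh).2.2 rfl
  set K' := deleteStar K {w} ⊔ cone (D₁ ⊔ simplex T) x₁ ⊔ cone (D₂ ⊔ simplex T) x₂ with hK'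
  have hcone : ∀ (D : PreAbstractSimplicialComplex V) (x : V) (σ : Finset V),
      σ ∈ (cone (D ⊔ simplex T) x).faces ↔ (σ ∈ D.faces ∨ (σ.Nonempty ∧ σ ⊆ T)) ∨
        ∃ τ, (τ = ∅ ∨ τ ∈ D.faces ∨ (τ.Nonempty ∧ τ ⊆ T)) ∧ σ = insert x τ :=
    fun D x σ => Iff.rfl
  have hmem : ∀ σ, σ ∈ K'.faces ↔ (σ ∈ K.faces ∧ w ∉ σ) ∨
      σ ∈ (cone (D₁ ⊔ simplex T) x₁).faces ∨ σ ∈ (cone (D₂ ⊔ simplex T) x₂).faces := by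
    intro σ
    rw [← or_assoc, ← Finset.singleton_subset_iff]
    exact Iff.rfl
  have hxne : x₁ ≠ x₂ := fun e => hx₂.1 e.symm
  -- the faces of a cone, by whether they contain the apex
  have hbase : ∀ (D : PreAbstractSimplicialComplex V) (x : V), (∀ σ ∈ D.faces, σ ∈ L.faces) →
      x ∉ hK.finite.toFinset.biUnion id → x ∉ T → ∀ σ ∈ (cone (D ⊔ simplex T) x).faces,
      ∀ y, y ∈ σ → y = x ∨ (∃ τ ∈ D.faces, y ∈ τ) ∨ y ∈ T := by
    intro D x hDL hx hxT σ hσ y hy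
    rcases (hcone D x σ).1 hσ with (h1 | h1) | ⟨τ, h1, rfl⟩
    · exact Or.inr (Or.inl ⟨σ, h1, hy⟩)
    · exact Or.inr (Or.inr (h1.2 hy))
    · rcases Finset.mem_insert.mp hy with e | hy
      · exact Or.inl e
      · rcases h1 with rfl | h1 | h1
        · simp at hy
        · exact Or.inr (Or.inl ⟨τ, h1, hy⟩)
        · exact Or.inr (Or.inr (h1.2 hy))
  have hins : ∀ (D : PreAbstractSimplicialComplex V) (x : V), (∀ σ ∈ D.faces, σ ∈ L.faces) →
      x ∉ hK.finite.toFinset.biUnion id → x ∉ T → ∀ σ, x ∉ σ →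
      (insert x σ ∈ (cone (D ⊔ simplex T) x).faces ↔ σ = ∅ ∨ σ ∈ D.faces ∨ σ ⊆ T) := by
    intro D x hDL hx hxT σ hxσ
    rw [hcone]
    constructor
    · rintro ((h1 | h1) | ⟨τ, h1, h2⟩)
      · exact absurd (Finset.mem_insert_self x σ) (fresh hx _ (hLK _ (hDL _ h1)))
      · exact absurd (h1.2 (Finset.mem_insert_self x σ)) hxT
      · have hxτ : x ∉ τ := by
          rcases h1 with rfl | h1 | h1
          · simp
          · exact fresh hx _ (hLK _ (hDL _ h1))
          · exact fun hh => hxT (h1.2 hh)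
        have : σ = τ := by rw [← Finset.erase_insert hxσ, h2, Finset.erase_insert hxτ]
        subst this
        exact h1.imp_right (Or.imp_right And.right)
    · intro h1
      refine Or.inr ⟨σ, ?_, rfl⟩
      rcases Finset.eq_empty_or_nonempty σ with h2 | h2
      · exact Or.inl h2
      · tauto
  have hno : ∀ (D : PreAbstractSimplicialComplex V) (x : V) σ, x ∉ σ →
      (σ ∈ (cone (D ⊔ simplex T) x).faces ↔ σ ∈ D.faces ∨ (σ.Nonempty ∧ σ ⊆ T)) := by
    intro D x σ hx
    rw [hcone]
    refine or_iff_left ?_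
    rintro ⟨τ, -, rfl⟩
    exact hx (Finset.mem_insert_self _ _)
  have hD₁L : ∀ σ ∈ D₁.faces, σ ∈ L.faces := fun σ hσ => mem_of_mem_triangleHull hσ
  have hD₂L : ∀ σ ∈ D₂.faces, σ ∈ L.faces := fun σ hσ => mem_of_mem_triangleHull hσ
  have hnot : ∀ (D : PreAbstractSimplicialComplex V) (x y : V), (∀ σ ∈ D.faces, σ ∈ L.faces) →
      x ∉ hK.finite.toFinset.biUnion id → x ∉ T → (∀ τ ∈ L.faces, y ∉ τ) → y ≠ x → y ∉ T →
      ∀ σ ∈ (cone (D ⊔ simplex T) x).faces, y ∉ σ := by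
    intro D x y hDL hx hxT h1 h2 h3 σ hσ hy
    rcases hbase D x hDL hx hxT σ hσ y hy with h4 | ⟨τ, h4, h5⟩ | h4
    · exact h2 h4
    · exact h1 τ (hDL _ h4) h5
    · exact h3 h4
  have hwL : ∀ τ ∈ L.faces, w ∉ τ := fun τ hτ => ((hlink τ (face_nonempty hτ)).1 hτ).1
  have hwx₁ : w ≠ x₁ := fun e => fresh hx₁ _ hw.1 (by simp [e])
  have hwx₂ : w ≠ x₂ := fun e => fresh hx₂.2 _ hw.1 (by simp [e])
  have h21 := hnot D₁ x₁ x₂ hD₁L hx₁ hxT₁ (fun τ hτ => fresh hx₂.2 τ (hLK _ hτ)) hxne.symm hxT₂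
  have h12 := hnot D₂ x₂ x₁ hD₂L hx₂.2 hxT₂ (fun τ hτ => fresh hx₁ τ (hLK _ hτ)) hxne hxT₁
  have hpart : ∀ σ : Finset V, σ.Nonempty → σ ⊆ T → σ ∈ K.faces ∨ σ = T := by
    intro σ hn hs
    rcases eq_or_ne σ T with e | e
    · exact Or.inr e
    · exact Or.inl (hLK _ (hD₁L _ (hG.exists_mem hL hT hTw hn (hs.ssubset_of_ne e))))
  have hsplit : IsSplit K K' w x₁ x₂ T D₁ D₂ := by
    refine ⟨hxne, fresh hx₁, fresh hx₂.2, hT, hTK, ?_, fun σ => hG.inter hL hT,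
      fun σ => hG.exists_mem hL hT hTw, fun σ => hG.not.exists_mem hL hT hTw,
      fun σ => triangleHull_pure, fun σ => triangleHull_pure,
      fun e h1 h2 => hG.existsUnique hL h2 (hTw e h1 h2) h1,
      fun e h1 h2 => hG.not.existsUnique hL h2 (hTw e h1 h2) h1, ?_, ?_, ?_, ?_, ?_⟩
    · intro σ hσ
      rw [hD, hlink σ hσ]
    · intro σ hσ
      rcases (hmem σ).1 hσ with h1 | h1 | h1
      · exact h1.2
      · exact hnot D₁ x₁ w hD₁L hx₁ hxT₁ hwL hwx₁ hwT σ h1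
      · exact hnot D₂ x₂ w hD₂L hx₂.2 hxT₂ hwL hwx₂ hwT σ h1
    · intro σ hσ h1
      rcases (hmem σ).1 hσ with h2 | h2 | h2
      · exact absurd h1 (fresh hx₁ σ h2.1)
      · exact h21 σ h2
      · exact absurd h1 (h12 σ h2)
    · intro σ h1 h2 h3
      rw [hmem, hno _ _ _ h2, hno _ _ _ h3]
      constructor
      · rintro (h4 | (h4 | h4) | (h4 | h4))
        · exact Or.inl h4.1
        · exact Or.inl (hLK _ (hD₁L _ h4))
        · exact hpart σ h4.1 h4.2
        · exact Or.inl (hLK _ (hD₂L _ h4))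
        · exact hpart σ h4.1 h4.2
      · rintro (h4 | rfl)
        · exact Or.inl ⟨h4, h1⟩
        · exact Or.inr (Or.inl (Or.inr ⟨hTne, subset_rfl⟩))
    · intro σ h1 h2 h3
      rw [hmem, ← hins D₁ x₁ hD₁L hx₁ hxT₁ σ h2]
      constructor
      · rintro (h4 | h4 | h4)
        · exact absurd (Finset.mem_insert_self _ _) (fresh hx₁ _ h4.1)
        · exact h4
        · exact absurd (Finset.mem_insert_self _ _) (h12 _ h4)
      · exact fun h4 => Or.inr (Or.inl h4)
    · intro σ h1 h2 h3
      rw [hmem, ← hins D₂ x₂ hD₂L hx₂.2 hxT₂ σ h3]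
      constructor
      · rintro (h4 | h4 | h4)
        · exact absurd (Finset.mem_insert_self _ _) (fresh hx₂.2 _ h4.1)
        · exact absurd (Finset.mem_insert_self _ _) (h21 _ h4)
        · exact h4
      · exact fun h4 => Or.inr (Or.inr h4)
  have hne : ∀ G, ChangesAcross L T G → triangleHull L G ≠ simplexBoundary T := by
    intro G hG e
    obtain ⟨c, hc⟩ := hTne
    have h1 : ({c} : Finset V) ⊂ T := hsplit.singleton_ssubset hc
    obtain ⟨τ, h2, -, h3⟩ := triangleHull_pure (hG.exists_mem hL hT hTw (by simp) h1)
    rw [e] at h2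
    have := Finset.card_lt_card h2.2
    omega
  refine ⟨K', (hsplit.isPM hK).isNormalPseudomanifold, Or.inr (Or.inr (Or.inl ⟨w, x₁, x₂, T, D₁, D₂,
    hw, fun hh => fresh hx₁ _ hh (by simp), fun hh => fresh hx₂.2 _ hh (by simp), hxne, hT, hTK,
    ?_, ?_, hne G hG, hne _ hG.not, hK'⟩)), hsplit.g2_lt hK.finite⟩
  · ext σ
    exact hD σ
  · ext σ
    exact ⟨fun hh => ⟨face_nonempty hh.1, hG.inter hL hT hh.1 hh.2⟩, fun hh =>
      ⟨hG.exists_mem hL hT hTw hh.1 hh.2, hG.not.exists_mem hL hT hTw hh.1 hh.2⟩⟩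

/-! ### Degrees -/

theorem card_facesOfCard_one {K : PreAbstractSimplicialComplex V} (h : K.faces.Finite) :
    (facesOfCard h 1).card = (exts h ∅).card := by
  rw [← Finset.card_image_of_injective (exts h ∅) Finset.singleton_injective]
  congr 1
  ext σ
  simp only [mem_facesOfCard, Finset.mem_image, mem_exts, Ext, Finset.notMem_empty,
    not_false_eq_true, true_and, insert_empty_eq, Finset.card_eq_one]
  constructor
  · rintro ⟨h1, a, rfl⟩; exact ⟨a, h1, rfl⟩
  · rintro ⟨a, h1, rfl⟩; exact ⟨h1, a, rfl⟩

theorem sum_card_exts {K : PreAbstractSimplicialComplex V} (h : K.faces.Finite) :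
    ∑ u ∈ exts h ∅, (exts h {u}).card = 2 * (facesOfCard h 2).card := by
  rw [Finset.sum_congr rfl fun u _ => (card_filter_mem_edges h u).symm]
  refine (Finset.sum_card_bipartiteAbove_eq_sum_card_bipartiteBelow (s := exts h ∅)
    (t := facesOfCard h 2) (fun u e => u ∈ e)).trans ?_
  rw [Finset.sum_congr rfl (g := fun _ => 2), Finset.sum_const, smul_eq_mul, mul_comm]
  intro e he
  obtain ⟨he, hc⟩ := mem_facesOfCard.mp he
  rw [Finset.bipartiteBelow, ← hc]
  congr 1
  ext u
  rw [Finset.mem_filter, mem_exts, and_iff_right_iff_imp]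
  intro hu
  exact ⟨by simp, face_mono he (by simpa using hu) (by simp)⟩

theorem exts_link_eq {K : PreAbstractSimplicialComplex V} (h : K.faces.Finite) {t : V}
    (h' : (link K {t}).faces.Finite) {σ : Finset V} (ht : t ∉ σ) :
    exts h' σ = exts h (insert t σ) := by
  ext x
  rw [mem_exts, mem_exts, ext_link (by simpa using ht), Finset.union_comm, ← Finset.insert_eq]

/-- The Euler characteristic of the link of `t` in terms of the degrees of the edges at `t`. -/
theorem IsPM.sum_card_exts_pair {K : PreAbstractSimplicialComplex V} (hK : IsPM 3 K) {t : V}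
    (ht : {t} ∈ K.faces) :
    (∑ v ∈ exts hK.finite {t}, (exts hK.finite {t, v}).card : ℕ) =
      6 * ((exts hK.finite {t}).card : ℤ) - 6 * eulerChar (SimplicialPM.link K {t}) := by
  have hL := hK.link ht
  have h1 := hL.eulerChar_eq
  have h2 := hL.three_mul_card
  have h3 := sum_card_exts hL.finite
  have h4 : exts hL.finite ∅ = exts hK.finite {t} := exts_link_eq hK.finite hL.finite (by simp)
  have h5 : ∑ v ∈ exts hK.finite {t}, (exts hL.finite {v}).card =
      ∑ v ∈ exts hK.finite {t}, (exts hK.finite {t, v}).card := by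
    refine Finset.sum_congr rfl fun v hv => ?_
    have := (mem_exts.mp hv).1
    rw [exts_link_eq hK.finite hL.finite (by simpa [eq_comm] using this)]
  rw [h4, h5] at h3
  rw [card_facesOfCard_one, h4] at h1
  rw [h1, h3]
  push_cast
  omega

/-! ### Irreducible pseudomanifolds -/

theorem exists_ext {K : PreAbstractSimplicialComplex V} (hK : IsPM 3 K) {σ : Finset V}
    (hσ : σ ∈ K.faces) (hc : σ.card ≤ 3) : ∃ x, Ext K σ x := by
  obtain ⟨τ, hτ, hs, hc'⟩ := hK.pure σ hσ
  obtain ⟨x, hx, hxσ⟩ := Finset.exists_mem_notMem_of_card_lt_card (show σ.card < τ.card by omega)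
  exact ⟨x, hxσ, face_mono hτ (Finset.insert_subset hx hs) (by simp)⟩

/-- A triple of pairwise adjacent vertices of the link of a non-singular vertex `w` spans a
tetrahedron with `w`: otherwise `K` could be split at `w`, or a tetrahedron would be missing. -/
theorem insert_mem_of_forall_pair [Infinite V] {K : PreAbstractSimplicialComplex V}
    (hK : IsPM 3 K) (hm : NoMissingTetrahedra K) (hr : ¬ IsReducible K) {w : V} {T : Finset V}
    (hw : IsNonsingular K w) (hT : T.card = 3) (hwT : w ∉ T)
    (h : ∀ e ⊆ T, e.card = 2 → insert w e ∈ K.faces) : insert w T ∈ K.faces := by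
  have hTK : T ∈ K.faces := by
    by_contra hTK
    refine hr (isReducible_of_simplexBoundary_le hK hw hT ?_ hTK)
    intro e he hc
    refine mem_link.mpr ⟨Finset.card_pos.mp (by omega), ?_, ?_⟩
    · exact Finset.disjoint_singleton_right.mpr fun hh => hwT (he hh)
    · rw [Finset.union_comm, ← Finset.insert_eq]; exact h e he hc
  refine hm _ (by rw [Finset.card_insert_of_notMem hwT, hT]) ?_
  rintro σ ⟨hn, hσ⟩
  by_cases hwσ : w ∈ σ
  · have hs : σ.erase w ⊆ T := Finset.subset_insert_iff.mp hσ.1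
    have hc := Finset.card_lt_card hσ
    rw [Finset.card_insert_of_notMem hwT, ← Finset.card_erase_add_one hwσ] at hc
    obtain ⟨e, h1, h2, h3⟩ := Finset.exists_subsuperset_card_eq hs
      (show (σ.erase w).card ≤ 2 by omega) (by omega)
    refine face_mono (h e h2 h3) ?_ hn
    rw [← Finset.insert_erase hwσ]
    exact Finset.insert_subset_insert _ h1
  · exact face_mono hTK ((Finset.subset_insert_iff_of_notMem hwσ).mp hσ.1) hn

section Edge

variable {K : PreAbstractSimplicialComplex V} {u v : V}

theorem union_pair_eq (γ : Finset V) : γ ∪ {u, v} = insert u (insert v γ) := by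
  ext x; simp only [Finset.mem_union, Finset.mem_insert, Finset.mem_singleton]; tauto

/-- The link of an edge is a graph in which all vertices have degree two. -/
theorem twoExt_triangle (hK : IsPM 3 K) (huv : u ≠ v) {a : V} (ha : Ext K {u, v} a) :
    TwoExt K (insert a {u, v}) :=
  hK.two _ ha.2 (by rw [Finset.card_insert_of_notMem ha.1, Finset.card_pair huv])

theorem exts_triangle_subset (hK : IsPM 3 K) {a : V} :
    exts hK.finite (insert a {u, v}) ⊆ (exts hK.finite {u, v}).erase a := by
  intro b hb
  obtain ⟨h1, h2⟩ := mem_exts.mp hb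
  rw [Finset.mem_insert, not_or] at h1
  exact Finset.mem_erase.mpr ⟨h1.1, mem_exts.mpr ⟨h1.2, face_mono h2
    (Finset.insert_subset_insert _ (Finset.subset_insert _ _)) (by simp)⟩⟩

theorem three_le_card_exts (hK : IsPM 3 K) (huv : u ≠ v) (he : {u, v} ∈ K.faces) :
    3 ≤ (exts hK.finite {u, v}).card := by
  obtain ⟨a, ha⟩ := exists_ext hK he (by rw [Finset.card_pair huv]; omega)
  have h1 := Finset.card_le_card (exts_triangle_subset hK (u := u) (v := v) (a := a))
  rw [(twoExt_triangle hK huv ha).card_exts, Finset.card_erase_of_mem (mem_exts.mpr ha)] at h1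
  omega

/-- An edge of degree three has the boundary of a triangle as its link. -/
theorem insert_insert_mem_of_ssubset (hK : IsPM 3 K) (huv : u ≠ v)
    (hc : (exts hK.finite {u, v}).card = 3) {γ : Finset V} (hγ : γ ⊂ exts hK.finite {u, v}) :
    insert u (insert v γ) ∈ K.faces := by
  obtain ⟨e, h1, h2, h3⟩ := Finset.exists_subsuperset_card_eq hγ.1
    (show γ.card ≤ 2 by have := Finset.card_lt_card hγ; omega) (by omega)
  obtain ⟨a, b, hab, rfl⟩ := Finset.card_eq_two.mp h3
  have ha := mem_exts.mp (h2 (show a ∈ ({a, b} : Finset V) by simp))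
  have heq := Finset.eq_of_subset_of_card_le (exts_triangle_subset hK (u := u) (v := v) (a := a))
    (by rw [(twoExt_triangle hK huv ha).card_exts, Finset.card_erase_of_mem (mem_exts.mpr ha), hc])
  have hb : b ∈ exts hK.finite (insert a {u, v}) := by
    rw [heq]; exact Finset.mem_erase.mpr ⟨hab.symm, h2 (by simp)⟩
  refine face_mono (mem_exts.mp hb).2 ?_ (by simp)
  intro x hx
  have := @h1 x
  simp only [Finset.mem_insert, Finset.mem_singleton] at hx this ⊢
  tauto

theorem link_eq_simplexBoundary (hK : IsPM 3 K) (huv : u ≠ v)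
    (hc : (exts hK.finite {u, v}).card = 3) :
    link K {u, v} = simplexBoundary (exts hK.finite {u, v}) := by
  ext γ
  constructor
  · rintro ⟨hn, hd, hγ⟩
    have hs : γ ⊆ exts hK.finite {u, v} := by
      intro x hx
      refine mem_exts.mpr ⟨Finset.disjoint_left.mp hd hx, face_mono hγ ?_ (by simp)⟩
      exact Finset.insert_subset (Finset.mem_union_left _ hx) Finset.subset_union_right
    refine ⟨hn, hs.ssubset_of_ne ?_⟩
    rintro rfl
    have := hK.dim _ hγ
    rw [Finset.card_union_of_disjoint hd, hc, Finset.card_pair huv] at this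
    omega
  · rintro ⟨hn, hγ⟩
    refine ⟨hn, ?_, ?_⟩
    · rw [Finset.disjoint_left]
      exact fun x hx => (mem_exts.mp (hγ.1 hx)).1
    · rw [union_pair_eq]; exact insert_insert_mem_of_ssubset hK huv hc hγ

theorem insert_exts_mem (hK : IsPM 3 K) (hm : NoMissingTetrahedra K) (huv : u ≠ v)
    (hc : (exts hK.finite {u, v}).card = 3) (hT : exts hK.finite {u, v} ∈ K.faces) :
    insert u (exts hK.finite {u, v}) ∈ K.faces := by
  have huT : u ∉ exts hK.finite {u, v} := fun hh => (mem_exts.mp hh).1 (by simp)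
  refine hm _ (by rw [Finset.card_insert_of_notMem huT, hc]) ?_
  rintro σ ⟨hn, hσ⟩
  by_cases huσ : u ∈ σ
  · have hs : σ.erase u ⊂ exts hK.finite {u, v} := by
      refine (Finset.subset_insert_iff.mp hσ.1).ssubset_of_ne fun e => ?_
      rw [← e, Finset.insert_erase huσ] at hσ
      exact absurd hσ (irrefl _)
    refine face_mono (insert_insert_mem_of_ssubset hK huv hc hs) ?_ hn
    conv_lhs => rw [← Finset.insert_erase huσ]
    exact Finset.insert_subset_insert _ (Finset.subset_insert _ _)
  · exact face_mono hT ((Finset.subset_insert_iff_of_notMem huσ).mp hσ.1) hn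

/-- If all tetrahedra on a set `Z` of five vertices are faces, then there are no other vertices. -/
theorem subset_of_forall_card_four (hK : IsPM 3 K) {Z : Finset V} (hZ : Z.card = 5)
    (h : ∀ τ ⊆ Z, τ.card = 4 → τ ∈ K.faces) {σ : Finset V} (hσ : σ ∈ K.faces) : σ ⊆ Z := by
  obtain ⟨τ, hτ, hs, hc⟩ := hK.pure σ hσ
  refine hs.trans ?_
  obtain ⟨τ₀, h1, h2⟩ := Finset.exists_subset_card_eq (show 4 ≤ Z.card by omega)
  have hp := hK.isNormalPseudomanifold.strong τ₀ (h _ h1 h2) τ hτ h2 hc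
  clear hσ hs hc hτ
  induction hp with
  | refl => exact h1
  | @tail α β _ hβ ih =>
    obtain ⟨a1, b1, a2, b2, c⟩ := hβ
    obtain ⟨p, q, hpq, hr⟩ := hK.two _ (face_mono a1 Finset.inter_subset_left
      (Finset.card_pos.mp (by omega))) c
    -- both cofaces of the triangle are spanned by it and a vertex of `Z`
    have hsub : Z \ (α ∩ β) ⊆ {p, q} := by
      intro r hr'
      obtain ⟨r1, r2⟩ := Finset.mem_sdiff.mp hr'
      have := (hr r).1 ⟨r2, h _ (Finset.insert_subset r1 (Finset.inter_subset_left.trans ih)) (by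
        rw [Finset.card_insert_of_notMem r2, c])⟩
      simpa using this
    have heq := Finset.eq_of_subset_of_card_le hsub (by
      rw [Finset.card_pair hpq,
        Finset.card_sdiff_of_subset (Finset.inter_subset_left.trans ih)]
      omega)
    intro x hx
    by_cases hxα : x ∈ α
    · exact ih hxα
    · have hxi : x ∉ α ∩ β := fun hh => hxα (Finset.mem_inter.mp hh).1
      have : x ∈ ({p, q} : Finset V) := by
        rw [Finset.mem_insert, Finset.mem_singleton, ← hr]
        exact ⟨hxi, face_mono b1 (Finset.insert_subset hx Finset.inter_subset_right) (by simp)⟩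
      rw [← heq] at this
      exact (Finset.mem_sdiff.mp this).1

/-- If `K` is irreducible and has more than five vertices, then no edge has degree three. -/
theorem four_le_card_exts (hK : IsPM 3 K) (hm : NoMissingTetrahedra K) (hr : ¬ IsReducible K)
    (hlarge : ∀ Z : Finset V, Z.card = 5 → ∃ σ ∈ K.faces, ¬ σ ⊆ Z) (huv : u ≠ v)
    (he : {u, v} ∈ K.faces) : 4 ≤ (exts hK.finite {u, v}).card := by
  by_contra hlt
  have h3 := three_le_card_exts hK huv he
  have hc : (exts hK.finite {u, v}).card = 3 := by omega
  have hT : exts hK.finite {u, v} ∈ K.faces := by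
    by_contra hT
    exact hr (isReducible_of_link_eq_simplexBoundary hK huv he hc
      (link_eq_simplexBoundary hK huv hc) hT)
  have hu := insert_exts_mem hK hm huv hc hT
  have hv : insert v (exts hK.finite {u, v}) ∈ K.faces := by
    have hcomm : exts hK.finite {u, v} = exts hK.finite {v, u} := by rw [Finset.pair_comm]
    rw [hcomm] at hc hT ⊢
    exact insert_exts_mem hK hm huv.symm hc hT
  set T := exts hK.finite {u, v} with hTdef
  have huT : u ∉ T := fun hh => (mem_exts.mp hh).1 (by simp)
  have hvT : v ∉ T := fun hh => (mem_exts.mp hh).1 (by simp)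
  have hZ : (insert u (insert v T)).card = 5 := by
    rw [Finset.card_insert_of_notMem (by simp [huv, huT]), Finset.card_insert_of_notMem hvT, hc]
  obtain ⟨σ, hσ, hn⟩ := hlarge _ hZ
  refine hn (subset_of_forall_card_four hK hZ ?_ hσ)
  intro τ hτ hτc
  have hne : τ.Nonempty := Finset.card_pos.mp (by omega)
  by_cases huτ : u ∈ τ
  · by_cases hvτ : v ∈ τ
    · have hγ : (τ.erase u).erase v ⊂ T := by
        refine Finset.ssubset_iff_subset_ne.mpr ⟨?_, fun e => ?_⟩
        · intro x hx
          have h1 := Finset.mem_erase.mp hx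
          have h2 := Finset.mem_erase.mp h1.2
          have h3 := hτ h2.2
          simp only [Finset.mem_insert] at h3
          tauto
        · have := congrArg Finset.card e
          rw [Finset.card_erase_of_mem (Finset.mem_erase.mpr ⟨huv.symm, hvτ⟩),
            Finset.card_erase_of_mem huτ, hc] at this
          omega
      have := insert_insert_mem_of_ssubset hK huv hc hγ
      rwa [Finset.insert_erase (Finset.mem_erase.mpr ⟨huv.symm, hvτ⟩), Finset.insert_erase huτ]
        at this
    · rw [Finset.insert_comm] at hτ
      exact face_mono hu ((Finset.subset_insert_iff_of_notMem hvτ).mp hτ) hne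
  · exact face_mono hv ((Finset.subset_insert_iff_of_notMem huτ).mp hτ) hne

/-- Every edge with a non-singular end `u` lies in a missing triangle: otherwise the edge satisfies
the link condition and can be contracted. -/
theorem exists_missing_triangle [Infinite V] (hK : IsPM 3 K) (hm : NoMissingTetrahedra K)
    (hr : ¬ IsReducible K) (huv : u ≠ v) (he : {u, v} ∈ K.faces) (hu : IsNonsingular K u)
    (hd : 4 ≤ (exts hK.finite {u, v}).card) :
    ∃ w, Ext K {u} w ∧ Ext K {v} w ∧ ¬ Ext K {u, v} w := by
  by_contra! hno
  have one : ∀ x, Ext K {u} x → Ext K {v} x → insert u (insert v {x}) ∈ K.faces := by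
    intro x h1 h2
    exact face_congr (hno x h1 h2).2 (by
      ext z; simp only [Finset.mem_insert, Finset.mem_singleton]; tauto)
  have ext_of : ∀ {γ : Finset V} {a x : V}, x ∈ γ → a ∉ γ → insert a γ ∈ K.faces →
      Ext K {a} x := by
    intro γ a x hx ha h
    refine ⟨?_, face_mono h ?_ (by simp)⟩
    · rw [Finset.mem_singleton]; rintro rfl; exact ha hx
    · intro z; simp only [Finset.mem_insert, Finset.mem_singleton]
      rintro (rfl | rfl)
      · exact Or.inr hx
      · exact Or.inl rfl
  have two : ∀ γ : Finset V, γ.card = 2 → u ∉ γ → v ∉ γ → insert u γ ∈ K.faces →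
      insert v γ ∈ K.faces → insert u (insert v γ) ∈ K.faces := by
    intro γ hc h1 h2 h3 h4
    refine hm _ ?_ ?_
    · rw [Finset.card_insert_of_notMem (by simp [huv, h1]), Finset.card_insert_of_notMem h2, hc]
    · rintro σ ⟨hn, hσ⟩
      by_cases huσ : u ∈ σ
      · by_cases hvσ : v ∈ σ
        · have hv' : v ∈ σ.erase u := Finset.mem_erase.mpr ⟨huv.symm, hvσ⟩
          have hs : (σ.erase u).erase v ⊆ γ :=
            Finset.subset_insert_iff.mp (Finset.subset_insert_iff.mp hσ.1)
          have hcard := Finset.card_lt_card hσ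
          rw [Finset.card_insert_of_notMem (by simp [huv, h1]), Finset.card_insert_of_notMem h2,
            hc, ← Finset.card_erase_add_one huσ, ← Finset.card_erase_add_one hv'] at hcard
          have heq : insert u (insert v ((σ.erase u).erase v)) = σ := by
            rw [Finset.insert_erase hv', Finset.insert_erase huσ]
          rw [← heq]
          rcases Finset.eq_empty_or_nonempty ((σ.erase u).erase v) with h0 | ⟨x, hx⟩
          · rw [h0]; exact he
          · have hx1 : (σ.erase u).erase v = {x} :=
              Finset.eq_singleton_iff_unique_mem.mpr ⟨hx, fun y hy =>
                Finset.card_le_one.mp (by omega) _ hy _ hx⟩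
            rw [hx1]
            exact one x (ext_of (hs hx) h1 h3) (ext_of (hs hx) h2 h4)
        · refine face_mono h3 ?_ hn
          have hσ' := hσ.1
          rw [Finset.insert_comm] at hσ'
          exact (Finset.subset_insert_iff_of_notMem hvσ).mp hσ'
      · exact face_mono h4 ((Finset.subset_insert_iff_of_notMem huσ).mp hσ.1) hn
  -- three common neighbours that span a triangle of both links would be the whole link of `uv`
  have three : ∀ γ : Finset V, γ.card = 3 → u ∉ γ → v ∉ γ → insert u γ ∈ K.faces →
      insert v γ ∈ K.faces → False := by
    intro γ hc h1 h2 h3 h4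
    have hpair : ∀ a ∈ γ, ∀ b ∈ γ, a ≠ b → Ext K (insert a {u, v}) b := by
      intro a ha b hb hab
      have hs : ({a, b} : Finset V) ⊆ γ := by
        rw [Finset.insert_subset_iff, Finset.singleton_subset_iff]; exact ⟨ha, hb⟩
      have := two {a, b} (Finset.card_pair hab) (fun hh => h1 (hs hh)) (fun hh => h2 (hs hh))
        (face_mono h3 (Finset.insert_subset_insert _ hs) (by simp))
        (face_mono h4 (Finset.insert_subset_insert _ hs) (by simp))
      refine ⟨?_, face_congr this ?_⟩
      · simp only [Finset.mem_insert, Finset.mem_singleton, not_or]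
        refine ⟨hab.symm, ?_, ?_⟩
        · rintro rfl; exact h1 hb
        · rintro rfl; exact h2 hb
      · ext z; simp only [Finset.mem_insert, Finset.mem_singleton]; tauto
    have hγX : ∀ a ∈ γ, Ext K {u, v} a := by
      intro a ha
      exact hno a (ext_of ha h1 h3) (ext_of ha h2 h4)
    have hclosed : ∀ a ∈ γ, ∀ b, LinkAdj K {u, v} a b → b ∈ γ := by
      intro a ha b hab
      by_cases hba : b = a
      · rwa [hba]
      have hsub : γ.erase a ⊆ exts hK.finite (insert a {u, v}) := by
        intro x hx
        obtain ⟨h5, h6⟩ := Finset.mem_erase.mp hx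
        exact mem_exts.mpr (hpair a ha x h6 h5.symm)
      have heq := Finset.eq_of_subset_of_card_le hsub (by
        rw [(twoExt_triangle hK huv (hγX a ha)).card_exts, Finset.card_erase_of_mem ha, hc])
      have hb : b ∈ exts hK.finite (insert a {u, v}) := by
        refine mem_exts.mpr ⟨?_, ?_⟩
        · rw [Finset.mem_insert, not_or]; exact ⟨hba, hab.2.1⟩
        · rw [Finset.insert_comm]; exact hab.2.2
      rw [← heq] at hb
      exact Finset.mem_of_mem_erase hb
    obtain ⟨a, ha⟩ := Finset.card_pos.mp (show 0 < γ.card by omega)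
    have hall : exts hK.finite {u, v} ⊆ γ := by
      intro x hx
      have hp := hK.conn {u, v} (Or.inr he) (by rw [Finset.card_pair huv]) a x (hγX a ha)
        (mem_exts.mp hx)
      clear hx
      induction hp with
      | refl => exact ha
      | tail _ hbc ih => exact hclosed _ ih _ hbc
    have := Finset.card_le_card hall
    omega
  refine hr (isReducible_of_link_inf_link hK huv.symm (by rwa [Finset.pair_comm]) hu ?_
    (by rwa [Finset.pair_comm]))
  ext γ
  constructor
  · rintro ⟨⟨hn, h1, h2⟩, ⟨-, h3, h4⟩⟩
    rw [Finset.disjoint_singleton_right] at h1 h3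
    rw [Finset.union_comm, ← Finset.insert_eq] at h2 h4
    refine ⟨hn, ?_, ?_⟩
    · rw [Finset.disjoint_left]
      intro x hx
      simp only [Finset.mem_insert, Finset.mem_singleton, not_or]
      exact ⟨fun e => h1 (e ▸ hx), fun e => h3 (e ▸ hx)⟩
    · rw [union_pair_eq, Finset.insert_comm]
      have hdim := hK.dim _ h2
      rw [Finset.card_insert_of_notMem h1] at hdim
      have hpos := Finset.card_pos.mpr hn
      have : γ.card = 1 ∨ γ.card = 2 ∨ γ.card = 3 := by omega
      rcases this with hc | hc | hc
      · obtain ⟨x, rfl⟩ := Finset.card_eq_one.mp hc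
        exact one x (ext_of (by simp) h3 h4) (ext_of (by simp) h1 h2)
      · exact two γ hc h3 h1 h4 h2
      · exact (three γ hc h3 h1 h4 h2).elim
  · rintro ⟨hn, hd, hγ⟩
    have hvu : ({v} : Finset V) ⊆ {v, u} := by simp
    have huu : ({u} : Finset V) ⊆ {v, u} := by simp
    exact ⟨⟨hn, Finset.disjoint_of_subset_right hvu hd,
      face_mono hγ (Finset.union_subset_union_right hvu) (hn.mono Finset.subset_union_left)⟩,
      ⟨hn, Finset.disjoint_of_subset_right huu hd,
      face_mono hγ (Finset.union_subset_union_right huu) (hn.mono Finset.subset_union_left)⟩⟩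

end Edge

/-! ### Counting edges -/

/-- What the count needs to know about an irreducible complex with the singular vertex `t`: `N u` is
the set of neighbours of `u`, `E u v` is the set of vertices of the link of the edge `uv`, and `O`
is the set of vertices that are neither `t` nor neighbours of `t`. -/
structure LinkSystem (N : V → Finset V) (E : V → V → Finset V) (t : V) (O : Finset V) : Prop where
  irrefl : ∀ u, u ∉ N u
  symm : ∀ {u v}, v ∈ N u → u ∈ N v
  comm : ∀ u v, E u v = E v u
  mem : ∀ {u v w}, v ∈ N u → w ∈ E u v → w ∈ N u
  rotate : ∀ {u v w}, v ∈ N u → w ∈ E u v → v ∈ E u w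
  /-- edges have degree at least four -/
  four_le : ∀ {u v}, v ∈ N u → 4 ≤ (E u v).card
  /-- edges lie in missing triangles -/
  missing : ∀ {u v}, v ∈ N u → u ≠ t → ∃ w ∈ N u, w ∈ N v ∧ w ∉ E u v
  /-- circuits of length three in the link of a vertex other than `t` bound a triangle -/
  fill : ∀ {x u v w}, x ≠ t → u ∈ N x → v ∈ E x u → w ∈ E x u → w ∈ E x v → w ∈ E u v
  /-- two adjacent vertices of the link of `v ≠ t` have at most two common neighbours there -/
  two : ∀ {v a b}, v ≠ t → a ∈ N v → b ∈ E v a → (E v a ∩ E v b).card ≤ 2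
  outside : ∀ {u}, u ∈ O → u ≠ t ∧ u ∉ N t
  cover : ∀ {u v}, v ∈ N u → v = t ∨ v ∈ N t ∨ v ∈ O

namespace LinkSystem

variable {N : V → Finset V} {E : V → V → Finset V} {t : V} {O : Finset V}

theorem mem_right (h : LinkSystem N E t O) {u v w : V} (hv : v ∈ N u) (hw : w ∈ E u v) :
    w ∈ N v :=
  h.mem (h.symm hv) (h.comm u v ▸ hw)

theorem rotate' (h : LinkSystem N E t O) {u v w : V} (hv : v ∈ N u) (hw : w ∈ E u v) :
    v ∈ E w u :=
  h.comm u w ▸ h.rotate hv hw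

theorem ne (h : LinkSystem N E t O) {u v : V} (hv : v ∈ N u) : v ≠ u := by
  rintro rfl
  exact h.irrefl _ hv

theorem notMem_self (h : LinkSystem N E t O) {u v : V} (hv : v ∈ N u) : u ∉ E u v ∧ v ∉ E u v :=
  ⟨fun hh => h.irrefl _ (h.mem hv hh), fun hh => h.irrefl _ (h.mem_right hv hh)⟩

/-! ### Vertices away from the singular vertex -/

theorem notMem_of_mem_inter (h : LinkSystem N E t O) {u v w x : V} (hu : u ∈ O) (hv : v ∈ N u)
    (hw : w ∈ N u) (hwv : w ∈ N v) (hn : w ∉ E u v) (h1 : x ∈ E u v) (h2 : x ∈ E v w) :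
    x ∉ E u w := by
  intro h3
  have hxu := h.mem hv h1
  have hxt : x ≠ t := by
    rintro rfl
    exact (h.outside hu).2 (h.symm hxu)
  exact hn (h.fill hxt (h.symm hxu) (h.rotate' hv h1) (h.rotate' hw h3) (h.rotate' hwv h2))

/-- For a missing triangle `uvw`, the links of `uw` and `uv` supply the neighbours of `u`, and those
of `uv` and `vw` the neighbours of `v`. No vertex lies in the links of all three edges, so that the
overlap of the latter two links is paid for by `u`. -/
theorem six_le_card (h : LinkSystem N E t O) {u v : V} (hu : u ∈ O) (hv : v ∈ N u) :
    6 ≤ (N u).card ∧ 16 ≤ (N u).card + (N v).card := by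
  obtain ⟨w, hw, hwv, hn⟩ := h.missing hv (h.outside hu).1
  have hn' : v ∉ E u w := fun hh => hn (h.rotate hw hh)
  have hn'' : u ∉ E v w := fun hh => hn (h.comm u v ▸ h.rotate hwv hh)
  have c1 := h.four_le hv
  have c2 := h.four_le hw
  have c3 := h.four_le hwv
  have hwne := h.ne hwv
  have n1 := h.notMem_self hv
  have n2 := h.notMem_self hw
  have n3 := h.notMem_self hwv
  have s1 : insert v (insert w (E u w ∪ (E u v ∩ E v w))) ⊆ N u := by
    intro x hx
    simp only [Finset.mem_insert, Finset.mem_union, Finset.mem_inter] at hx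
    rcases hx with rfl | rfl | hx | hx
    · exact hv
    · exact hw
    · exact h.mem hw hx
    · exact h.mem hv hx.1
  have d1 : Disjoint (E u w) (E u v ∩ E v w) := by
    rw [Finset.disjoint_right]
    intro x hx
    rw [Finset.mem_inter] at hx
    exact h.notMem_of_mem_inter hu hv hw hwv hn hx.1 hx.2
  have s2 : insert u (insert w (E u v ∪ E v w)) ⊆ N v := by
    intro x hx
    simp only [Finset.mem_insert, Finset.mem_union] at hx
    rcases hx with rfl | rfl | hx | hx
    · exact h.symm hv
    · exact hwv
    · exact h.mem_right hv hx
    · exact h.mem hwv hx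
  have k1 := Finset.card_le_card s1
  have k2 := Finset.card_le_card s2
  rw [Finset.card_insert_of_notMem, Finset.card_insert_of_notMem,
    Finset.card_union_of_disjoint d1] at k1
  · rw [Finset.card_insert_of_notMem, Finset.card_insert_of_notMem] at k2
    · have := Finset.card_union_add_card_inter (E u v) (E v w)
      omega
    · simp only [Finset.mem_union, not_or]
      exact ⟨hn, n3.2⟩
    · simp only [Finset.mem_insert, Finset.mem_union, not_or]
      exact ⟨(h.ne hw).symm, n1.1, hn''⟩
  · simp only [Finset.mem_union, Finset.mem_inter, not_or]
    exact ⟨n2.2, fun hh => hn hh.1⟩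
  · simp only [Finset.mem_insert, Finset.mem_union, Finset.mem_inter, not_or]
    exact ⟨hwne.symm, hn', fun hh => n1.2 hh.1⟩

/-- A neighbour of a vertex of degree less than eight has at least five neighbours of larger
degree. -/
theorem card_filter_add_five_le (h : LinkSystem N E t O) {u v : V} (hu : u ∈ O) (hv : v ∈ N u)
    (hd : (N u).card < 8) : ((N v ∩ O).filter fun x => (N x).card < 8).card + 5 ≤ (N v).card := by
  obtain ⟨w, hw, hwv, hn⟩ := h.missing hv (h.outside hu).1
  -- the common neighbours of `u` and `v` are neighbours of `u` and hence of large degree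
  have s : insert w (E u v) ⊆ N v \ ((N v ∩ O).filter fun x => (N x).card < 8) := by
    intro x hx
    have hx' : x ∈ N u ∧ x ∈ N v := by
      rcases Finset.mem_insert.mp hx with rfl | hx
      · exact ⟨hw, hwv⟩
      · exact ⟨h.mem hv hx, h.mem_right hv hx⟩
    refine Finset.mem_sdiff.mpr ⟨hx'.2, fun hh => ?_⟩
    have h1 := (Finset.mem_filter.mp hh).2
    have h2 := (h.six_le_card hu hx'.1).2
    omega
  have k := Finset.card_le_card s
  have hsub : ((N v ∩ O).filter fun x => (N x).card < 8) ⊆ N v :=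
    (Finset.filter_subset _ _).trans Finset.inter_subset_left
  have := h.four_le hv
  have := Finset.card_le_card hsub
  rw [Finset.card_insert_of_notMem hn, Finset.card_sdiff_of_subset hsub] at k
  omega

theorem card_eq_of_mem_outside (h : LinkSystem N E t O) {u : V} (hu : u ∈ O) :
    (N u).card = (N u ∩ N t).card + (N u ∩ O).card := by
  rw [← Finset.card_union_of_disjoint]
  · congr 1
    ext x
    simp only [Finset.mem_union, Finset.mem_inter]
    constructor
    · intro hx
      rcases h.cover hx with rfl | hx' | hx'
      · exact absurd (h.symm hx) (h.outside hu).2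
      · exact Or.inl ⟨hx, hx'⟩
      · exact Or.inr ⟨hx, hx'⟩
    · rintro (hx | hx) <;> exact hx.1
  · rw [Finset.disjoint_left]
    intro x hx hx'
    exact (h.outside (Finset.mem_inter.mp hx').2).2 (Finset.mem_inter.mp hx).2

/-- The local form of the discharging argument: a vertex `u` of degree `d < 8` receives `8 - d` from
each of its neighbours in `O`, all of which have degree greater than eight, and these can afford
it. -/
theorem sum_deficiency_le (h : LinkSystem N E t O) {u : V} (hu : u ∈ O) (hne : (N u).Nonempty) :
    ∑ x ∈ N u ∩ O, (8 - (N x).card) + 48 ≤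
      2 * (N u ∩ N t).card + 6 * (N u).card + (N u ∩ O).card * (8 - (N u).card) := by
  have hcard := h.card_eq_of_mem_outside hu
  by_cases hd : (N u).card < 8
  · obtain ⟨v, hv⟩ := hne
    have h6 := (h.six_le_card hu hv).1
    have hz : ∑ x ∈ N u ∩ O, (8 - (N x).card) = 0 := by
      refine Finset.sum_eq_zero fun x hx => ?_
      have := (h.six_le_card hu (Finset.mem_inter.mp hx).1).2
      omega
    rw [hz]
    have : (N u).card = 6 ∨ (N u).card = 7 := by omega
    rcases this with h1 | h1 <;> rw [h1] at hcard ⊢ <;> omega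
  · have hsum : ∀ m, (∀ x ∈ N u ∩ O, 8 - (N x).card ≤ m) →
        ∑ x ∈ N u ∩ O, (8 - (N x).card) ≤
          ((N u ∩ O).filter fun x => (N x).card < 8).card * m := by
      intro m hm
      rw [← Finset.sum_filter_of_ne (p := fun x => (N x).card < 8)]
      · rw [← smul_eq_mul]
        exact Finset.sum_le_card_nsmul _ _ _ fun x hx => hm x (Finset.mem_filter.mp hx).1
      · intro x _ hx
        omega
    by_cases hbad : ∃ x ∈ N u ∩ O, (N x).card < 8
    · obtain ⟨x, hx, hxd⟩ := hbad
      rw [Finset.mem_inter] at hx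
      have h5 := h.card_filter_add_five_le hx.2 (h.symm hx.1) hxd
      have h9 := (h.six_le_card hx.2 (h.symm hx.1)).2
      by_cases h6 : ∃ y ∈ N u ∩ O, (N y).card ≤ 6
      · obtain ⟨y, hy, hyd⟩ := h6
        rw [Finset.mem_inter] at hy
        have h10 := (h.six_le_card hy.2 (h.symm hy.1)).2
        have := hsum 2 fun z hz => by
          rw [Finset.mem_inter] at hz
          have := (h.six_le_card hz.2 (h.symm hz.1)).1
          omega
        omega
      · push Not at h6
        have := hsum 1 fun z hz => by have := h6 z hz; omega
        omega
    · push Not at hbad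
      have := hsum 0 fun z hz => by have := hbad z hz; omega
      omega

theorem sum_card_inter_comm (h : LinkSystem N E t O) (f : V → ℕ) (A B : Finset V) :
    ∑ u ∈ A, ∑ x ∈ N u ∩ B, f x = ∑ x ∈ B, (N x ∩ A).card * f x := by
  rw [Finset.sum_comm' (t' := B) (s' := fun x => N x ∩ A)]
  · simp
  · intro u x
    simp only [Finset.mem_inter]
    constructor
    · rintro ⟨h1, h2, h3⟩; exact ⟨⟨h.symm h2, h1⟩, h3⟩
    · rintro ⟨⟨h1, h2⟩, h3⟩; exact ⟨h2, h.symm h1, h3⟩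

/-- The vertices of `O` of degree less than eight are compensated by the edges between `O` and the
neighbours of `t`. -/
theorem card_outside_le (h : LinkSystem N E t O) (hne : ∀ u ∈ O, (N u).Nonempty) :
    48 * O.card ≤ 2 * ∑ v ∈ N t, (N v ∩ O).card + 6 * ∑ u ∈ O, (N u).card := by
  have h1 := Finset.sum_le_sum fun u hu => h.sum_deficiency_le hu (hne u hu)
  have h2 := h.sum_card_inter_comm (fun x => 8 - (N x).card) O O
  have h3 := h.sum_card_inter_comm (fun _ => 1) (N t) O
  simp only [Finset.sum_const, smul_eq_mul, mul_one] at h3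
  simp only [Finset.sum_add_distrib, ← Finset.mul_sum, Finset.sum_const, smul_eq_mul] at h1
  rw [h2] at h1
  rw [h3]
  omega

/-! ### Neighbours of the singular vertex -/

variable (N E t) in
/-- The vertices joined to `v` by a chord: an edge between neighbours of `t` that does not form a
triangle with `t`. -/
def chords (v : V) : Finset V :=
  (N v ∩ N t) \ E t v

theorem mem_chords {v w : V} : w ∈ chords N E t v ↔ w ∈ N v ∧ w ∈ N t ∧ w ∉ E t v := by
  rw [chords, Finset.mem_sdiff, Finset.mem_inter, and_assoc]

theorem chords_symm (h : LinkSystem N E t O) {v w : V} (hv : v ∈ N t)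
    (hw : w ∈ chords N E t v) : v ∈ chords N E t w := by
  rw [mem_chords] at hw ⊢
  exact ⟨h.symm hw.1, hv, fun hh => hw.2.2 (h.rotate hw.2.1 hh)⟩

theorem one_le_card_chords (h : LinkSystem N E t O) {v : V} (hv : v ∈ N t) :
    1 ≤ (chords N E t v).card := by
  obtain ⟨w, h1, h2, h3⟩ := h.missing (h.symm hv) (h.ne hv)
  exact Finset.card_pos.mpr ⟨w, mem_chords.mpr ⟨h1, h2, h.comm v t ▸ h3⟩⟩

theorem card_add_card_chords (h : LinkSystem N E t O) {v : V} (hv : v ∈ N t) :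
    (E t v).card + (chords N E t v).card = (N v ∩ N t).card := by
  have hs : E t v ⊆ N v ∩ N t := fun x hx =>
    Finset.mem_inter.mpr ⟨h.mem_right hv hx, h.mem hv hx⟩
  have := Finset.card_le_card hs
  rw [chords, Finset.card_sdiff_of_subset hs]
  omega

theorem card_eq_of_mem (h : LinkSystem N E t O) {v : V} (hv : v ∈ N t) :
    (N v).card = 1 + (E t v).card + (chords N E t v).card + (N v ∩ O).card := by
  have e : N v = insert t ((N v ∩ N t) ∪ (N v ∩ O)) := by
    ext x
    simp only [Finset.mem_insert, Finset.mem_union, Finset.mem_inter]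
    constructor
    · intro hx
      rcases h.cover hx with hx' | hx' | hx'
      · exact Or.inl hx'
      · exact Or.inr (Or.inl ⟨hx, hx'⟩)
      · exact Or.inr (Or.inr ⟨hx, hx'⟩)
    · rintro (rfl | hx | hx)
      · exact h.symm hv
      · exact hx.1
      · exact hx.1
  have d : Disjoint (N v ∩ N t) (N v ∩ O) := by
    rw [Finset.disjoint_left]
    intro x hx hx'
    exact (h.outside (Finset.mem_inter.mp hx').2).2 (Finset.mem_inter.mp hx).2
  have ht : t ∉ (N v ∩ N t) ∪ (N v ∩ O) := by
    simp only [Finset.mem_union, Finset.mem_inter, not_or]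
    exact ⟨fun hh => h.irrefl t hh.2, fun hh => (h.outside hh.2).1 rfl⟩
  have h1 := h.card_add_card_chords hv
  have h2 := congrArg Finset.card e
  rw [Finset.card_insert_of_notMem ht, Finset.card_union_of_disjoint d] at h2
  omega

theorem card_inter_add_one_le (h : LinkSystem N E t O) {v : V} (hv : v ∈ N t) :
    (N v ∩ N t).card + 1 ≤ (N t).card := by
  have hs : insert v (N v ∩ N t) ⊆ N t :=
    Finset.insert_subset hv Finset.inter_subset_right
  have := Finset.card_le_card hs
  rwa [Finset.card_insert_of_notMem fun hh => h.irrefl v (Finset.mem_inter.mp hh).1] at this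

/-- A vertex of the link of a chord `vw` is joined to `v` or to `w` by a chord, unless it lies
outside: the circuit `tvw` of its link does not bound. -/
theorem chord_link_subset (h : LinkSystem N E t O) {v w : V} (hv : v ∈ N t)
    (hw : w ∈ chords N E t v) : E v w ⊆
      (N v ∩ O) ∪ ((chords N E t v).erase w ∪ (chords N E t w).erase v) := by
  obtain ⟨h1, h2, h3⟩ := mem_chords.mp hw
  intro x hx
  have hxv := h.mem h1 hx
  have hxw := h.mem_right h1 hx
  have hxt : x ≠ t := by
    rintro rfl
    exact h3 (h.comm v x ▸ h.rotate h1 hx)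
  simp only [Finset.mem_union, Finset.mem_inter, Finset.mem_erase, mem_chords]
  rcases h.cover hxv with h4 | h4 | h4
  · exact absurd h4 hxt
  · refine Or.inr ?_
    by_cases h5 : x ∈ E t v
    · by_cases h6 : x ∈ E t w
      · exact absurd (h.fill hxt (h.symm h4) (h.rotate' hv h5) (h.rotate' h2 h6)
          (h.rotate' h1 hx)) h3
      · exact Or.inr ⟨h.ne hxv, hxw, h4, h6⟩
    · exact Or.inl ⟨h.ne hxw, hxv, h4, h5⟩
  · exact Or.inl ⟨hxv, h4⟩

theorem six_le_of_chord (h : LinkSystem N E t O) {v w : V} (hv : v ∈ N t)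
    (hw : w ∈ chords N E t v) :
    6 ≤ (N v ∩ O).card + (chords N E t v).card + (chords N E t w).card := by
  have h1 := Finset.card_le_card (h.chord_link_subset hv hw)
  have h2 := h.four_le (mem_chords.mp hw).1
  have h3 := Finset.card_union_le (N v ∩ O)
    ((chords N E t v).erase w ∪ (chords N E t w).erase v)
  have h4 := Finset.card_union_le ((chords N E t v).erase w) ((chords N E t w).erase v)
  have h5 := h.chords_symm hv hw
  rw [Finset.card_erase_of_mem hw, Finset.card_erase_of_mem h5] at h4
  have h6 := Finset.card_pos.mpr ⟨_, hw⟩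
  have h7 := Finset.card_pos.mpr ⟨_, h5⟩
  omega

/-! ### Neighbours of the singular vertex with a single further edge -/

variable (N E t O) in
/-- All edges at `v` but one lie in the star of `t`, and the remaining one is the chord `vw`. -/
def IsPendant (v w : V) : Prop :=
  v ∈ N t ∧ chords N E t v = {w} ∧ N v ∩ O = ∅

/-- The link of a pendant vertex is the suspension with apices `t` and `w` of a circuit. -/
theorem IsPendant.mem_of_mem {v w x : V} (hp : IsPendant N E t O v w) (h : LinkSystem N E t O)
    (hx : x ∈ E t v) : x ∈ E v w ∧ x ∈ chords N E t w := by
  obtain ⟨hv, hc, ho⟩ := hp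
  have hw : w ∈ chords N E t v := by rw [hc]; simp
  have hvt := h.ne hv
  have hxv := h.mem_right hv hx
  have hx' : x ∈ E v t := h.comm t v ▸ hx
  -- otherwise the link of `vx` has two vertices besides `t` and its neighbours in this link
  have key : w ∈ E v x := by
    by_contra hn
    have hs : (E v x).erase t ⊆ E v t ∩ E v x := by
      intro y hy
      obtain ⟨hyt, hyx⟩ := Finset.mem_erase.mp hy
      refine Finset.mem_inter.mpr ⟨?_, hyx⟩
      have hyv := h.mem hxv hyx
      rw [h.comm v t]
      by_contra hyE
      rcases h.cover hyv with h1 | h1 | h1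
      · exact hyt h1
      · have : y ∈ chords N E t v := mem_chords.mpr ⟨hyv, h1, hyE⟩
        rw [hc, Finset.mem_singleton] at this
        exact hn (this ▸ hyx)
      · have : y ∈ N v ∩ O := Finset.mem_inter.mpr ⟨hyv, h1⟩
        rw [ho] at this
        simp at this
    have h1 := Finset.card_le_card hs
    have h2 := h.two hvt (h.symm hv) hx'
    have h3 := h.four_le hxv
    have h4 := Finset.pred_card_le_card_erase (s := E v x) (a := t)
    omega
  have hxw : x ∈ E v w := h.rotate hxv key
  refine ⟨hxw, ?_⟩
  have := h.chord_link_subset hv hw hxw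
  rw [ho, hc] at this
  simp only [Finset.erase_singleton, Finset.empty_union] at this
  exact Finset.mem_of_mem_erase this

theorem IsPendant.insert_subset {v w : V} (hp : IsPendant N E t O v w) (h : LinkSystem N E t O) :
    insert v (E t v) ⊆ chords N E t w := by
  refine Finset.insert_subset (h.chords_symm hp.1 ?_) fun x hx => (hp.mem_of_mem h hx).2
  rw [hp.2.1]; simp

/-- If only five chords end at `w`, then the chord `vw` is the only one that makes an end
pendant. -/
theorem IsPendant.not_of_mem {v w w' x : V} (hp : IsPendant N E t O v w) (h : LinkSystem N E t O)
    (hc : (chords N E t w).card ≤ 5) (hx : x ∈ E t v) : ¬ IsPendant N E t O x w' := by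
  intro hp'
  have hv := hp.1
  have hxt := hp'.1
  have hxw := (hp.mem_of_mem h hx).2
  have hw : w ∈ N t := (mem_chords.mp (show w ∈ chords N E t v by rw [hp.2.1]; simp)).2.1
  have hww : w = w' := by
    have := h.chords_symm hw hxw
    rwa [hp'.2.1, Finset.mem_singleton] at this
  subst hww
  have eq : ∀ {y}, IsPendant N E t O y w → insert y (E t y) = chords N E t w := by
    intro y hy
    refine Finset.eq_of_subset_of_card_le (hy.insert_subset h) ?_
    rw [Finset.card_insert_of_notMem (h.notMem_self hy.1).2]
    have := h.four_le hy.1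
    omega
  have hwv : w ∈ N v := (mem_chords.mp (show w ∈ chords N E t v by rw [hp.2.1]; simp)).1
  have hwx : w ∈ N x := (mem_chords.mp (show w ∈ chords N E t x by rw [hp'.2.1]; simp)).1
  -- if `xw` were the only chord at `x` as well, all vertices of the link of `tv` other than `x`
  -- would be adjacent to `x` in that link
  have hs : (E t v).erase x ⊆ E v t ∩ E v x := by
    intro y hy
    obtain ⟨hyx, hyE⟩ := Finset.mem_erase.mp hy
    refine Finset.mem_inter.mpr ⟨h.comm t v ▸ hyE, ?_⟩
    have hyx' : y ∈ E t x := by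
      have : y ∈ insert x (E t x) := by
        rw [eq hp', ← eq hp]; exact Finset.mem_insert_of_mem hyE
      exact (Finset.mem_insert.mp this).resolve_left hyx
    have a1 := (hp.mem_of_mem h hx).1
    have a2 := (hp.mem_of_mem h hyE).1
    have a3 := (hp'.mem_of_mem h hyx').1
    refine h.fill (h.ne hw) (h.symm hwv) ?_ ?_ ?_
    · rwa [h.comm w v]
    · rwa [h.comm w v]
    · rwa [h.comm w x]
  have h1 := Finset.card_le_card hs
  have h2 := h.two (h.ne hv) (h.symm hv) (h.comm t v ▸ hx)
  have h3 := h.four_le hv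
  rw [Finset.card_erase_of_mem hx] at h1
  omega

/-! ### The weights of the neighbours of the singular vertex -/

variable (N E t O) in
/-- The weight of a neighbour of `t` in the final count. -/
def weight (v : V) : ℕ :=
  3 * (chords N E t v).card + 2 * (N v ∩ O).card

theorem le_sum_of_forall_le {A S : Finset V} {f : V → ℕ} {b c d : ℕ} {w w' : V} (hS : S ⊆ A)
    (hw : w ∈ A) (hw' : w' ∈ A) (hf : ∀ v ∈ A, b + (if v = w then c else 0) +
      (if v = w' then d else 0) + (if v ∈ S then 2 else 0) ≤ f v) :
    A.card * b + c + d + 2 * S.card ≤ ∑ v ∈ A, f v := by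
  refine le_trans (le_of_eq ?_) (Finset.sum_le_sum hf)
  rw [Finset.sum_add_distrib, Finset.sum_add_distrib, Finset.sum_add_distrib, Finset.sum_const,
    Finset.sum_ite_eq', Finset.sum_ite_eq', Finset.sum_ite_mem, Finset.inter_eq_right.mpr hS,
    Finset.sum_const, if_pos hw, if_pos hw', smul_eq_mul, smul_eq_mul]
  ring

theorem three_le_weight (h : LinkSystem N E t O) {v : V} (hv : v ∈ N t) :
    3 ≤ weight N E t O v := by
  have := h.one_le_card_chords hv
  rw [weight]
  omega

theorem five_le_weight (h : LinkSystem N E t O) {v : V} (hv : v ∈ N t)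
    (hp : ∀ w, ¬ IsPendant N E t O v w) : 5 ≤ weight N E t O v := by
  have := h.one_le_card_chords hv
  rw [weight]
  by_contra hlt
  obtain ⟨w, hw⟩ := Finset.card_eq_one.mp (show (chords N E t v).card = 1 by omega)
  exact hp w ⟨hv, hw, Finset.card_eq_zero.mp (by omega)⟩

theorem IsPendant.five_le_card_chords {v w : V} (hp : IsPendant N E t O v w)
    (h : LinkSystem N E t O) :
    5 ≤ (chords N E t w).card ∧ w ∈ N t := by
  have hw : w ∈ chords N E t v := by rw [hp.2.1]; simp
  have := h.six_le_of_chord hp.1 hw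
  rw [hp.2.1, hp.2.2] at this
  simp only [Finset.card_empty, Finset.card_singleton] at this
  exact ⟨by omega, (mem_chords.mp hw).2.1⟩

theorem sum_weight_of_pendant (h : LinkSystem N E t O) {v w : V}
    (hp : IsPendant N E t O v w) : 55 ≤ ∑ x ∈ N t, weight N E t O x := by
  obtain ⟨h5, hw⟩ := hp.five_le_card_chords h
  have hv := hp.1
  have hE := h.four_le hv
  have hEw := h.four_le hw
  set S := chords N E t w with hS
  have hSw : w ∉ S := fun hh => h.irrefl w (mem_chords.mp hh).1
  have hYw : w ∉ E t w := (h.notMem_self hw).2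
  have hYS : Disjoint S (E t w) := by
    rw [Finset.disjoint_left]
    exact fun x hx => (mem_chords.mp hx).2.2
  have hSt : S ⊆ N t := fun x hx => (mem_chords.mp hx).2.1
  have hYt : E t w ⊆ N t := fun x hx => h.mem hw hx
  have hn : S.card + (E t w).card + 1 ≤ (N t).card := by
    rw [← Finset.card_union_of_disjoint hYS, ← Finset.card_insert_of_notMem (a := w)
      (by simp [hSw, hYw])]
    exact Finset.card_le_card (Finset.insert_subset hw (Finset.union_subset hSt hYt))
  have hww : 3 * S.card ≤ weight N E t O w := Nat.le_add_right _ _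
  have hEt : E t v ⊆ S := (Finset.subset_insert _ _).trans (hp.insert_subset h)
  -- if only five chords end at `w`, then the vertices of the link of `tv` weigh at least five
  have hx5 : ∀ x ∈ E t v, S.card ≤ 5 → 5 ≤ weight N E t O x := fun x hx hc =>
    h.five_le_weight (h.mem hv hx) fun w' => hp.not_of_mem h hc hx
  by_cases hy : ∃ y ∈ E t w, ∃ w', IsPendant N E t O y w'
  · obtain ⟨y, hy, w', hp'⟩ := hy
    obtain ⟨h5', hw'⟩ := hp'.five_le_card_chords h
    have hne : w ≠ w' := by
      rintro rfl
      have : w ∈ chords N E t y := by rw [hp'.2.1]; simp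
      exact (mem_chords.mp this).2.2 (h.rotate hw hy)
    have hww' : 15 ≤ weight N E t O w' := by rw [weight]; omega
    have hcard := Finset.pred_card_le_card_erase (s := E t v) (a := w')
    by_cases hc : S.card ≤ 5
    · have := le_sum_of_forall_le (A := N t) (S := (E t v).erase w') (f := weight N E t O) (b := 3)
        (c := 3 * S.card - 3) (d := 12)
        (((Finset.erase_subset _ _).trans hEt).trans hSt) hw hw' (by
          intro x hx
          have h3 := h.three_le_weight hx
          by_cases hxw : x = w
          · subst hxw
            have : x ∉ (E t v).erase w' := fun hh => hSw (hEt (Finset.mem_of_mem_erase hh))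
            simp only [if_true, hne, this, if_false]
            omega
          by_cases hxw' : x = w'
          · subst hxw'
            simp only [hxw, if_true, if_false, Finset.mem_erase, ne_eq, not_true, false_and]
            omega
          by_cases hxS : x ∈ (E t v).erase w'
          · have := hx5 x (Finset.mem_of_mem_erase hxS) hc
            simp only [hxw, hxw', hxS, if_true, if_false]
            omega
          · simp only [hxw, hxw', hxS, if_false]
            omega)
      omega
    · have := le_sum_of_forall_le (A := N t) (S := ∅) (f := weight N E t O) (b := 3)
        (c := 3 * S.card - 3) (d := 12) (Finset.empty_subset _) hw hw' (by
          intro x hx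
          have h3 := h.three_le_weight hx
          by_cases hxw : x = w
          · subst hxw
            simp only [if_true, hne, Finset.notMem_empty, if_false]
            omega
          by_cases hxw' : x = w'
          · subst hxw'
            simp only [hxw, if_true, if_false, Finset.notMem_empty]
            omega
          simp only [hxw, hxw', Finset.notMem_empty, if_false]
          omega)
      simp only [Finset.card_empty] at this
      omega
  · push Not at hy
    have hy5 : ∀ y ∈ E t w, 5 ≤ weight N E t O y := fun y hy' =>
      h.five_le_weight (hYt hy') (hy y hy')
    by_cases hc : S.card ≤ 5
    · have hd : Disjoint (E t v) (E t w) := Finset.disjoint_of_subset_left hEt hYS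
      have := le_sum_of_forall_le (A := N t) (S := E t v ∪ E t w) (f := weight N E t O) (b := 3)
        (c := 3 * S.card - 3) (d := 0) (Finset.union_subset (hEt.trans hSt) hYt) hw hw (by
          intro x hx
          have h3 := h.three_le_weight hx
          by_cases hxw : x = w
          · subst hxw
            have : x ∉ E t v ∪ E t x := by
              rw [Finset.mem_union, not_or]; exact ⟨fun hh => hSw (hEt hh), hYw⟩
            simp only [if_true, this, if_false]
            omega
          by_cases hxS : x ∈ E t v ∪ E t w
          · have : 5 ≤ weight N E t O x := by
              rcases Finset.mem_union.mp hxS with hh | hh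
              · exact hx5 x hh hc
              · exact hy5 x hh
            simp only [hxw, hxS, if_true, if_false]
            omega
          · simp only [hxw, hxS, if_false]
            omega)
      rw [Finset.card_union_of_disjoint hd] at this
      omega
    · have := le_sum_of_forall_le (A := N t) (S := E t w) (f := weight N E t O) (b := 3)
        (c := 3 * S.card - 3) (d := 0) hYt hw hw (by
          intro x hx
          have h3 := h.three_le_weight hx
          by_cases hxw : x = w
          · subst hxw
            simp only [if_true, hYw, if_false]
            omega
          by_cases hxS : x ∈ E t w
          · have := hy5 x hxS
            simp only [hxw, hxS, if_true, if_false]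
            omega
          · simp only [hxw, hxS, if_false]
            omega)
      omega

theorem sum_weight_of_not_pendant (h : LinkSystem N E t O) (hn : (N t).Nonempty)
    (hp : ∀ v w, ¬ IsPendant N E t O v w)
    (hE : 6 * (N t).card ≤ ∑ v ∈ N t, (E t v).card) :
    55 ≤ ∑ x ∈ N t, weight N E t O x := by
  have h5 : ∀ v ∈ N t, 5 ≤ weight N E t O v := fun v hv => h.five_le_weight hv (hp v)
  -- the chords: there are at most `n (n - 7)` pairs
  have hD : ∑ v ∈ N t, (chords N E t v).card + 7 * (N t).card ≤ (N t).card * (N t).card := by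
    have h1 : ∑ v ∈ N t, ((E t v).card + (chords N E t v).card + 1) ≤
        ∑ _v ∈ N t, (N t).card := Finset.sum_le_sum fun v hv => by
      rw [h.card_add_card_chords hv]; exact h.card_inter_add_one_le hv
    simp only [Finset.sum_add_distrib, Finset.sum_const, smul_eq_mul, mul_one] at h1
    omega
  have hD1 : (N t).card ≤ ∑ v ∈ N t, (chords N E t v).card := by
    have := Finset.card_nsmul_le_sum (N t) (fun v => (chords N E t v).card) 1
      fun v hv => h.one_le_card_chords hv
    simpa using this
  have hpos := Finset.card_pos.mpr hn
  have h8 : 8 ≤ (N t).card := by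
    by_contra hlt
    nlinarith
  by_cases h11 : 11 ≤ (N t).card
  · have := Finset.card_nsmul_le_sum (N t) (fun x => weight N E t O x) 5 h5
    rw [smul_eq_mul] at this
    omega
  -- a vertex of weight at most six has a chord to a vertex with at least four chords
  have hr : ∀ v ∈ N t, weight N E t O v ≤ 6 →
      ∃ r ∈ chords N E t v, r ∈ N t ∧ 4 ≤ (chords N E t r).card := by
    intro v hv hle
    have h1 := h.one_le_card_chords hv
    obtain ⟨r, hr⟩ := Finset.card_pos.mp h1
    have h6 := h.six_le_of_chord hv hr
    rw [weight] at hle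
    exact ⟨r, hr, (mem_chords.mp hr).2.1, by omega⟩
  by_cases hall : ∀ v ∈ N t, 7 ≤ weight N E t O v
  · have := Finset.card_nsmul_le_sum (N t) (fun x => weight N E t O x) 7 hall
    rw [smul_eq_mul] at this
    omega
  push Not at hall
  obtain ⟨v, hv, hlt⟩ := hall
  obtain ⟨r, hvr, hrt, hr4⟩ := hr v hv (by omega)
  have hr12 : 12 ≤ weight N E t O r := by rw [weight]; omega
  by_cases h8' : (N t).card = 8
  · exfalso
    rw [h8'] at hD hD1
    have h1 := le_sum_of_forall_le (A := N t) (S := ∅) (f := fun v => (chords N E t v).card)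
      (b := 1) (c := 3) (d := 0) (Finset.empty_subset _) hrt hrt (by
        intro x hx
        have := h.one_le_card_chords hx
        by_cases hxr : x = r
        · subst hxr
          simp only [if_true, Finset.notMem_empty, if_false]
          omega
        · simp only [hxr, Finset.notMem_empty, if_false]
          omega)
    omega
  have hYr : r ∉ E t r := (h.notMem_self hrt).2
  have hY4 := h.four_le hrt
  by_cases hy : ∃ y ∈ E t r, weight N E t O y ≤ 6
  · obtain ⟨y, hy, hle⟩ := hy
    obtain ⟨r', hyr', hrt', hr4'⟩ := hr y (h.mem hrt hy) hle
    have hr12' : 12 ≤ weight N E t O r' := by rw [weight]; omega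
    have hne : r ≠ r' := by
      rintro rfl
      exact (mem_chords.mp hyr').2.2 (h.rotate hrt hy)
    have := le_sum_of_forall_le (A := N t) (S := ∅) (f := weight N E t O)
      (b := 5) (c := 7) (d := 7) (Finset.empty_subset _) hrt hrt' (by
        intro x hx
        have := h5 x hx
        by_cases hxr : x = r
        · subst hxr
          simp only [if_true, hne, Finset.notMem_empty, if_false]
          omega
        by_cases hxr' : x = r'
        · subst hxr'
          simp only [hxr, if_true, Finset.notMem_empty, if_false]
          omega
        simp only [hxr, hxr', Finset.notMem_empty, if_false]
        omega)
    omega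
  · push Not at hy
    have := le_sum_of_forall_le (A := N t) (S := E t r) (f := weight N E t O)
      (b := 5) (c := 7) (d := 0) (fun x hx => h.mem hrt hx) hrt hrt (by
        intro x hx
        have := h5 x hx
        by_cases hxr : x = r
        · subst hxr
          simp only [if_true, hYr, if_false]
          omega
        by_cases hxY : x ∈ E t r
        · have := hy x hxY
          simp only [hxr, hxY, if_true, if_false]
          omega
        · simp only [hxr, hxY, if_false]
          omega)
    omega

/-- The lower bound for the sum of all degrees. -/
theorem le_sum_degrees (h : LinkSystem N E t O) (hn : (N t).Nonempty)
    (hne : ∀ u ∈ O, (N u).Nonempty) {k : ℕ} (hk : 1 ≤ k)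
    (hE : ∑ v ∈ N t, (E t v).card + 12 = 6 * (N t).card + 12 * k)
    (heven : Even ((N t).card + ∑ v ∈ N t, (N v).card + ∑ u ∈ O, (N u).card)) :
    8 * (1 + (N t).card + O.card) + 12 * k ≤
      (N t).card + ∑ v ∈ N t, (N v).card + ∑ u ∈ O, (N u).card := by
  have h55 : 55 ≤ ∑ x ∈ N t, weight N E t O x := by
    by_cases hp : ∃ v w, IsPendant N E t O v w
    · obtain ⟨v, w, hp⟩ := hp
      exact h.sum_weight_of_pendant hp
    · push Not at hp
      exact h.sum_weight_of_not_pendant hn hp (by omega)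
  have hO := h.card_outside_le hne
  have hA : ∑ v ∈ N t, (N v).card = (N t).card + ∑ v ∈ N t, (E t v).card +
      ∑ v ∈ N t, (chords N E t v).card + ∑ v ∈ N t, (N v ∩ O).card := by
    rw [Finset.sum_congr rfl fun v hv => h.card_eq_of_mem hv]
    simp only [Finset.sum_add_distrib, Finset.sum_const, smul_eq_mul, mul_one]
  simp only [weight, Finset.sum_add_distrib, ← Finset.mul_sum] at h55
  obtain ⟨m, hm⟩ := heven
  omega

end LinkSystem

/-! ### The edge count for irreducible pseudomanifolds -/

/-- Three pairwise adjacent vertices `a`, `b`, `c` of the link of a non-singular vertex `x` span a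
tetrahedron with `x`. -/
theorem insert_triple_mem [Infinite V] {K : PreAbstractSimplicialComplex V}
    (hK : IsPM 3 K) (hm : NoMissingTetrahedra K) (hr : ¬ IsReducible K) {x a b c : V}
    (hx : IsNonsingular K x) (ha : Ext K {x} a) (hb : Ext K {x, a} b) (hc : Ext K {x, a} c)
    (hc' : Ext K {x, b} c) : insert x {a, b, c} ∈ K.faces := by
  have h1 := ha.1
  have h2 := hb.1
  have h3 := hc.1
  have h4 := hc'.1
  simp only [Finset.mem_insert, Finset.mem_singleton, not_or] at h1 h2 h3 h4
  have hT : ({a, b, c} : Finset V).card = 3 :=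
    Finset.card_eq_three.mpr ⟨a, b, c, Ne.symm h2.2, Ne.symm h3.2, Ne.symm h4.2, rfl⟩
  have e : ∀ {p q : V}, Ext K {x, p} q → insert x {p, q} ∈ K.faces := fun {p q} h =>
    face_congr h.2 (by ext z; simp only [Finset.mem_insert, Finset.mem_singleton]; tauto)
  have e' : ∀ {p q : V}, Ext K {x, p} q → insert x {q, p} ∈ K.faces := fun {p q} h => by
    rw [Finset.pair_comm]; exact e h
  refine insert_mem_of_forall_pair hK hm hr hx hT ?_ ?_
  · simp only [Finset.mem_insert, Finset.mem_singleton, not_or]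
    exact ⟨Ne.symm h1, Ne.symm h2.1, Ne.symm h3.1⟩
  · intro s hs hcard
    obtain ⟨p, q, hpq, rfl⟩ := Finset.card_eq_two.mp hcard
    have hp := hs (show p ∈ ({p, q} : Finset V) by simp)
    have hq := hs (show q ∈ ({p, q} : Finset V) by simp)
    simp only [Finset.mem_insert, Finset.mem_singleton] at hp hq
    rcases hp with rfl | rfl | rfl <;> rcases hq with rfl | rfl | rfl <;>
      first
      | exact absurd rfl hpq
      | exact e ‹_›
      | exact e' ‹_›

/-- An irreducible complex with at most one singular vertex, and with more than five vertices, obeys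
the rules of the count. -/
theorem linkSystem_of_irreducible [Infinite V] {K : PreAbstractSimplicialComplex V}
    (hK : IsPM 3 K) (hm : NoMissingTetrahedra K) (hr : ¬ IsReducible K) {t : V}
    (hns : ∀ u, u ≠ t → {u} ∈ K.faces → IsNonsingular K u)
    (hlarge : ∀ Z : Finset V, Z.card = 5 → ∃ σ ∈ K.faces, ¬ σ ⊆ Z) :
    LinkSystem (fun u => exts hK.finite {u}) (fun u v => exts hK.finite {u, v}) t
      (exts hK.finite ∅ \ insert t (exts hK.finite {t})) := by
  have hns' : ∀ {u v}, u ≠ t → Ext K {u} v → IsNonsingular K u := fun {u v} hu hv =>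
    hns u hu (face_mono hv.2 (by simp) (by simp))
  have hpair : ∀ {u v}, Ext K {u} v → u ≠ v ∧ {u, v} ∈ K.faces := fun {u v} h =>
    ⟨by simpa [eq_comm] using h.1, by rw [Finset.pair_comm]; exact h.2⟩
  refine ⟨?_, ?_, ?_, ?_, ?_, ?_, ?_, ?_, ?_, ?_, ?_⟩
  · intro u hu
    exact (mem_exts.mp hu).1 (by simp)
  · intro u v hv
    obtain ⟨h1, h2⟩ := hpair (mem_exts.mp hv)
    exact mem_exts.mpr ⟨by simpa using h1, h2⟩
  · intro u v
    simp only [Finset.pair_comm]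
  · intro u v w hv hw
    obtain ⟨h1, h2⟩ := mem_exts.mp hw
    exact mem_exts.mpr ⟨fun hh => h1 (Finset.mem_insert.mpr (Or.inl (Finset.mem_singleton.mp hh))),
      face_mono h2 (Finset.insert_subset_insert _ (by simp)) (by simp)⟩
  · intro u v w hv hw
    obtain ⟨h1, h2⟩ := mem_exts.mp hw
    obtain ⟨h3, -⟩ := hpair (mem_exts.mp hv)
    refine mem_exts.mpr ⟨?_, face_congr h2 ?_⟩
    · simp only [Finset.mem_insert, Finset.mem_singleton, not_or] at h1 ⊢
      exact ⟨Ne.symm h3, Ne.symm h1.2⟩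
    · ext z; simp only [Finset.mem_insert, Finset.mem_singleton]; tauto
  · intro u v hv
    obtain ⟨h1, h2⟩ := hpair (mem_exts.mp hv)
    exact four_le_card_exts hK hm hr hlarge h1 h2
  · intro u v hv hu
    obtain ⟨h1, h2⟩ := hpair (mem_exts.mp hv)
    obtain ⟨w, h3, h4, h5⟩ := exists_missing_triangle hK hm hr h1 h2 (hns' hu (mem_exts.mp hv))
      (four_le_card_exts hK hm hr hlarge h1 h2)
    exact ⟨w, mem_exts.mpr h3, mem_exts.mpr h4, fun hh => h5 (mem_exts.mp hh)⟩
  · intro x u v w hx hu hv hw hw'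
    rw [mem_exts] at hu hv hw hw'
    have := insert_triple_mem hK hm hr (hns' hx hu) hu hv hw hw'
    refine mem_exts.mpr ⟨?_, face_mono this ?_ (by simp)⟩
    · have h1 := hw.1
      have h2 := hw'.1
      simp only [Finset.mem_insert, Finset.mem_singleton, not_or] at h1 h2 ⊢
      exact ⟨h1.2, h2.2⟩
    · intro z; simp only [Finset.mem_insert, Finset.mem_singleton]; tauto
  · intro v a b hv ha hb
    rw [mem_exts] at ha hb
    have h2 : (exts hK.finite (insert b {v, a})).card = 2 :=
      (twoExt_triangle hK (hpair ha).1 hb).card_exts hK.finite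
    rw [← h2]
    refine Finset.card_le_card fun y hy => ?_
    obtain ⟨h3, h4⟩ := Finset.mem_inter.mp hy
    rw [mem_exts] at h3 h4
    have := insert_triple_mem hK hm hr (hns' hv ha) ha hb h3 h4
    refine mem_exts.mpr ⟨?_, face_congr this ?_⟩
    · have h5 := h3.1
      have h6 := h4.1
      simp only [Finset.mem_insert, Finset.mem_singleton, not_or] at h5 h6 ⊢
      exact ⟨h6.2, h5.1, h5.2⟩
    · ext z; simp only [Finset.mem_insert, Finset.mem_singleton]; tauto
  · intro u hu
    obtain ⟨-, h1⟩ := Finset.mem_sdiff.mp hu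
    rwa [Finset.mem_insert, not_or] at h1
  · intro u v hv
    have h1 : v ∈ exts hK.finite ∅ :=
      mem_exts.mpr ⟨by simp, face_mono (mem_exts.mp hv).2 (by simp) (by simp)⟩
    simp only [Finset.mem_sdiff, Finset.mem_insert]
    tauto

/-- A vertex whose link has Euler characteristic at most zero has more than four neighbours. -/
theorem exists_not_subset {K : PreAbstractSimplicialComplex V} (hK : IsPM 3 K) {t : V}
    (ht : {t} ∈ K.faces) (hχ : eulerChar (link K {t}) ≤ 0) {Z : Finset V} (hZ : Z.card = 5) :
    ∃ σ ∈ K.faces, ¬ σ ⊆ Z := by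
  by_contra! hall
  have htZ : t ∈ Z := hall _ ht (by simp)
  have hsub : exts hK.finite {t} ⊆ Z.erase t := by
    intro x hx
    obtain ⟨h1, h2⟩ := mem_exts.mp hx
    exact Finset.mem_erase.mpr ⟨by simpa using h1, hall _ h2 (by simp)⟩
  have hcard := Finset.card_le_card hsub
  rw [Finset.card_erase_of_mem htZ, hZ] at hcard
  have hle : ∑ v ∈ exts hK.finite {t}, (exts hK.finite {t, v}).card ≤
      (exts hK.finite {t}).card * 3 := by
    rw [← smul_eq_mul]
    refine Finset.sum_le_card_nsmul _ _ _ fun v hv => ?_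
    have hs : exts hK.finite {t, v} ⊆ (exts hK.finite {t}).erase v := by
      intro x hx
      obtain ⟨h1, h2⟩ := mem_exts.mp hx
      simp only [Finset.mem_insert, Finset.mem_singleton, not_or] at h1
      exact Finset.mem_erase.mpr ⟨h1.2, mem_exts.mpr ⟨by simpa using h1.1,
        face_mono h2 (Finset.insert_subset_insert _ (by simp)) (by simp)⟩⟩
    have := Finset.card_le_card hs
    rw [Finset.card_erase_of_mem hv] at this
    omega
  obtain ⟨x, hx⟩ := exists_ext hK ht (by simp)
  have hpos := Finset.card_pos.mpr ⟨x, mem_exts (h := hK.finite).mpr hx⟩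
  have := hK.sum_card_exts_pair ht
  omega

/-- The bound on the number of edges, for a complex that is irreducible and has at most one singular
vertex `t`, the link of which has Euler characteristic `2 - 2k` with `k ≥ 1`. -/
theorem four_mul_add_le_card_edges [Infinite V] {K : PreAbstractSimplicialComplex V}
    (hK : IsPM 3 K) (hm : NoMissingTetrahedra K) (hr : ¬ IsReducible K) {t : V}
    (ht : {t} ∈ K.faces) (hns : ∀ u, u ≠ t → {u} ∈ K.faces → IsNonsingular K u) {k : ℕ}
    (hk : 1 ≤ k) (hχ : eulerChar (link K {t}) = 2 - 2 * k) :
    4 * fNum K 0 + 6 * k ≤ fNum K 1 := by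
  have hsys := linkSystem_of_irreducible hK hm hr hns
    fun Z hZ => exists_not_subset hK ht (by omega) hZ
  have hnonempty : ∀ u, {u} ∈ K.faces → (exts hK.finite {u}).Nonempty := fun u hu =>
    let ⟨x, hx⟩ := exists_ext hK hu (by simp)
    ⟨x, mem_exts.mpr hx⟩
  set O := exts hK.finite ∅ \ insert t (exts hK.finite {t}) with hO
  have htN : t ∉ exts hK.finite {t} := fun hh => (mem_exts.mp hh).1 (by simp)
  have hsub : insert t (exts hK.finite {t}) ⊆ exts hK.finite ∅ := by
    intro x hx
    refine mem_exts.mpr ⟨by simp, ?_⟩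
    rcases Finset.mem_insert.mp hx with rfl | hx
    · simpa using ht
    · exact face_mono (mem_exts.mp hx).2 (by simp) (by simp)
  have hsum : ∀ f : V → ℕ, ∑ u ∈ exts hK.finite ∅, f u =
      f t + ∑ v ∈ exts hK.finite {t}, f v + ∑ u ∈ O, f u := by
    intro f
    rw [← Finset.sum_sdiff hsub, Finset.sum_insert htN, ← hO, add_comm]
  have h0 : fNum K 0 = 1 + (exts hK.finite {t}).card + O.card := by
    rw [fNum_eq hK.finite, card_facesOfCard_one, Finset.card_eq_sum_ones, hsum]
    simp
  have h1 : 2 * fNum K 1 = (exts hK.finite {t}).card +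
      ∑ v ∈ exts hK.finite {t}, (exts hK.finite {v}).card +
      ∑ u ∈ O, (exts hK.finite {u}).card := by
    rw [fNum_eq hK.finite, ← sum_card_exts, hsum]
  have hE := hK.sum_card_exts_pair ht
  rw [hχ] at hE
  have := hsys.le_sum_degrees (hnonempty t ht) (fun u hu => hnonempty u (by
    have := (mem_exts.mp (Finset.mem_sdiff.mp hu).1).2
    simpa using this)) hk (by omega) ⟨fNum K 1, by rw [← h1]; ring⟩
  omega

end SimplicialPM

theorem mainTheorem4 {V : Type*} [DecidableEq V] [Infinite V]
    (K : PreAbstractSimplicialComplex V) (hK : SimplicialPM.InR1 K)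
    (t : V) (ht : {t} ∈ K.faces) (h : ℕ)
    (hlink : SimplicialPM.IsSumOfCopies SimplicialPM.IsTorus h (SimplicialPM.link K {t}) ∨
      SimplicialPM.IsSumOfCopies SimplicialPM.IsKleinBottle h (SimplicialPM.link K {t})) :
    4 * SimplicialPM.fNum K 0 + 6 * h ≤ SimplicialPM.fNum K 1 ∧
      10 + 6 * (h : ℤ) ≤ SimplicialPM.g2 K := by
  have hPM := hK.normal.isPM
  obtain ⟨hh, hfin, hχ⟩ : 1 ≤ h ∧ (SimplicialPM.link K {t}).faces.Finite ∧
      SimplicialPM.eulerChar (SimplicialPM.link K {t}) = 2 - 2 * h := by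
    rcases hlink with hl | hl
    · exact hl.finite_and_eulerChar fun _ => SimplicialPM.IsTorus.finite_and_eulerChar
    · exact hl.finite_and_eulerChar fun _ => SimplicialPM.IsKleinBottle.finite_and_eulerChar
  have hsing : SimplicialPM.IsSingular K t := by
    refine ⟨ht, fun hs => ?_⟩
    have := hs.eulerChar hfin
    omega
  have hns : ∀ u, u ≠ t → {u} ∈ K.faces → SimplicialPM.IsNonsingular K u := by
    intro u hut hu
    refine ⟨hu, ?_⟩
    by_contra hs
    exact hut (hK.one_singularity.unique ⟨hu, hs⟩ hsing)
  have key := SimplicialPM.four_mul_add_le_card_edges hPM hK.no_missing hK.irreducible ht hns hh hχ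
  refine ⟨key, ?_⟩
  rw [SimplicialPM.g2]
  omega
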